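/- **Setting.** Write $u_{(i,j)}$ for the value of $u:\mathbb Z^2\to\mathbb C$ at $(n+i,m+j)$, and $\mathcal S_n,\mathcal S_m$ for the shifts in $n$ and $m$ (acting on functions of $n,m$ and the $u_{(i,j)}$). An ABS equation is $$Q(u_{(0,0)},u_{(1,0)},u_{(0,1)},u_{(1,1)};\alpha,\beta)=0,\qquad \alpha\neq\beta,$$ $$Q(u,x,y,z)=a_1uxyz+a_2(uyz+xyz+uxz+uxy)+a_3(ux+yz)+a_4(uz+xy)+a_5(xz+uy)+a_6(u+x+y+z)+a_7 ,$$ where $(a_1,\dots,a_7)$, a biquadratic polynomial $f(u,x,\alpha)$, symmetric in $u,x$, and a function $r$ are, with constants $\delta,g_2,g_3\in\mathbb C$: * H1: $(0,0,1,0,-1,0,\beta-\alpha)$; $f=1$; $r=1$. * H2: $(0,0,1,0,-1,\beta-\alpha,\beta^2-\alpha^2)$; $f=2(u+x+\alpha)$; $r=1$. * H3: $(0,0,\alpha,0,-\beta,0,\delta(\alpha^2-\beta^2))$; $f=ux+\alpha\delta$; $r(\alpha)=-\alpha/2$. * Q1: $(0,0,\alpha,\beta-\alpha,-\beta,0,\delta^2\alpha\beta(\alpha-\beta))$;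 $f=((u-x)^2-\alpha^2\delta^2)/\alpha$; $r=1$ ($\alpha,\beta\ne0$). * Q2: $(0,0,\alpha,\beta-\alpha,-\beta,\alpha\beta(\alpha-\beta),\alpha\beta(\beta-\alpha)(\alpha^2-\alpha\beta+\beta^2))$; $f=((u-x)^2-2\alpha^2(u+x)+\alpha^4)/\alpha$; $r=1$ ($\alpha,\beta\ne0$). * Q3: $\big(0,0,\beta(\alpha^2-1),\beta^2-\alpha^2,\alpha(1-\beta^2),0,-\tfrac{\delta^2(\alpha^2-\beta^2)(\alpha^2-1)(\beta^2-1)}{4\alpha\beta}\big)$; $f=-\tfrac{4\alpha(x-\alpha u)(\alpha x-u)+(\alpha^2-1)^2\delta^2}{4\alpha(\alpha^2-1)}$; $r(\alpha)=-\alpha/2$ ($\alpha,\beta\ne0,\pm1$). * Q4: $a_1=a+b$, $a_2=-a\beta-b\alpha$, $a_3=\tfrac{ab(a+b)}{2(\alpha-\beta)}+a\beta^2-(2\alpha^2-\tfrac{g_2}4)b$, $a_4=a\beta^2+b\alpha^2$, $a_5=\tfrac{ab(a+b)}{2(\beta-\alpha)}+b\alpha^2-(2\beta^2-\tfrac{g_2}4)a$,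 $a_6=\tfrac{g_3}2a_1-\tfrac{g_2}4a_2$, $a_7=\tfrac{g_2^2}{16}a_1-g_3a_2$, where $a=a(\alpha)\ne0$ and $b=b(\beta)\neq0$ are values of local holomorphic branches of $\sqrt{4x^3-g_2x-g_3}$ at $\alpha$ and at $\beta$; $f=\big((ux+\alpha(u+x)+\tfrac{g_2}4)^2-(u+x+\alpha)(4\alpha ux-g_3)\big)/a$; $r(\alpha)=-a/2$. In the direction $m$, $f(u,x,\beta)$ and $r(\beta)$ are obtained by replacing $\alpha$ (and $a$) by $\beta$ (and $b$). Put $$R_n^{[0]}=\frac{f(u_{(0,0)},u_{(1,0)},\alpha)}{u_{(1,0)}-u_{(-1,0)}}-\tfrac12 f_{,u_{(1,0)}}(u_{(0,0)},u_{(1,0)},\alpha),\qquad \mathbf v_n^{[0]}=\mathbf v_n=R_n^{[0]}\partial_{u_{(0,0)}},\qquad \mathbf V_n=nR_n^{[0]}\partial_{u_{(0,0)}}-r(\alpha)\partial_\alpha ,$$ and define $R^{[0]}_m$, $\mathbf v_m^{[0]}=\mathbf v_m$, $\mathbf V_m$ in the same way with $u_{(0,\pm1)},\beta,m$. A vector field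 $R\,\partial_{u_{(0,0)}}+\xi\partial_\alpha+\zeta\partial_\beta$ acts on functions through its prolongation $\sum_{i,j}(\mathcal S_n^{(i)}\mathcal S_m^{(j)}R)\,\partial_{u_{(i,j)}}+\xi\partial_\alpha+\zeta\partial_\beta$, and commutators are formed accordingly. "Solution" means a solution $u$ on all of $\mathbb Z^2$ which is nonsingular, i.e. on every elementary square no first derivative of $Q$ with respect to one of its four vertex values vanishes. A vector field is a (generalized or extended generalized) symmetry if its prolongation annihilates $Q$ on all solutions, and a trivial one if it vanishes on all solutions. Statements about objects of direction $n$ are made where $u_{(i+1,j)}\neq u_{(i-1,j)}$ for all $i,j$, those about direction $m$ where $u_{(i,j+1)}\ne u_{(i,j-1)}$ for all $i,j$, and those about both directions where both hold; except where "on solutions" is said, the identities hold for all such $u$, not only for solutions. **Theorem.** For every ABS equation the following holds for $i=n$ and, with the obvious changes, for $i=m$. 1. $\mathbf V_i$ is an extended generalized symmetry of the equation. It is a master symmetry of $\mathbf v_i^{[0]}$: $[\mathbf V_i,\mathbf v_i^{[0]}]\neq0$ (that is, it is not identically zero) and $[[\mathbf V_i,\mathbf v_i^{[0]}],\mathbf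 v_i^{[0]}]=0$. 2. Let $\mathbf v_i^{[k+1]}:=[\mathbf V_i,\mathbf v_i^{[k]}]$, $k=0,1,\dots$. Every $\mathbf v_i^{[k]}$ is a generalized symmetry of the equation, and $\mathbf v_i^{[k]}=R_i^{[k]}\partial_{u_{(0,0)}}$ with $R_i^{[k]}=\mathcal R_i^{\,k}R_i^{[0]}$, where $$\mathcal R_n=\sum_{\ell\in\mathbb Z}\ell\,\big(\mathcal S_n^{(\ell)}R_n^{[0]}\big)\partial_{u_{(\ell,0)}}-r(\alpha)\partial_\alpha ,\qquad \mathcal R_m=\sum_{\ell\in\mathbb Z}\ell\,\big(\mathcal S_m^{(\ell)}R_m^{[0]}\big)\partial_{u_{(0,\ell)}}-r(\beta)\partial_\beta .$$ $R_n^{[k]}$ is a function of the values of $u$ at the $2k+3$ points $u_{(\ell,0)}$, $|\ell|\le k+1$, only, and it depends on the outermost ones: $\partial R_n^{[k]}/\partial u_{(\pm(k+1),0)}\ne0$ wherever all $f(u_{(\ell,0)},u_{(\ell+1,0)},\alpha)\neq0$. Likewise for $R_m^{[k]}$ and $u_{(0,\ell)}$. 3. The first member is $$R_n^{[1]}=\Big((\mathcal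 S_nR_n^{[0]})\partial_{u_{(1,0)}}-(\mathcal S_n^{(-1)}R_n^{[0]})\partial_{u_{(-1,0)}}-r(\alpha)\partial_\alpha\Big)R_n^{[0]}=\frac{f(u_{(0,0)},u_{(1,0)},\alpha)\,f(u_{(0,0)},u_{(-1,0)},\alpha)\,(u_{(2,0)}-u_{(-2,0)})}{(u_{(1,0)}-u_{(-1,0)})^2(u_{(2,0)}-u_{(0,0)})(u_{(-2,0)}-u_{(0,0)})},$$ and likewise for $R_m^{[1]}$. 4. $[\mathbf v_n^{[1]},\mathbf v_n^{[0]}]=[\mathbf v_m^{[1]},\mathbf v_m^{[0]}]=0$; $[\mathbf V_n,\mathbf v_m^{[0]}]=n[\mathbf v_n^{[0]},\mathbf v_m^{[0]}]$ and $[\mathbf V_m,\mathbf v_n^{[0]}]=m[\mathbf v_m^{[0]},\mathbf v_n^{[0]}]$; and the following are trivial, i.e. vanish on solutions: $[\mathbf v_n,\mathbf v_m]$, $[\mathbf V_n,\mathbf v_m^{[0]}]$, $[\mathbf V_m,\mathbf v_n^{[0]}]$, $[\mathbf v_n^{[1]},\mathbf v_m^{[0]}]$, $[\mathbf v_n^{[1]},\mathbf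 V_m]$, $[\mathbf v_m^{[1]},\mathbf v_n^{[0]}]$, $[\mathbf v_m^{[1]},\mathbf V_n]$, $[\mathbf v_n^{[1]},\mathbf v_m^{[1]}]$. -/

import Mathlib

noncomputable section

namespace ABSLattice

/-! ### Lattice functions and (extended) generalized vector fields -/

/-- The values of the dependent variable around a lattice point: `u (i, j)` is `u_{(i,j)}`,
the value of `u` at `(n + i, m + j)`. -/
abbrev Conf := ℤ × ℤ → ℂ

/-- A function of the lattice point `p = (n, m)`, of the values `u_{(i,j)}` (finitely many of them
in all cases of interest) and of the lattice parameters `α`, `β`: `F p u α β`. -/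
abbrev LatFun := ℤ × ℤ → Conf → ℂ → ℂ → ℂ

/-- The translation operator: `shift (k, l) F = S_n^{(k)} S_m^{(l)} F`. -/
def shift (s : ℤ × ℤ) (F : LatFun) : LatFun :=
  fun p u α β => F (p + s) (fun q => u (q + s)) α β

/-- The partial derivative with respect to `u_{(i,j)}`, where `q = (i, j)`. -/
def dU (q : ℤ × ℤ) (F : LatFun) : LatFun :=
  fun p u α β => deriv (fun x => F p (Function.update u q x) α β) (u q)

/-- The partial derivative with respect to `α`. -/
def dAlpha (F : LatFun) : LatFun := fun p u α β => deriv (fun x => F p u x β) α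

/-- The partial derivative with respect to `β`. -/
def dBeta (F : LatFun) : LatFun := fun p u α β => deriv (fun x => F p u α x) β

/-- An extended generalized vector field `R ∂_{u_{(0,0)}} + ξ(α, β) ∂_α + ζ(α, β) ∂_β`
with characteristic `R`. -/
structure VField where
  char : LatFun
  xi : ℂ → ℂ → ℂ
  zeta : ℂ → ℂ → ℂ

/-- The action on functions of the prolongation
`∑ (S_n^{(i)} S_m^{(j)} R) ∂_{u_{(i,j)}} + ξ ∂_α + ζ ∂_β`
of a vector field to all values of `u`. -/
def VField.apply (v : VField) (F : LatFun) : LatFun := fun p u α β =>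
  (∑ᶠ q : ℤ × ℤ, shift q v.char p u α β * dU q F p u α β)
    + v.xi α β * dAlpha F p u α β + v.zeta α β * dBeta F p u α β

/-- The commutator `[v, w]` of two vector fields. -/
def VField.bracket (v w : VField) : VField where
  char := fun p u α β => v.apply w.char p u α β - w.apply v.char p u α β
  xi := fun α β =>
    (v.xi α β * deriv (fun x => w.xi x β) α + v.zeta α β * deriv (fun y => w.xi α y) β)
    - (w.xi α β * deriv (fun x => v.xi x β) α + w.zeta α β * deriv (fun y => v.xi α y) β)
  zeta := fun α β =>
    (v.xi α β * deriv (fun x => w.zeta x β) α + v.zeta α β * deriv (fun y => w.zeta α y) β)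
    - (w.xi α β * deriv (fun x => v.zeta x β) α + w.zeta α β * deriv (fun y => v.zeta α y) β)

/-- The generalized vector field `R ∂_{u_{(0,0)}}`. -/
def ofChar (R : LatFun) : VField := ⟨R, fun _ _ => 0, fun _ _ => 0⟩

/-- Equality of two vector fields at the parameters `(α, β)`, identically in the lattice point and
in the configurations belonging to `D`. -/
def EqAt (D : Set Conf) (α β : ℂ) (v w : VField) : Prop :=
  (∀ p, ∀ u ∈ D, v.char p u α β = w.char p u α β) ∧
    v.xi α β = w.xi α β ∧ v.zeta α β = w.zeta α β

/-- The sequence `v, [V, v], [V, [V, v]], …`. -/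
def hierarchy (V v : VField) : ℕ → VField
  | 0 => v
  | k + 1 => V.bracket (hierarchy V v k)

/-- `V` is a master symmetry of `v`: `[V, v] ≠ 0` and `[[V, v], v] = 0`. -/
def IsMasterSymmetry (D : Set Conf) (α β : ℂ) (V v : VField) : Prop :=
  ¬ EqAt D α β (V.bracket v) (ofChar 0) ∧
    EqAt D α β ((V.bracket v).bracket v) (ofChar 0)

/-! ### The Adler-Bobenko-Suris equations -/

/-- The equations of the list, with their free constants. -/
inductive ABS : Type
  | H1
  | H2
  | H3 (δ : ℂ)
  | Q1 (δ : ℂ)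
  | Q2
  | Q3 (δ : ℂ)
  | Q4 (g₂ g₃ : ℂ)

/-- The affine-linear function with seven coefficients, with arguments
`u = u_{(0,0)}`, `x = u_{(1,0)}`, `y = u_{(0,1)}`, `z = u_{(1,1)}`. -/
def affineQ (a₁ a₂ a₃ a₄ a₅ a₆ a₇ u x y z : ℂ) : ℂ :=
  a₁ * u * x * y * z + a₂ * (u * y * z + x * y * z + u * x * z + u * x * y)
    + a₃ * (u * x + y * z) + a₄ * (u * z + x * y) + a₅ * (x * z + u * y)
    + a₆ * (u + x + y + z) + a₇

/-- The function `Q(u, x, y, z; α, β)` of an equation. Only for `Q4` the functions `A`, `B` matter: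
they are branches of `√(4x³ - g₂x - g₃)` near `α` and near `β`, and `a = A α`, `b = B β`. -/
def ABS.Q (e : ABS) (A B : ℂ → ℂ) (u x y z α β : ℂ) : ℂ :=
  match e with
  | .H1 => affineQ 0 0 1 0 (-1) 0 (β - α) u x y z
  | .H2 => affineQ 0 0 1 0 (-1) (β - α) (β ^ 2 - α ^ 2) u x y z
  | .H3 δ => affineQ 0 0 α 0 (-β) 0 (δ * (α ^ 2 - β ^ 2)) u x y z
  | .Q1 δ => affineQ 0 0 α (β - α) (-β) 0 (δ ^ 2 * α * β * (α - β)) u x y z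
  | .Q2 => affineQ 0 0 α (β - α) (-β) (α * β * (α - β))
      (α * β * (β - α) * (α ^ 2 - α * β + β ^ 2)) u x y z
  | .Q3 δ => affineQ 0 0 (β * (α ^ 2 - 1)) (β ^ 2 - α ^ 2) (α * (1 - β ^ 2)) 0
      (-(δ ^ 2 * (α ^ 2 - β ^ 2) * (α ^ 2 - 1) * (β ^ 2 - 1)) / (4 * α * β)) u x y z
  | .Q4 g₂ g₃ =>
      let a := A α
      let b := B β
      let a₁ := a + b
      let a₂ := -(a * β) - b * α
      affineQ a₁ a₂
        (a * b * (a + b) / (2 * (α - β)) + a * β ^ 2 - (2 * α ^ 2 - g₂ / 4) * b)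
        (a * β ^ 2 + b * α ^ 2)
        (a * b * (a + b) / (2 * (β - α)) + b * α ^ 2 - (2 * β ^ 2 - g₂ / 4) * a)
        (g₃ / 2 * a₁ - g₂ / 4 * a₂)
        (g₂ ^ 2 / 16 * a₁ - g₃ * a₂) u x y z

/-- The symmetric biquadratic polynomial `f(u, x, c)` of an equation, where `c` is `α` or `β` and
`s` is the branch of the square root belonging to `c` (used for `Q4` only). -/
def ABS.f (e : ABS) (s : ℂ → ℂ) (u x c : ℂ) : ℂ :=
  match e with
  | .H1 => 1
  | .H2 => 2 * (u + x + c)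
  | .H3 δ => u * x + c * δ
  | .Q1 δ => ((u - x) ^ 2 - c ^ 2 * δ ^ 2) / c
  | .Q2 => ((u - x) ^ 2 - 2 * c ^ 2 * (u + x) + c ^ 4) / c
  | .Q3 δ => -1 / (4 * c * (c ^ 2 - 1)) *
      (4 * c * (x - c * u) * (c * x - u) + (c ^ 2 - 1) ^ 2 * δ ^ 2)
  | .Q4 g₂ g₃ => ((u * x + c * (u + x) + g₂ / 4) ^ 2 - (u + x + c) * (4 * c * u * x - g₃)) / s c

/-- The function `r`; for `Q4` it is `-½ √(4x³ - g₂x - g₃)`. -/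
def ABS.r (e : ABS) (s : ℂ → ℂ) (c : ℂ) : ℂ :=
  match e with
  | .H1 => 1
  | .H2 => 1
  | .H3 _ => -c / 2
  | .Q1 _ => 1
  | .Q2 => 1
  | .Q3 _ => -c / 2
  | .Q4 _ _ => -(1 / 2) * s c

/-- The equation is defined at the parameter value `c`: no denominator vanishes and, for `Q4`,
`s` is a holomorphic branch of `√(4x³ - g₂x - g₃)` near `c`. -/
def ABS.Admissible (e : ABS) (s : ℂ → ℂ) (c : ℂ) : Prop :=
  match e with
  | .H1 => True
  | .H2 => True
  | .H3 _ => True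
  | .Q1 _ => c ≠ 0
  | .Q2 => c ≠ 0
  | .Q3 _ => c ≠ 0 ∧ c ^ 2 ≠ 1
  | .Q4 g₂ g₃ => s c ≠ 0 ∧
      ∀ᶠ x in nhds c, DifferentiableAt ℂ s x ∧ s x ^ 2 = 4 * x ^ 3 - g₂ * x - g₃

/-- The left-hand side of the lattice equation `Q(u_{(0,0)}, u_{(1,0)}, u_{(0,1)}, u_{(1,1)}) = 0`
as a lattice function. -/
def ABS.quad (e : ABS) (A B : ℂ → ℂ) : LatFun :=
  fun _ u α β => e.Q A B (u (0, 0)) (u (1, 0)) (u (0, 1)) (u (1, 1)) α β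

/-- `u` solves the equation on the whole lattice, and on every elementary square each of
the four values of `u` is determined by the other three, i.e. no first derivative of
the affine-linear function `Q` with respect to a vertex value vanishes. -/
def ABS.solutions (e : ABS) (A B : ℂ → ℂ) (α β : ℂ) : Set Conf :=
  {u | ∀ s : ℤ × ℤ, shift s (e.quad A B) 0 u α β = 0 ∧
    ∀ c ∈ ({(0, 0), (1, 0), (0, 1), (1, 1)} : Set (ℤ × ℤ)),
      shift s (dU c (e.quad A B)) 0 u α β ≠ 0}

/-- The infinitesimal criterion for a generalized, or extended generalized, symmetry of
the equation: the prolonged vector field annihilates `Q` on the solutions (belonging to the set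
`D`, where the characteristic is defined). -/
def ABS.IsSymmetry (e : ABS) (A B : ℂ → ℂ) (D : Set Conf) (α β : ℂ) (v : VField) : Prop :=
  ∀ p, ∀ u ∈ e.solutions A B α β ∩ D, v.apply (e.quad A B) p u α β = 0

/-- The vector field is a trivial symmetry: it vanishes on the solutions. -/
def ABS.IsTrivial (e : ABS) (A B : ℂ → ℂ) (D : Set Conf) (α β : ℂ) (v : VField) : Prop :=
  EqAt (e.solutions A B α β ∩ D) α β v (ofChar 0)

/-! ### The two lattice directions and the basic symmetries -/

/-- The two lattice directions. -/
inductive Dir : Type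
  | n
  | m

/-- `x` in the direction `n`, `y` in the direction `m`. -/
def Dir.pick {X : Type} (d : Dir) (x y : X) : X :=
  match d with
  | .n => x
  | .m => y

/-- The unit vector of a direction. -/
def Dir.vec (d : Dir) : ℤ × ℤ := d.pick (1, 0) (0, 1)

/-- The configurations with `u_{(i+1,j)} ≠ u_{(i-1,j)}` (respectively `u_{(i,j+1)} ≠ u_{(i,j-1)}`)
for all `(i, j)`. -/
def regular (d : Dir) : Set Conf := {u | ∀ q, u (q + d.vec) ≠ u (q - d.vec)}

/-- `f(u_{(0,0)}, u_{(1,0)}, α)`, respectively `f(u_{(0,0)}, u_{(0,1)}, β)`. -/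
def ABS.edge (e : ABS) (A B : ℂ → ℂ) (d : Dir) : LatFun := fun _ u α β =>
  e.f (d.pick A B) (u 0) (u d.vec) (d.pick α β)

/-- The characteristic `R^{[0]}_n`, respectively `R^{[0]}_m`. -/
def ABS.R0 (e : ABS) (A B : ℂ → ℂ) (d : Dir) : LatFun := fun p u α β =>
  e.edge A B d p u α β / (u d.vec - u (-d.vec)) - 1 / 2 * dU d.vec (e.edge A B d) p u α β

/-- The vector field `v_n = R^{[0]}_n ∂_{u_{(0,0)}}`, respectively `v_m`. -/
def ABS.v (e : ABS) (A B : ℂ → ℂ) (d : Dir) : VField := ofChar (e.R0 A B d)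

/-- The vector field `V_n = n R^{[0]}_n ∂_{u_{(0,0)}} - r(α) ∂_α`, respectively
`V_m = m R^{[0]}_m ∂_{u_{(0,0)}} - r(β) ∂_β`. -/
def ABS.V (e : ABS) (A B : ℂ → ℂ) (d : Dir) : VField where
  char := fun p u α β => ((d.pick p.1 p.2 : ℤ) : ℂ) * e.R0 A B d p u α β
  xi := fun α _ => d.pick (-e.r A α) 0
  zeta := fun _ β => d.pick 0 (-e.r B β)

/-- The derivation `r(α) ∂_α`, respectively `r(β) ∂_β`. -/
def ABS.rD (e : ABS) (A B : ℂ → ℂ) (d : Dir) (F : LatFun) : LatFun := fun p u α β =>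
  d.pick (e.r A α * dAlpha F p u α β) (e.r B β * dBeta F p u α β)

/-- The operator `∑_ℓ ℓ (S_n^{(ℓ)} R^{[0]}_n) ∂_{u_{(ℓ,0)}} - r(α) ∂_α`, respectively its
counterpart in the direction `m`. -/
def ABS.recOp (e : ABS) (A B : ℂ → ℂ) (d : Dir) (F : LatFun) : LatFun := fun p u α β =>
  (∑ᶠ l : ℤ, (l : ℂ) * shift (l • d.vec) (e.R0 A B d) p u α β * dU (l • d.vec) F p u α β)
    - e.rD A B d F p u α β

/-- The members `v_n^{[k]}`, respectively `v_m^{[k]}`, of the hierarchy generated by `V_n`,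
respectively `V_m`. -/
def ABS.vk (e : ABS) (A B : ℂ → ℂ) (d : Dir) (k : ℕ) : VField :=
  hierarchy (e.V A B d) (e.v A B d) k

end ABSLattice

end

noncomputable section

open MvPolynomial Filter Topology

set_option linter.unusedSectionVars false

namespace ABSLattice

/-! ### Difference algebras of lattice functions -/

/-- A finite family of directions `vec d` in a lattice of points. -/
class Directions (G D : Type) [AddCommGroup G] where
  vec : D → G
  vec_ne : ∀ d, vec d + vec d ≠ 0

/-- Generators: the coefficients `c d j` of the biquadratic polynomial of a direction, the values
`x q` of the dependent variable, and `w d q`, which stands for `1 / (x (q + d) - x (q - d))`. -/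
inductive Gen (G D : Type) : Type
  | c (d : D) (j : Fin 6)
  | x (q : G)
  | w (d : D) (q : G)

/-- Polynomials in the generators. -/
abbrev LAlg (G D : Type) := MvPolynomial (Gen G D) ℂ

/-- The generator `x q`. -/
abbrev gx {G D : Type} (q : G) : LAlg G D := X (.x q)

/-- The generator `w d q`. -/
abbrev gw {G D : Type} (d : D) (q : G) : LAlg G D := X (.w d q)

/-- The generator `c d j`. -/
abbrev gc {G D : Type} (d : D) (j : Fin 6) : LAlg G D := X (.c d j)

section Algebra

variable {G D : Type} [AddCommGroup G] [Directions G D]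

open Directions

/-- The derivation with prescribed values at the `c d j` and the `x q`, which respects the meaning
of the `w d q`. -/
def goodDer (cc : D → Fin 6 → LAlg G D) (xx : G → LAlg G D) :
    Derivation ℂ (LAlg G D) (LAlg G D) :=
  mkDerivation ℂ fun
    | .c d j => cc d j
    | .x q => xx q
    | .w d q => -(gw d q) ^ 2 * (xx (q + vec d) - xx (q - vec d))

@[simp] theorem goodDer_c (cc : D → Fin 6 → LAlg G D) (xx : G → LAlg G D) (d : D) (j : Fin 6) :
    goodDer cc xx (gc d j) = cc d j := mkDerivation_X _ _ _

@[simp] theorem goodDer_x (cc : D → Fin 6 → LAlg G D) (xx : G → LAlg G D) (q : G) :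
    goodDer cc xx (gx q) = xx q := mkDerivation_X _ _ _

@[simp] theorem goodDer_w (cc : D → Fin 6 → LAlg G D) (xx : G → LAlg G D) (d : D) (q : G) :
    goodDer cc xx (gw d q) = -(gw d q) ^ 2 * (xx (q + vec d) - xx (q - vec d)) :=
  mkDerivation_X _ _ _

/-- Derivations of this form are closed under commutators: on a generator w the terms cubic in w are
symmetric in the two derivations and cancel. -/
theorem goodDer_lie (cc cc' : D → Fin 6 → LAlg G D) (xx xx' : G → LAlg G D) :
    ⁅goodDer cc xx, goodDer cc' xx'⁆ =
      goodDer (fun d j => goodDer cc xx (cc' d j) - goodDer cc' xx' (cc d j))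
        (fun q => goodDer cc xx (xx' q) - goodDer cc' xx' (xx q)) := by
  refine derivation_ext fun g => ?_
  rcases g with ⟨d, j⟩ | q | ⟨d, q⟩
  · simp [Derivation.commutator_apply]
  · simp [Derivation.commutator_apply]
  · simp only [Derivation.commutator_apply, goodDer_w, Derivation.leibniz, Derivation.leibniz_pow,
      map_neg, map_sub, smul_eq_mul, Nat.add_one_sub_one, pow_one, nsmul_eq_mul, Nat.cast_ofNat]
    ring

theorem goodDer_add (cc cc' : D → Fin 6 → LAlg G D) (xx xx' : G → LAlg G D) :
    goodDer cc xx + goodDer cc' xx' = goodDer (cc + cc') (xx + xx') := by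
  refine derivation_ext fun g => ?_
  rcases g with ⟨d, j⟩ | q | ⟨d, q⟩
  · simp
  · simp
  · simp only [Derivation.add_apply, goodDer_w, Pi.add_apply]; ring

/-- A homomorphism intertwines two derivations as soon as it does so on the generators. -/
theorem intertwine {σ τ : Type} (φ : MvPolynomial σ ℂ →ₐ[ℂ] MvPolynomial τ ℂ)
    (E : Derivation ℂ (MvPolynomial σ ℂ) (MvPolynomial σ ℂ))
    (E' : Derivation ℂ (MvPolynomial τ ℂ) (MvPolynomial τ ℂ))
    (h : ∀ g, E' (φ (X g)) = φ (E (X g))) (P : MvPolynomial σ ℂ) : E' (φ P) = φ (E P) := by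
  induction P using MvPolynomial.induction_on with
  | C a => simp [← algebraMap_eq]
  | add p q hp hq => simp [hp, hq]
  | mul_X p g hp => simp only [map_mul, Derivation.leibniz, hp, h, smul_eq_mul, map_add]

/-- The translation by `s`. -/
def shiftHom (s : G) : LAlg G D →ₐ[ℂ] LAlg G D :=
  rename fun
    | .c d j => .c d j
    | .x q => .x (q + s)
    | .w d q => .w d (q + s)

@[simp] theorem shiftHom_c (s : G) (d : D) (j : Fin 6) :
    shiftHom s (gc d j : LAlg G D) = gc d j := rename_X _ _

@[simp] theorem shiftHom_x (s q : G) : shiftHom s (gx q : LAlg G D) = gx (q + s) := rename_X _ _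

@[simp] theorem shiftHom_w (s : G) (d : D) (q : G) :
    shiftHom s (gw d q : LAlg G D) = gw d (q + s) := rename_X _ _

theorem shiftHom_shiftHom (s t : G) (P : LAlg G D) :
    shiftHom s (shiftHom t P) = shiftHom (t + s) P := by
  rw [shiftHom, shiftHom, rename_rename, shiftHom]
  congr 2
  funext g
  rcases g with ⟨d, j⟩ | q | ⟨d, q⟩ <;> simp [add_assoc]

@[simp] theorem shiftHom_zero (P : LAlg G D) : shiftHom 0 P = P := by
  rw [shiftHom]
  conv_rhs => rw [← rename_id_apply P]
  congr 2
  funext g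
  rcases g with ⟨d, j⟩ | q | ⟨d, q⟩ <;> simp

/-- The evolutionary derivation with characteristic `F`. -/
def evo (F : LAlg G D) : Derivation ℂ (LAlg G D) (LAlg G D) :=
  goodDer 0 fun q => shiftHom q F

@[simp] theorem evo_c (F : LAlg G D) (d : D) (j : Fin 6) : evo F (gc d j) = 0 := by simp [evo]

@[simp] theorem evo_x (F : LAlg G D) (q : G) : evo F (gx q) = shiftHom q F := by simp [evo]

theorem shiftHom_goodDer (s : G) (cc cc' : D → Fin 6 → LAlg G D) (xx xx' : G → LAlg G D)
    (hc : ∀ d j, cc' d j = shiftHom s (cc d j)) (hx : ∀ q, xx' (q + s) = shiftHom s (xx q))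
    (P : LAlg G D) : goodDer cc' xx' (shiftHom s P) = shiftHom s (goodDer cc xx P) := by
  refine intertwine _ _ _ (fun g => ?_) P
  rcases g with ⟨d, j⟩ | q | ⟨d, q⟩
  · simp [hc]
  · simp [hx]
  · rw [shiftHom_w, goodDer_w, goodDer_w]
    simp only [map_mul, map_neg, map_pow, shiftHom_w, map_sub, ← hx]
    rw [add_right_comm, add_sub_right_comm]

theorem evo_shiftHom (F P : LAlg G D) (s : G) :
    evo F (shiftHom s P) = shiftHom s (evo F P) :=
  shiftHom_goodDer s _ _ _ _ (by simp) (fun q => by rw [shiftHom_shiftHom]) P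

/-- The characteristic of the commutator of two evolutionary derivations. -/
def br (F H : LAlg G D) : LAlg G D := evo F H - evo H F

theorem br_swap (F H : LAlg G D) : br F H = -br H F := by simp [br]

theorem br_self (F : LAlg G D) : br F F = 0 := by simp [br]

variable [DecidableEq G] [DecidableEq D]

/-- The partial derivative with respect to `x q`. -/
def pd (q : G) : Derivation ℂ (LAlg G D) (LAlg G D) :=
  goodDer 0 fun p => if p = q then 1 else 0

/-- The partial derivative with respect to `c d j`. -/
def pc (k : D × Fin 6) : Derivation ℂ (LAlg G D) (LAlg G D) :=
  goodDer (fun d j => if (d, j) = k then 1 else 0) 0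

@[simp] theorem pd_c (q : G) (d : D) (j : Fin 6) : pd q (gc d j : LAlg G D) = 0 := by simp [pd]

@[simp] theorem pd_x (q p : G) : pd q (gx p : LAlg G D) = if p = q then 1 else 0 := by simp [pd]

@[simp] theorem pd_w (q : G) (d : D) (p : G) : pd q (gw d p : LAlg G D) =
    -(gw d p) ^ 2 * ((if p + vec d = q then 1 else 0) - if p - vec d = q then 1 else 0) := by
  simp [pd]

theorem pd_shiftHom (q s : G) (P : LAlg G D) :
    pd q (shiftHom s P) = shiftHom s (pd (q - s) P) := by
  refine shiftHom_goodDer s _ _ _ _ (by simp) (fun p => ?_) P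
  by_cases h : p = q - s
  · simp [h]
  · have : p + s ≠ q := fun h' => h (by rw [← h']; abel)
    simp [h, this]

/-- Because `pd q` takes constant values on the generators c and x, its commutator with a derivation
of this kind just differentiates the prescribed values. -/
theorem pd_goodDer (q : G) (cc : D → Fin 6 → LAlg G D) (xx : G → LAlg G D) (P : LAlg G D) :
    pd q (goodDer cc xx P) = goodDer cc xx (pd q P)
      + goodDer (fun d j => pd q (cc d j)) (fun p => pd q (xx p)) P := by
  have h : ⁅pd (D := D) q, goodDer cc xx⁆ =
      goodDer (fun d j => pd q (cc d j)) (fun p => pd q (xx p)) := by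
    rw [pd, goodDer_lie]
    congr 1
    · funext d j; simp
    · funext p
      split_ifs <;> simp
  rw [← h, Derivation.commutator_apply]; ring

/-- A polynomial in the generators involves only finitely many values `x q`. -/
theorem exists_goodDer_eq_sum [Fintype D] (P : LAlg G D) :
    ∃ T : Finset G, ∀ T' : Finset G, T ⊆ T' → ∀ cc xx, goodDer cc xx P =
      ∑ q ∈ T', xx q * pd q P + ∑ k : D × Fin 6, cc k.1 k.2 * pc k P := by
  induction P using MvPolynomial.induction_on with
  | C a => exact ⟨∅, fun T' _ cc xx => by simp [← algebraMap_eq]⟩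
  | add p q hp hq =>
    obtain ⟨T, hT⟩ := hp
    obtain ⟨S, hS⟩ := hq
    -- Since the induction hypotheses hold for every larger finite set, the sets of the two summands
    -- can be merged.
    refine ⟨T ∪ S, fun T' h cc xx => ?_⟩
    rw [map_add, hT T' (Finset.union_subset_left h), hS T' (Finset.union_subset_right h)]
    simp only [map_add, mul_add, Finset.sum_add_distrib]
    ring
  | mul_X p g hp =>
    obtain ⟨T, hT⟩ := hp
    have hg : ∃ S : Finset G, ∀ T' : Finset G, S ⊆ T' → ∀ cc xx, goodDer cc xx (X g : LAlg G D) =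
      ∑ q ∈ T', xx q * pd q (X g) + ∑ k : D × Fin 6, cc k.1 k.2 * pc k (X g) := by
      rcases g with ⟨d, j⟩ | q | ⟨d, q⟩
      · refine ⟨∅, fun T' _ cc xx => ?_⟩
        rw [goodDer_c, Finset.sum_eq_zero fun q _ => by simp, Finset.sum_eq_single (d, j)]
        · simp [pc]
        · intro b _ hb
          simp [pc, hb.symm]
        · simp
      · refine ⟨{q}, fun T' h cc xx => ?_⟩
        rw [goodDer_x]
        have : q ∈ T' := h (by simp)
        simp [pc, this]
      · refine ⟨{q + vec d, q - vec d}, fun T' h cc xx => ?_⟩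
        have h1 : q + vec d ∈ T' := h (by simp)
        have h2 : q - vec d ∈ T' := h (by simp)
        rw [goodDer_w]
        simp [pc, mul_sub, Finset.sum_sub_distrib, h1, h2, mul_ite]
        ring
    obtain ⟨S, hS⟩ := hg
    refine ⟨T ∪ S, fun T' h cc xx => ?_⟩
    rw [Derivation.leibniz, hT T' (Finset.union_subset_left h),
      hS T' (Finset.union_subset_right h)]
    simp only [Derivation.leibniz, smul_eq_mul, mul_add, Finset.mul_sum, Finset.sum_add_distrib]
    have e1 : ∀ q, xx q * (p * pd q (X g)) = p * (xx q * pd q (X g)) := fun q => by ring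
    have e2 : ∀ q, xx q * (X g * pd q p) = X g * (xx q * pd q p) := fun q => by ring
    have e3 : ∀ k : D × Fin 6, cc k.1 k.2 * (p * pc k (X g)) = p * (cc k.1 k.2 * pc k (X g)) :=
      fun q => by ring
    have e4 : ∀ k : D × Fin 6, cc k.1 k.2 * (X g * pc k p) = X g * (cc k.1 k.2 * pc k p) :=
      fun q => by ring
    simp only [e1, e2, e3, e4]
    ring

end Algebra

/-! ### Evaluation -/

section Evaluation

variable {G D : Type} [AddCommGroup G] [Directions G D]

open Directions

/-- No denominator `u (q + d) - u (q - d)` vanishes. -/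
def RegAll (D : Type) [Directions G D] (u : G → ℂ) : Prop :=
  ∀ (d : D) (q : G), u (q + vec d) ≠ u (q - vec d)

/-- Evaluation at the coefficients `cv` and the lattice function `u`. -/
def ev (cv : D → Fin 6 → ℂ) (u : G → ℂ) : LAlg G D →ₐ[ℂ] ℂ :=
  aeval fun
    | .c d j => cv d j
    | .x q => u q
    | .w d q => (u (q + vec d) - u (q - vec d))⁻¹

@[simp] theorem ev_c (cv : D → Fin 6 → ℂ) (u : G → ℂ) (d : D) (j : Fin 6) :
    ev cv u (gc d j) = cv d j := aeval_X _ _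

@[simp] theorem ev_x (cv : D → Fin 6 → ℂ) (u : G → ℂ) (q : G) :
    ev cv u (gx q) = u q := aeval_X _ _

@[simp] theorem ev_w (cv : D → Fin 6 → ℂ) (u : G → ℂ) (d : D) (q : G) :
    ev cv u (gw d q) = (u (q + vec d) - u (q - vec d))⁻¹ := aeval_X _ _

@[simp] theorem ev_C (cv : D → Fin 6 → ℂ) (u : G → ℂ) (a : ℂ) :
    ev cv u (C a) = a := by simp [ev]

theorem ev_shiftHom (cv : D → Fin 6 → ℂ) (u : G → ℂ) (s : G) (P : LAlg G D) :
    ev cv u (shiftHom s P) = ev cv (fun q => u (q + s)) P := by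
  rw [shiftHom, ev, aeval_rename, ev]
  congr 2
  funext g
  rcases g with ⟨d, j⟩ | q | ⟨d, q⟩
  · rfl
  · rfl
  · simp only [Function.comp_apply]
    rw [add_right_comm, add_sub_right_comm]

theorem RegAll.shift {u : G → ℂ} (hu : RegAll D u) (s : G) : RegAll D fun q => u (q + s) := by
  intro d q
  have := hu d (q + s)
  rwa [add_right_comm, add_sub_right_comm] at this

/-- The chain rule along a curve. -/
theorem hasDerivAt_ev {cv : ℂ → D → Fin 6 → ℂ} {u : ℂ → G → ℂ} {t₀ : ℂ}
    {cc : D → Fin 6 → LAlg G D} {xx : G → LAlg G D}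
    (hc : ∀ d j, HasDerivAt (fun t => cv t d j) (ev (cv t₀) (u t₀) (cc d j)) t₀)
    (hx : ∀ q, HasDerivAt (fun t => u t q) (ev (cv t₀) (u t₀) (xx q)) t₀)
    (hu : RegAll D (u t₀)) (P : LAlg G D) :
    HasDerivAt (fun t => ev (cv t) (u t) P) (ev (cv t₀) (u t₀) (goodDer cc xx P)) t₀ := by
  induction P using MvPolynomial.induction_on with
  | C a => simpa [← algebraMap_eq] using hasDerivAt_const t₀ a
  | add p q hp hq => simpa using! hp.add hq
  | mul_X p g hp =>
    have hg : HasDerivAt (fun t => ev (cv t) (u t) (X g))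
        (ev (cv t₀) (u t₀) (goodDer cc xx (X g))) t₀ := by
      rcases g with ⟨d, j⟩ | q | ⟨d, q⟩
      · simpa using hc d j
      · simpa using hx q
      · have := ((hx (q + vec d)).sub (hx (q - vec d))).inv (sub_ne_zero.2 (hu d q))
        simp only [ev_w, goodDer_w, map_mul, map_neg, map_pow, map_sub]
        refine this.congr_deriv ?_
        simp only [Pi.sub_apply]
        rw [inv_pow]; ring
    have := hp.mul hg
    simp only [map_mul, Derivation.leibniz, smul_eq_mul, map_add]
    exact this.congr_deriv (by ring)

/-- A function regular on a finite set agrees there with a regular one. -/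
theorem exists_regAll [Countable G] (B : Finset G) (u : G → ℂ)
    (hu : ∀ (d : D) q, q + vec d ∈ B → q - vec d ∈ B → u (q + vec d) ≠ u (q - vec d)) :
    ∃ u' : G → ℂ, RegAll D u' ∧ ∀ q ∈ B, u' q = u q := by
  classical
  obtain ⟨e, he⟩ := exists_injective_nat G
  obtain ⟨N, hN⟩ : ∃ N : ℕ, ∀ q ∈ B, ‖u q‖ < N := by
    obtain ⟨N, hN⟩ := exists_nat_gt (∑ q ∈ B, ‖u q‖)
    exact ⟨N, fun q hq => lt_of_le_of_lt
      (Finset.single_le_sum (f := fun q => ‖u q‖) (fun _ _ => norm_nonneg _) hq) hN⟩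
  have hne : ∀ q ∈ B, ∀ p, u q ≠ ((N + e p : ℕ) : ℂ) := by
    intro q hq p h
    have := hN q hq
    rw [h, Complex.norm_natCast] at this
    have : N + e p < N := by exact_mod_cast this
    omega
  -- Outside `B` the values are distinct natural numbers exceeding every `‖u q‖` on `B`, so they
  -- collide neither with each other nor with the given values.
  refine ⟨fun q => if q ∈ B then u q else ((N + e q : ℕ) : ℂ), fun d q => ?_, fun q hq => by
    simp [hq]⟩
  by_cases h1 : q + vec d ∈ B <;> by_cases h2 : q - vec d ∈ B
  · simpa [h1, h2] using hu d q h1 h2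
  · simpa only [h1, h2, if_true, if_false] using hne _ h1 _
  · simpa only [h1, h2, if_true, if_false] using (hne _ h2 _).symm
  · simp only [h1, h2, if_false]
    intro h
    have h3 : N + e (q + vec d) = N + e (q - vec d) := by exact_mod_cast h
    have h4 := he (Nat.add_left_cancel h3)
    apply vec_ne (G := G) d
    have : q + vec d - (q - vec d) = 0 := by rw [h4]; abel
    rw [← this]; abel

variable [DecidableEq G]

/-- In each direction only the two denominators centred at `q ± vec d` contain the value at `q`.
Both ends of one denominator cannot be `q`, as `vec d + vec d ≠ 0`. -/
theorem RegAll.update {u : G → ℂ} (hu : RegAll D u) (q : G) {t : ℂ}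
    (h₁ : ∀ d : D, t ≠ u (q + vec d + vec d)) (h₂ : ∀ d : D, t ≠ u (q - vec d - vec d)) :
    RegAll D (Function.update u q t) := by
  intro d p
  by_cases hp : p + vec d = q <;> by_cases hm : p - vec d = q
  · exfalso
    apply vec_ne (G := G) d
    have : p + vec d - (p - vec d) = 0 := by rw [hp, hm]; abel
    rw [← this]; abel
  · rw [Function.update_of_ne hm, hp, Function.update_self]
    have := h₂ d
    rwa [← hp, add_sub_cancel_right] at this
  · rw [Function.update_of_ne hp, hm, Function.update_self]
    have := h₁ d
    rw [← hm, sub_add_cancel] at this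
    exact this.symm
  · rw [Function.update_of_ne hp, Function.update_of_ne hm]
    exact hu d p

theorem RegAll.eventually_update [Finite D] {u : G → ℂ} (hu : RegAll D u) (q : G) :
    ∀ᶠ t in 𝓝 (u q), RegAll D (Function.update u q t) := by
  have h₁ : ∀ᶠ t in 𝓝 (u q), ∀ d : D, t ≠ u (q + vec d + vec d) := by
    refine eventually_all.2 fun d => eventually_ne_nhds ?_
    have := hu d (q + vec d)
    rw [add_sub_cancel_right] at this
    exact this.symm
  have h₂ : ∀ᶠ t in 𝓝 (u q), ∀ d : D, t ≠ u (q - vec d - vec d) := by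
    refine eventually_all.2 fun d => eventually_ne_nhds ?_
    have := hu d (q - vec d)
    rwa [sub_add_cancel] at this
  filter_upwards [h₁, h₂] with t ht₁ ht₂ using hu.update q ht₁ ht₂

theorem hasDerivAt_ev_update {u : G → ℂ} (hu : RegAll D u) (cv : D → Fin 6 → ℂ) (q : G)
    (P : LAlg G D) :
    HasDerivAt (fun t => ev cv (Function.update u q t) P) (ev cv u (pd q P)) (u q) := by
  have := hasDerivAt_ev (cv := fun _ => cv) (u := fun t => Function.update u q t) (t₀ := u q)
    (cc := 0) (xx := fun p => if p = q then 1 else 0) (fun d j => by simpa using hasDerivAt_const _ _)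
    (fun p => ?_) (by simpa using hu) P
  · simpa [pd] using this
  · by_cases hp : p = q
    · subst hp; simpa using! hasDerivAt_id _
    · simpa [hp, Function.update_of_ne hp] using hasDerivAt_const _ _

/-- `P` vanishes identically. -/
def Vanish (P : LAlg G D) : Prop := ∀ cv u, RegAll D u → ev cv u P = 0

end Evaluation

/-! ### Derivations as finite sums of partial derivatives -/

section Vanishing

variable {G D : Type} [AddCommGroup G] [Directions G D] [DecidableEq G] [DecidableEq D]

open Directions

theorem goodDer_eq_sum [Fintype D] {T : Finset G} {P : LAlg G D} (hP : ∀ q ∉ T, pd q P = 0)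
    (xx : G → LAlg G D) : goodDer 0 xx P = ∑ q ∈ T, xx q * pd q P := by
  obtain ⟨S, hS⟩ := exists_goodDer_eq_sum P
  rw [hS (S ∪ T) Finset.subset_union_left]
  rw [← Finset.sum_subset (Finset.subset_union_right (s₁ := S))]
  · simp
  · intro q _ hq; rw [hP q hq, mul_zero]

theorem goodDer_eq_sum' [Fintype D] {T : Finset G} {xx : G → LAlg G D} (hx : ∀ q ∉ T, xx q = 0)
    (P : LAlg G D) : goodDer 0 xx P = ∑ q ∈ T, xx q * pd q P := by
  obtain ⟨S, hS⟩ := exists_goodDer_eq_sum P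
  rw [hS (S ∪ T) Finset.subset_union_left]
  rw [← Finset.sum_subset (Finset.subset_union_right (s₁ := S))]
  · simp
  · intro q _ hq; rw [hx q hq, zero_mul]

theorem evo_eq_sum [Fintype D] {T : Finset G} {P : LAlg G D} (hP : ∀ q ∉ T, pd q P = 0)
    (F : LAlg G D) : evo F P = ∑ q ∈ T, shiftHom q F * pd q P := goodDer_eq_sum hP _

theorem goodDer_zero_zero (P : LAlg G D) : goodDer 0 0 P = 0 := by
  have : (goodDer 0 0 : Derivation ℂ (LAlg G D) (LAlg G D)) = 0 := by
    refine derivation_ext fun g => ?_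
    rcases g with ⟨d, j⟩ | q | ⟨d, q⟩ <;> simp
  rw [this]; rfl

end Vanishing

/-! ### Symmetric biquadratic polynomials -/

section Biquadratic

variable {R : Type} [CommRing R]

/-- The symmetric biquadratic polynomial with coefficients `c`. -/
def bq (c : Fin 6 → R) (u x : R) : R :=
  c 0 * u ^ 2 * x ^ 2 + 2 * c 1 * (u ^ 2 * x + u * x ^ 2) + c 2 * (u ^ 2 + x ^ 2)
    + 2 * c 3 * u * x + 2 * c 4 * (u + x) + c 5

/-- Half the derivative of `bq` with respect to the second argument. -/
def bqh (c : Fin 6 → R) (u x : R) : R :=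
  c 0 * u ^ 2 * x + c 1 * (u ^ 2 + 2 * u * x) + c 2 * x + c 3 * u + c 4

/-- The polarization of `bq` with respect to the second argument. -/
def bqp (c : Fin 6 → R) (u x y : R) : R :=
  c 0 * u ^ 2 * x * y + c 1 * (u ^ 2 * (x + y) + 2 * u * x * y) + c 2 * (u ^ 2 + x * y)
    + c 3 * u * (x + y) + c 4 * (2 * u + x + y) + c 5

/-- The derivative of `bqp` with respect to the first argument. -/
def bqpu (c : Fin 6 → R) (u x y : R) : R :=
  2 * c 0 * u * x * y + 2 * c 1 * (u * (x + y) + x * y) + 2 * c 2 * u + c 3 * (x + y) + 2 * c 4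

/-- The coefficients of `(f_x f_u - f f_{xu}) / 2`. -/
def bqDelta (c : Fin 6 → R) : Fin 6 → R :=
  ![2 * c 1 ^ 2 - c 0 * c 3, c 1 * c 2 - c 0 * c 4, c 2 * c 3 - 2 * c 1 * c 4,
    c 2 ^ 2 - c 0 * c 5, c 2 * c 4 - c 1 * c 5, 2 * c 4 ^ 2 - c 3 * c 5]

theorem bq_comm (c : Fin 6 → R) (u x : R) : bq c u x = bq c x u := by simp only [bq]; ring

theorem bqp_comm (c : Fin 6 → R) (u x y : R) : bqp c u x y = bqp c u y x := by
  simp only [bqp]; ring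

/-- For a quadratic polynomial in x, value minus polarization is half the derivative times the
increment. This turns the derivative term in the definition of the basic characteristic into a
polarization. -/
theorem bq_sub (c : Fin 6 → R) (u x y : R) :
    bq c u x - bqp c u x y = bqh c u x * (x - y) := by simp only [bq, bqp, bqh]; ring

/-- The parameter part of `recD R0` contains the polarization of `bqDelta`. This identity splits it
into values of f and half derivatives at the two adjacent edges, the form in which it cancels
against the part coming from the shifts. -/
theorem bqp_bqDelta (c : Fin 6 → R) (u x y : R) :
    (x - y) * bqp (bqDelta c) u x y = bq c u x * bqh c y u - bq c u y * bqh c x u := by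
  simp [bq, bqDelta, bqh, bqp]; ring

end Biquadratic

/-! ### The hierarchy on a line -/

instance : Directions ℤ Unit where
  vec _ := 1
  vec_ne _ := by norm_num

@[simp] theorem vec_unit (d : Unit) : (Directions.vec d : ℤ) = 1 := rfl

/-- The difference algebra of a line. -/
abbrev L1 := LAlg ℤ Unit

/-- The coefficients as elements of the difference algebra. -/
abbrev cs : Fin 6 → L1 := gc ()

/-- The characteristic `f(x₀; x₁, x₋₁) / (x₁ - x₋₁)`, `f` being polarized. -/
def R0 : L1 := bqp cs (gx 0) (gx 1) (gx (-1)) * gw () 0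

/-- The recursion operator. -/
def recD : Derivation ℂ L1 L1 :=
  goodDer (fun _ j => -bqDelta cs j) fun l => C (l : ℂ) * shiftHom l R0

/-- The characteristics of the hierarchy. -/
def Rk : ℕ → L1
  | 0 => R0
  | k + 1 => recD (Rk k)

/-- The evaluation at constant coefficients and a function on the line. -/
abbrev e1 (c : Fin 6 → ℂ) (x : ℤ → ℂ) : L1 →ₐ[ℂ] ℂ := ev (fun _ => c) x

/-- Regularity on the line. -/
abbrev Reg (x : ℤ → ℂ) : Prop := RegAll Unit x

theorem RegAll.ne {x : ℤ → ℂ} (hx : Reg x) (i : ℤ) : x (i + 1) ≠ x (i - 1) := hx () i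

@[simp] theorem derivation_two {σ : Type} (E : Derivation ℂ (MvPolynomial σ ℂ) (MvPolynomial σ ℂ)) :
    E 2 = 0 := by
  have := E.map_natCast 2
  exact_mod_cast this

@[simp] theorem algHom_two {σ τ : Type} (φ : MvPolynomial σ ℂ →ₐ[ℂ] MvPolynomial τ ℂ) :
    φ 2 = 2 := map_ofNat φ 2

/-- `∂R₀/∂x₁`. -/
abbrev rho : L1 := pd 1 R0

/-- `∂R₀/∂x₀`. -/
abbrev rho0 : L1 := pd 0 R0

/-- `∂R₀/∂x₋₁`. -/
abbrev rhom : L1 := pd (-1) R0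

theorem pd_R0 {l : ℤ} (h1 : l ≠ 1) (h0 : l ≠ 0) (hm : l ≠ -1) : pd l R0 = 0 := by
  simp [R0, bqp, h1.symm, h0.symm, hm.symm]

theorem pd_shift_R0 {a l : ℤ} (h1 : l ≠ a - 1) (h0 : l ≠ a) (hm : l ≠ a + 1) :
    pd a (shiftHom l R0) = 0 := by
  rw [pd_shiftHom, pd_R0 (by omega) (by omega) (by omega), map_zero]

theorem evo_R0 (F : L1) :
    evo F R0 = shiftHom 1 F * rho + F * rho0 + shiftHom (-1) F * rhom := by
  rw [evo_eq_sum (T := {1, 0, -1})]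
  · simp; ring
  · intro q hq
    simp only [Finset.mem_insert, Finset.mem_singleton, not_or] at hq
    exact pd_R0 hq.1 hq.2.1 hq.2.2

theorem goodDer_three (a : ℤ) (xx : ℤ → L1)
    (hx : ∀ l, l ≠ a - 1 → l ≠ a → l ≠ a + 1 → xx l = 0) (P : L1) :
    goodDer 0 xx P = xx (a - 1) * pd (a - 1) P + xx a * pd a P + xx (a + 1) * pd (a + 1) P := by
  rw [goodDer_eq_sum' (T := {a - 1, a, a + 1})]
  · rw [Finset.sum_insert (by simp; omega), Finset.sum_insert (by simp), Finset.sum_singleton]; ring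
  · intro q hq
    simp only [Finset.mem_insert, Finset.mem_singleton, not_or] at hq
    exact hx q hq.1 hq.2.1 hq.2.2

/-- Only the shifts of `R0` by a - 1, a and a + 1 depend on the value at a, so the commutator of `pd
a` and `recD` has three terms. This is the recursion for the extreme derivatives of the hierarchy.
-/
theorem pd_recD (a : ℤ) (P : L1) : pd a (recD P) = recD (pd a P)
    + C ((a - 1 : ℤ) : ℂ) * shiftHom (a - 1) rho * pd (a - 1) P
    + C (a : ℂ) * shiftHom a rho0 * pd a P
    + C ((a + 1 : ℤ) : ℂ) * shiftHom (a + 1) rhom * pd (a + 1) P := by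
  rw [recD, pd_goodDer, ← recD]
  have : (fun (d : Unit) (j : Fin 6) => pd a (-bqDelta cs j)) = 0 := by
    funext d j
    fin_cases j <;> simp [bqDelta]
  rw [this, goodDer_three a]
  · simp only [Derivation.leibniz, pd_shiftHom, sub_sub_cancel, sub_self, sub_add_cancel_left,
      derivation_C, smul_eq_mul, mul_zero, add_zero]
    ring
  · intro l h1 h2 h3
    simp [pd_shift_R0 h1 h2 h3]

theorem pd_Rk_eq_zero (k : ℕ) {l : ℤ} (hl : (k : ℤ) + 1 < |l|) : pd l (Rk k) = 0 := by
  induction k generalizing l with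
  | zero =>
    refine pd_R0 ?_ ?_ ?_ <;> rintro rfl <;> norm_num at hl
  | succ k ih =>
    push_cast at hl
    have h : (k : ℤ) + 1 < |l| ∧ (k : ℤ) + 1 < |l - 1| ∧ (k : ℤ) + 1 < |l + 1| := by
      simp only [lt_abs] at hl ⊢
      omega
    rw [Rk, pd_recD, ih h.1, ih h.2.1, ih h.2.2]
    simp

/-- The products `ρ S(ρ) ⋯ S^{n-1}(ρ)`. -/
def rhoProd (n : ℕ) : L1 := ∏ i ∈ Finset.range n, shiftHom (i : ℤ) rho

/-- At the new outermost point only the term of `pd_recD` from the inner neighbour survives. It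
contributes the weight k + 1 and one more shift of `rho`, whence the factorial and the product. -/
theorem pd_Rk_top (k : ℕ) : pd ((k : ℤ) + 1) (Rk k) = C (k.factorial : ℂ) * rhoProd (k + 1) := by
  induction k with
  | zero => simp [Rk, rhoProd]
  | succ k ih =>
    rw [Rk, pd_recD]
    push_cast
    rw [add_sub_cancel_right, add_sub_cancel_right, ih, pd_Rk_eq_zero k (l := (k : ℤ) + 1 + 1),
      pd_Rk_eq_zero k (l := (k : ℤ) + 1 + 1 + 1), rhoProd, rhoProd,
      Finset.prod_range_succ _ (k + 1), Nat.factorial_succ]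
    · push_cast
      simp only [map_zero, mul_zero, add_zero, zero_add, map_mul, map_add, map_one]
      ring
    · rw [lt_abs]; omega
    · rw [lt_abs]; omega

/-- The mirror image of `pd_Rk_top`; the surviving weight is now -(k + 1), which produces the
alternating sign. -/
theorem pd_Rk_bot (k : ℕ) : pd (-((k : ℤ) + 1)) (Rk k) =
    C ((-1) ^ k * k.factorial : ℂ) * ∏ i ∈ Finset.range (k + 1), shiftHom (-(i : ℤ)) rhom := by
  induction k with
  | zero => simp [Rk]
  | succ k ih =>
    rw [Rk, pd_recD]
    push_cast
    rw [show -((k : ℤ) + 1 + 1) + 1 = -((k : ℤ) + 1) by ring, ih,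
      pd_Rk_eq_zero k (l := -((k : ℤ) + 1 + 1)),
      pd_Rk_eq_zero k (l := -((k : ℤ) + 1 + 1) - 1),
      Finset.prod_range_succ _ (k + 1), Nat.factorial_succ, pow_succ]
    · push_cast
      simp only [map_zero, mul_zero, add_zero, zero_add, map_mul, map_add, map_one, map_neg]
      ring
    · rw [lt_abs]; omega
    · rw [lt_abs]; omega

/-- The weights in `recD` are positions relative to the origin. Moving the origin by s adds s to all
of them, that is, s times the evolution along `R0`; this is the source of the explicit n in
commutators with V. -/
theorem recD_shiftHom (s : ℤ) (P : L1) :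
    recD (shiftHom s P) = shiftHom s (recD P + C (s : ℂ) * evo R0 P) := by
  have h : recD + (C (s : ℂ) : L1) • evo R0 = goodDer (fun _ j => -bqDelta cs j)
      (fun l => C ((l + s : ℤ) : ℂ) * shiftHom l R0) := by
    refine derivation_ext fun g => ?_
    rcases g with ⟨d, j⟩ | q | ⟨d, q⟩
    · simp [recD]
    · simp [recD]; ring
    · simp [recD, evo]; ring
  have h2 := shiftHom_goodDer (D := Unit) s (fun _ j => -bqDelta cs j) (fun _ j => -bqDelta cs j)
    (fun l => C ((l + s : ℤ) : ℂ) * shiftHom l R0) (fun l => C (l : ℂ) * shiftHom l R0)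
    (fun d j => by fin_cases j <;> simp [bqDelta])
    (fun l => by simp [shiftHom_shiftHom, ← algebraMap_eq]) P
  rw [← h] at h2
  simpa [recD] using h2

@[simp] theorem ev_two {G D : Type} [AddCommGroup G] [Directions G D] (cv : D → Fin 6 → ℂ)
    (u : G → ℂ) : ev cv u (2 : LAlg G D) = 2 := map_ofNat _ 2

theorem e1_shift (c : Fin 6 → ℂ) (x : ℤ → ℂ) (s : ℤ) (P : L1) :
    e1 c x (shiftHom s P) = e1 c (fun i => x (i + s)) P := ev_shiftHom _ _ _ _

theorem e1_bq (c : Fin 6 → ℂ) (x : ℤ → ℂ) (p q : L1) :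
    e1 c x (bq cs p q) = bq c (e1 c x p) (e1 c x q) := by simp [bq]

theorem e1_R0 (c : Fin 6 → ℂ) (x : ℤ → ℂ) :
    e1 c x R0 = bqp c (x 0) (x 1) (x (-1)) / (x 1 - x (-1)) := by
  simp [R0, bqp, div_eq_mul_inv]

theorem e1_shift_R0 (c : Fin 6 → ℂ) (x : ℤ → ℂ) (l : ℤ) : e1 c x (shiftHom l R0) =
    bqp c (x l) (x (l + 1)) (x (l - 1)) / (x (l + 1) - x (l - 1)) := by
  rw [e1_shift, e1_R0, zero_add, add_comm 1 l, neg_add_eq_sub]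

theorem RegAll.sub_ne {x : ℤ → ℂ} (hx : Reg x) : x 1 - x (-1) ≠ 0 := by
  have := hx.ne 0
  simpa [sub_eq_zero] using this

/-- Differentiating the polarization over x₁ - x₋₁ with respect to x₁ makes its two arguments
coincide at x₋₁, which leaves f itself on the opposite edge. -/
theorem e1_rho (c : Fin 6 → ℂ) {x : ℤ → ℂ} (hx : Reg x) :
    e1 c x rho = -bq c (x 0) (x (-1)) / (x 1 - x (-1)) ^ 2 := by
  have h := hx.sub_ne
  simp [rho, R0, bqp, bq]
  field_simp
  ring

theorem e1_rhom (c : Fin 6 → ℂ) {x : ℤ → ℂ} (hx : Reg x) :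
    e1 c x rhom = bq c (x 0) (x 1) / (x 1 - x (-1)) ^ 2 := by
  have h := hx.sub_ne
  simp [rhom, R0, bqp, bq]
  field_simp
  ring

theorem e1_rho0 (c : Fin 6 → ℂ) (x : ℤ → ℂ) :
    e1 c x rho0 = bqpu c (x 0) (x 1) (x (-1)) / (x 1 - x (-1)) := by
  simp [rho0, R0, bqp, bqpu, div_eq_mul_inv]
  ring

theorem e1_shift_rho (c : Fin 6 → ℂ) {x : ℤ → ℂ} (hx : Reg x) (l : ℤ) :
    e1 c x (shiftHom l rho) = -bq c (x l) (x (l - 1)) / (x (l + 1) - x (l - 1)) ^ 2 := by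
  rw [e1_shift, e1_rho c (hx.shift l), zero_add, add_comm 1 l, neg_add_eq_sub]

theorem e1_shift_rhom (c : Fin 6 → ℂ) {x : ℤ → ℂ} (hx : Reg x) (l : ℤ) :
    e1 c x (shiftHom l rhom) = bq c (x l) (x (l + 1)) / (x (l + 1) - x (l - 1)) ^ 2 := by
  rw [e1_shift, e1_rhom c (hx.shift l), zero_add, add_comm 1 l, neg_add_eq_sub]

theorem goodDer_split {G D : Type} [AddCommGroup G] [Directions G D]
    (cc : D → Fin 6 → LAlg G D) (xx : G → LAlg G D) (P : LAlg G D) :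
    goodDer cc xx P = goodDer 0 xx P + goodDer cc 0 P := by
  rw [← Derivation.add_apply, goodDer_add, zero_add, add_zero]

theorem recD_R0 : recD R0 = shiftHom 1 R0 * rho - shiftHom (-1) R0 * rhom
    - bqp (bqDelta cs) (gx 0) (gx 1) (gx (-1)) * gw () 0 := by
  rw [recD, goodDer_split]
  have h1 : goodDer 0 (fun l : ℤ => C (l : ℂ) * shiftHom l R0) R0 =
      shiftHom 1 R0 * rho - shiftHom (-1) R0 * rhom := by
    rw [goodDer_eq_sum (T := {1, 0, -1})]
    · simp; ring
    · intro q hq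
      simp only [Finset.mem_insert, Finset.mem_singleton, not_or] at hq
      exact pd_R0 hq.1 hq.2.1 hq.2.2
  have h2 : goodDer (fun (_ : Unit) j => -bqDelta cs j) 0 R0 =
      -(bqp (bqDelta cs) (gx 0) (gx 1) (gx (-1)) * gw () 0) := by
    simp [R0, bqp]; ring
  rw [h1, h2]; ring

/-- An explicit form of the first member of the hierarchy. -/
def R1 : L1 := -(bq cs (gx 0) (gx 1) * bq cs (gx 0) (gx (-1)) * gw () 0 ^ 2
  * (gw () 1 + gw () (-1)))

theorem e1_R1 (c : Fin 6 → ℂ) (x : ℤ → ℂ) : e1 c x R1 =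
    -(bq c (x 0) (x 1) * bq c (x 0) (x (-1)) * ((x 1 - x (-1))⁻¹) ^ 2
      * ((x 2 - x 0)⁻¹ + (x 0 - x (-2))⁻¹)) := by
  simp [R1, e1_bq]

/-- The polarizations at the sites 1 and -1 are expanded around the edges leading to 0 (`k2`, `k3`).
The half derivatives then cancel against the parameter part by `bqp_bqDelta` (`k1`), and only
products of values of f remain. The identity holds after evaluation only, since the polynomial ring
does not contain the relation between w and x. -/
theorem vanish_recD_R0_sub_R1 : Vanish (recD R0 - R1) := by
  intro cv x hx
  obtain ⟨c, rfl⟩ : ∃ c, cv = fun _ => c := ⟨cv (), rfl⟩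
  have h0 := hx.sub_ne
  have h1 : x 2 - x 0 ≠ 0 := by simpa [sub_eq_zero] using hx.ne 1
  have h2 : x 0 - x (-2) ≠ 0 := by simpa [sub_eq_zero] using hx.ne (-1)
  rw [map_sub, recD_R0, map_sub, map_sub, map_mul, map_mul, e1_shift_R0, e1_shift_R0, e1_R1,
    e1_rho c hx, e1_rhom c hx]
  have e : e1 c x (bqp (bqDelta cs) (gx 0) (gx 1) (gx (-1)) * gw () 0) =
      bqp (bqDelta c) (x 0) (x 1) (x (-1)) / (x 1 - x (-1)) := by
    simp [bqp, bqDelta, div_eq_mul_inv]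
  rw [e]
  norm_num
  have k1 := bqp_bqDelta c (x 0) (x 1) (x (-1))
  have k2 : bqp c (x 1) (x 2) (x 0) = bq c (x 0) (x 1) + bqh c (x 1) (x 0) * (x 2 - x 0) := by
    rw [bqp_comm, bq_comm]; linear_combination -bq_sub c (x 1) (x 0) (x 2)
  have k3 : bqp c (x (-1)) (x 0) (x (-2)) =
      bq c (x 0) (x (-1)) - bqh c (x (-1)) (x 0) * (x 0 - x (-2)) := by
    rw [bq_comm]; linear_combination -bq_sub c (x (-1)) (x 0) (x (-2))
  rw [k2, k3]
  field_simp
  linear_combination (-(x 2 - x 0) * (x 0 - x (-2))) * k1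

/-! ### Affine-linear polynomials on the squares of the lattice -/

/-- The affine-linear polynomial with coefficients `a`. -/
def aq (a : Fin 7 → ℂ) (u x y z : ℂ) : ℂ :=
  affineQ (a 0) (a 1) (a 2) (a 3) (a 4) (a 5) (a 6) u x y z

/-- Its derivative with respect to `u`. -/
def aqu (a : Fin 7 → ℂ) (x y z : ℂ) : ℂ :=
  a 0 * x * y * z + a 1 * (y * z + x * z + x * y) + a 2 * x + a 3 * z + a 4 * y + a 5

/-- Its derivative with respect to `x`. -/
def aqx (a : Fin 7 → ℂ) (u y z : ℂ) : ℂ :=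
  a 0 * u * y * z + a 1 * (y * z + u * z + u * y) + a 2 * u + a 3 * y + a 4 * z + a 5

/-- Its derivative with respect to `y`. -/
def aqy (a : Fin 7 → ℂ) (u x z : ℂ) : ℂ :=
  a 0 * u * x * z + a 1 * (x * z + u * z + u * x) + a 2 * z + a 3 * x + a 4 * u + a 5

/-- Its derivative with respect to `z`. -/
def aqz (a : Fin 7 → ℂ) (u x y : ℂ) : ℂ :=
  a 0 * u * x * y + a 1 * (x * y + u * y + u * x) + a 2 * y + a 3 * u + a 4 * x + a 5

/-- Its differential. -/
def aqd (a : Fin 7 → ℂ) (u x y z U X Y Z : ℂ) : ℂ :=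
  U * aqu a x y z + X * aqx a u y z + Y * aqy a u x z + Z * aqz a u x y

/-- Its second differential. -/
def aqdd (a : Fin 7 → ℂ) (u x y z U X Y Z U' X' Y' Z' : ℂ) : ℂ :=
  (a 0 * y * z + a 1 * (y + z) + a 2) * (U * X' + X * U')
    + (a 0 * x * z + a 1 * (x + z) + a 4) * (U * Y' + Y * U')
    + (a 0 * x * y + a 1 * (x + y) + a 3) * (U * Z' + Z * U')
    + (a 0 * u * z + a 1 * (u + z) + a 3) * (X * Y' + Y * X')
    + (a 0 * u * y + a 1 * (u + y) + a 4) * (X * Z' + Z * X')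
    + (a 0 * u * x + a 1 * (u + x) + a 2) * (Y * Z' + Z * Y')

theorem hasDerivAt_aq {a : ℂ → Fin 7 → ℂ} {a' : Fin 7 → ℂ} {u x y z : ℂ → ℂ} {U X Y Z t : ℂ}
    (ha : ∀ k, HasDerivAt (fun s => a s k) (a' k) t) (hu : HasDerivAt u U t)
    (hx : HasDerivAt x X t) (hy : HasDerivAt y Y t) (hz : HasDerivAt z Z t) :
    HasDerivAt (fun s => aq (a s) (u s) (x s) (y s) (z s))
      (aq a' (u t) (x t) (y t) (z t) + aqd (a t) (u t) (x t) (y t) (z t) U X Y Z) t := by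
  have h := ((((((((((ha 0).mul hu).mul hx).mul hy).mul hz).add
    ((ha 1).mul (((((hu.mul hy).mul hz).add ((hx.mul hy).mul hz)).add ((hu.mul hx).mul hz)).add
      ((hu.mul hx).mul hy)))).add ((ha 2).mul ((hu.mul hx).add (hy.mul hz)))).add
    ((ha 3).mul ((hu.mul hz).add (hx.mul hy)))).add
    ((ha 4).mul ((hx.mul hz).add (hu.mul hy)))).add
    ((ha 5).mul (((hu.add hx).add hy).add hz))).add (ha 6)
  refine h.congr_deriv ?_
  simp only [aq, aqd, affineQ, aqu, aqx, aqy, aqz, Pi.mul_apply, Pi.add_apply]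
  ring

theorem hasDerivAt_aqd {a : ℂ → Fin 7 → ℂ} {a' : Fin 7 → ℂ} {u x y z V₁ V₂ V₃ V₄ : ℂ → ℂ}
    {U X Y Z W₁ W₂ W₃ W₄ t : ℂ}
    (ha : ∀ k, HasDerivAt (fun s => a s k) (a' k) t) (hu : HasDerivAt u U t)
    (hx : HasDerivAt x X t) (hy : HasDerivAt y Y t) (hz : HasDerivAt z Z t)
    (h₁ : HasDerivAt V₁ W₁ t) (h₂ : HasDerivAt V₂ W₂ t) (h₃ : HasDerivAt V₃ W₃ t)
    (h₄ : HasDerivAt V₄ W₄ t) :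
    HasDerivAt (fun s => aqd (a s) (u s) (x s) (y s) (z s) (V₁ s) (V₂ s) (V₃ s) (V₄ s))
      (aqd a' (u t) (x t) (y t) (z t) (V₁ t) (V₂ t) (V₃ t) (V₄ t)
        + aqdd (a t) (u t) (x t) (y t) (z t) U X Y Z (V₁ t) (V₂ t) (V₃ t) (V₄ t)
        + aqd (a t) (u t) (x t) (y t) (z t) W₁ W₂ W₃ W₄) t := by
  have hU := ((((((((ha 0).mul hx).mul hy).mul hz).add ((ha 1).mul (((hy.mul hz).add
    (hx.mul hz)).add (hx.mul hy)))).add ((ha 2).mul hx)).add ((ha 3).mul hz)).add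
    ((ha 4).mul hy)).add (ha 5)
  have hX := ((((((((ha 0).mul hu).mul hy).mul hz).add ((ha 1).mul (((hy.mul hz).add
    (hu.mul hz)).add (hu.mul hy)))).add ((ha 2).mul hu)).add ((ha 3).mul hy)).add
    ((ha 4).mul hz)).add (ha 5)
  have hY := ((((((((ha 0).mul hu).mul hx).mul hz).add ((ha 1).mul (((hx.mul hz).add
    (hu.mul hz)).add (hu.mul hx)))).add ((ha 2).mul hz)).add ((ha 3).mul hx)).add
    ((ha 4).mul hu)).add (ha 5)
  have hZ := ((((((((ha 0).mul hu).mul hx).mul hy).add ((ha 1).mul (((hx.mul hy).add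
    (hu.mul hy)).add (hu.mul hx)))).add ((ha 2).mul hy)).add ((ha 3).mul hu)).add
    ((ha 4).mul hx)).add (ha 5)
  have h := (((h₁.mul hU).add (h₂.mul hX)).add (h₃.mul hY)).add (h₄.mul hZ)
  refine h.congr_deriv ?_
  simp only [aqd, aqdd, aqu, aqx, aqy, aqz, Pi.mul_apply, Pi.add_apply]
  ring

/-- The value of `aq` on the square with lower left vertex `q`. -/
def sqv (a : Fin 7 → ℂ) (u : ℤ × ℤ → ℂ) (q : ℤ × ℤ) : ℂ :=
  aq a (u q) (u (q + (1, 0))) (u (q + (0, 1))) (u (q + (1, 1)))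

/-- The differential of `aq` on a square. -/
def sqd (a : Fin 7 → ℂ) (u U : ℤ × ℤ → ℂ) (q : ℤ × ℤ) : ℂ :=
  aqd a (u q) (u (q + (1, 0))) (u (q + (0, 1))) (u (q + (1, 1)))
    (U q) (U (q + (1, 0))) (U (q + (0, 1))) (U (q + (1, 1)))

/-- The second differential of `aq` on a square. -/
def sqdd (a : Fin 7 → ℂ) (u U V : ℤ × ℤ → ℂ) (q : ℤ × ℤ) : ℂ :=
  aqdd a (u q) (u (q + (1, 0))) (u (q + (0, 1))) (u (q + (1, 1)))
    (U q) (U (q + (1, 0))) (U (q + (0, 1))) (U (q + (1, 1)))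
    (V q) (V (q + (1, 0))) (V (q + (0, 1))) (V (q + (1, 1)))

/-- The derivative of `aq` with respect to the upper left vertex of a square. -/
def sqy (a : Fin 7 → ℂ) (u : ℤ × ℤ → ℂ) (q : ℤ × ℤ) : ℂ :=
  aqy a (u q) (u (q + (1, 0))) (u (q + (1, 1)))

/-- The vertices of the square with lower left vertex `q`. -/
def corners (q : ℤ × ℤ) : Set (ℤ × ℤ) := {q, q + (1, 0), q + (0, 1), q + (1, 1)}

theorem hasDerivAt_sqv {a : ℂ → Fin 7 → ℂ} {a' : Fin 7 → ℂ} {w : ℂ → ℤ × ℤ → ℂ} {U : ℤ × ℤ → ℂ}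
    {t : ℂ} {q : ℤ × ℤ} (ha : ∀ k, HasDerivAt (fun s => a s k) (a' k) t)
    (hw : ∀ p ∈ corners q, HasDerivAt (fun s => w s p) (U p) t) :
    HasDerivAt (fun s => sqv (a s) (w s) q) (sqv a' (w t) q + sqd (a t) (w t) U q) t :=
  hasDerivAt_aq ha (hw _ (by simp [corners])) (hw _ (by simp [corners]))
    (hw _ (by simp [corners])) (hw _ (by simp [corners]))

theorem hasDerivAt_sqd {a : ℂ → Fin 7 → ℂ} {a' : Fin 7 → ℂ} {w V : ℂ → ℤ × ℤ → ℂ}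
    {U V' : ℤ × ℤ → ℂ} {t : ℂ} {q : ℤ × ℤ} (ha : ∀ k, HasDerivAt (fun s => a s k) (a' k) t)
    (hw : ∀ p ∈ corners q, HasDerivAt (fun s => w s p) (U p) t)
    (hV : ∀ p ∈ corners q, HasDerivAt (fun s => V s p) (V' p) t) :
    HasDerivAt (fun s => sqd (a s) (w s) (V s) q)
      (sqd a' (w t) (V t) q + sqdd (a t) (w t) U (V t) q + sqd (a t) (w t) V' q) t :=
  hasDerivAt_aqd ha (hw _ (by simp [corners])) (hw _ (by simp [corners]))
    (hw _ (by simp [corners])) (hw _ (by simp [corners])) (hV _ (by simp [corners]))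
    (hV _ (by simp [corners])) (hV _ (by simp [corners])) (hV _ (by simp [corners]))

theorem sqdd_comm (a : Fin 7 → ℂ) (u U V : ℤ × ℤ → ℂ) (q : ℤ × ℤ) :
    sqdd a u U V q = sqdd a u V U q := by
  simp only [sqdd, aqdd]; ring

/-! ### Curves of solutions with a prescribed tangent -/

/-- The solution of the lattice equation on a quadrant with boundary values `d`. -/
def grid (a : Fin 7 → ℂ) (d : ℕ → ℕ → ℂ) : ℕ → ℕ → ℂ
  | 0, q => d 0 q
  | p + 1, 0 => d (p + 1) 0
  | p + 1, q + 1 =>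
    -aq a (grid a d (p + 1) q) (grid a d p q) 0 (grid a d p (q + 1))
      / aqy a (grid a d (p + 1) q) (grid a d p q) (grid a d p (q + 1))

theorem aqy_eq (a : Fin 7 → ℂ) (u x z : ℂ) : aqy a u x z = aq a u x 1 z - aq a u x 0 z := by
  simp only [aqy, aq, affineQ]; ring

theorem aq_eq (a : Fin 7 → ℂ) (u x y z : ℂ) : aq a u x y z = aq a u x 0 z + y * aqy a u x z := by
  simp only [aqy, aq, affineQ]; ring

theorem hasDerivAt_aqy {a : ℂ → Fin 7 → ℂ} {a' : Fin 7 → ℂ} {u x z : ℂ → ℂ} {U X Z t : ℂ}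
    (ha : ∀ k, HasDerivAt (fun s => a s k) (a' k) t) (hu : HasDerivAt u U t)
    (hx : HasDerivAt x X t) (hz : HasDerivAt z Z t) :
    HasDerivAt (fun s => aqy (a s) (u s) (x s) (z s))
      (aq a' (u t) (x t) 1 (z t) + aqd (a t) (u t) (x t) 1 (z t) U X 0 Z
        - (aq a' (u t) (x t) 0 (z t) + aqd (a t) (u t) (x t) 0 (z t) U X 0 Z)) t := by
  simp only [aqy_eq]
  exact (hasDerivAt_aq ha hu hx (hasDerivAt_const t 1) hz).sub
    (hasDerivAt_aq ha hu hx (hasDerivAt_const t 0) hz)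

/-- Implicit differentiation: Q is affine in y, so y is an explicit quotient. Its velocity is the
unique solution of the linearized equation, because Q_y ≠ 0, and `hY` says that Y solves that
equation. -/
theorem hasDerivAt_solve {a : ℂ → Fin 7 → ℂ} {a' : Fin 7 → ℂ} {u x z : ℂ → ℂ} {U X Z t y Y : ℂ}
    (ha : ∀ k, HasDerivAt (fun s => a s k) (a' k) t) (hu : HasDerivAt u U t)
    (hx : HasDerivAt x X t) (hz : HasDerivAt z Z t) (hQ : aq (a t) (u t) (x t) y (z t) = 0)
    (hy : aqy (a t) (u t) (x t) (z t) ≠ 0)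
    (hY : aq a' (u t) (x t) y (z t) + aqd (a t) (u t) (x t) y (z t) U X Y Z = 0) :
    -aq (a t) (u t) (x t) 0 (z t) / aqy (a t) (u t) (x t) (z t) = y ∧
    HasDerivAt (fun s => -aq (a s) (u s) (x s) 0 (z s) / aqy (a s) (u s) (x s) (z s)) Y t := by
  have h0 : -aq (a t) (u t) (x t) 0 (z t) / aqy (a t) (u t) (x t) (z t) = y := by
    rw [div_eq_iff hy]
    linear_combination -hQ + aq_eq (a t) (u t) (x t) y (z t)
  refine ⟨h0, ?_⟩
  have h := (hasDerivAt_aq ha hu hx (hasDerivAt_const t 0) hz).neg.div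
    (hasDerivAt_aqy ha hu hx hz) hy
  refine h.congr_deriv ?_
  rw [div_eq_iff (pow_ne_zero 2 hy)]
  have e : -aq (a t) (u t) (x t) 0 (z t) = y * aqy (a t) (u t) (x t) (z t) := by
    rw [← h0]; field_simp
  simp only [Pi.neg_apply, e]
  have k : aq a' (u t) (x t) y (z t) + aqd (a t) (u t) (x t) y (z t) U X Y Z =
      (aq a' (u t) (x t) 0 (z t) + aqd (a t) (u t) (x t) 0 (z t) U X 0 Z)
      + y * (aq a' (u t) (x t) 1 (z t) + aqd (a t) (u t) (x t) 1 (z t) U X 0 Z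
        - (aq a' (u t) (x t) 0 (z t) + aqd (a t) (u t) (x t) 0 (z t) U X 0 Z))
      + Y * aqy (a t) (u t) (x t) (z t) := by
    simp only [aq, aqd, affineQ, aqu, aqx, aqy, aqz]; ring
  rw [k] at hY
  linear_combination -aqy (a t) (u t) (x t) (z t) * hY

/-- A tangent of the solution set of the lattice equation on a rectangle, with varying
coefficients, is the tangent of a curve of solutions. -/
theorem exists_tangent_curve {a : ℂ → Fin 7 → ℂ} {a' : Fin 7 → ℂ}
    (ha : ∀ k, HasDerivAt (fun s => a s k) (a' k) 0) (u U : ℤ × ℤ → ℂ) (i₀ i₁ j₀ j₁ : ℤ)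
    (h : ∀ i j, i₀ ≤ i → i < i₁ → j₀ ≤ j → j < j₁ →
      sqv (a 0) u (i, j) = 0 ∧ sqy (a 0) u (i, j) ≠ 0 ∧
        sqv a' u (i, j) + sqd (a 0) u U (i, j) = 0) :
    ∃ w : ℂ → ℤ × ℤ → ℂ, w 0 = u ∧
      (∀ q ∈ Finset.Icc i₀ i₁ ×ˢ Finset.Icc j₀ j₁, HasDerivAt (fun t => w t q) (U q) 0) ∧
      (∀ q ∉ Finset.Icc i₀ i₁ ×ˢ Finset.Icc j₀ j₁, ∀ t, w t q = u q) ∧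
      ∀ᶠ t in 𝓝 0, ∀ i j, i₀ ≤ i → i < i₁ → j₀ ≤ j → j < j₁ → sqv (a t) (w t) (i, j) = 0 := by
  -- The values on the right column and on the bottom row move along straight lines with velocity U;
  -- the indices count the steps to the left of i₁ and upwards from j₀.
  set d : ℂ → ℕ → ℕ → ℂ := fun t p q => u (i₁ - p, j₀ + q) + t * U (i₁ - p, j₀ + q) with hd
  have hdd : ∀ p q, HasDerivAt (fun t => d t p q) (U (i₁ - p, j₀ + q)) 0 := fun p q =>
    (((hasDerivAt_id (0 : ℂ)).mul_const _).const_add _).congr_deriv (one_mul _)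
  have hd0 : ∀ p q, d 0 p q = u (i₁ - p, j₀ + q) := fun p q => by simp [hd]
  -- The remaining values are forced by the equation. At t = 0 they reproduce u, and their
  -- velocities satisfy the same linearized equation with the same boundary data as U, so they agree
  -- with U.
  have key : ∀ p q : ℕ, i₀ + p ≤ i₁ → j₀ + q ≤ j₁ →
      grid (a 0) (d 0) p q = u (i₁ - p, j₀ + q) ∧
      HasDerivAt (fun t => grid (a t) (d t) p q) (U (i₁ - p, j₀ + q)) 0 := by
    intro p
    induction p with
    | zero => intro q _ _; simpa [grid] using And.intro (hd0 0 q) (hdd 0 q)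
    | succ p ihp =>
      intro q
      induction q with
      | zero => intro _ _; simpa [grid] using And.intro (hd0 (p + 1) 0) (hdd (p + 1) 0)
      | succ q ihq =>
        intro hp hq
        push_cast at hp hq
        obtain ⟨eu, du⟩ := ihq (by push_cast; omega) (by omega)
        obtain ⟨ex, dx⟩ := ihp q (by omega) (by omega)
        obtain ⟨ez, dz⟩ := ihp (q + 1) (by omega) (by push_cast; omega)
        obtain ⟨h1, h2, h3⟩ := h (i₁ - (p + 1)) (j₀ + q) (by omega) (by omega) (by omega) (by omega)
        simp only [sqv, sqd, sqy, Prod.mk_add_mk, add_zero] at h1 h2 h3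
        push_cast at eu du ex dx ez dz ⊢
        rw [show i₁ - ((p : ℤ) + 1) + 1 = i₁ - p by ring, add_assoc] at h1 h2 h3
        have := hasDerivAt_solve (y := u (i₁ - (p + 1), j₀ + (q + 1)))
          (Y := U (i₁ - (p + 1), j₀ + (q + 1))) ha du dx dz
        simp only [eu, ex, ez] at this
        simpa only [grid, eu, ex, ez] using this h1 h2 h3
  refine ⟨fun t q => if q ∈ Finset.Icc i₀ i₁ ×ˢ Finset.Icc j₀ j₁ then
    grid (a t) (d t) (i₁ - q.1).toNat (q.2 - j₀).toNat else u q, ?_, ?_, ?_, ?_⟩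
  · funext ⟨i, j⟩
    dsimp only
    split_ifs with hq
    · simp only [Finset.mem_product, Finset.mem_Icc] at hq
      rw [(key _ _ (by omega) (by omega)).1]
      congr 2 <;> omega
    · rfl
  · rintro ⟨i, j⟩ hq
    simp only [hq, if_true]
    simp only [Finset.mem_product, Finset.mem_Icc] at hq
    have := (key (i₁ - i).toNat (j - j₀).toNat (by omega) (by omega)).2
    have e : ((i₁ - ((i₁ - i).toNat : ℤ), j₀ + ((j - j₀).toNat : ℤ)) : ℤ × ℤ) = (i, j) := by
      congr 1 <;> omega
    rwa [e] at this
  · intro q hq t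
    simp [hq]
  -- The recursive quotients solve the equation only as long as their finitely many denominators are
  -- nonzero, which persists for small t.
  · have hy : ∀ᶠ t in 𝓝 (0 : ℂ), ∀ p ∈ Finset.range (i₁ - i₀).toNat,
        ∀ q ∈ Finset.range (j₁ - j₀).toNat, aqy (a t) (grid (a t) (d t) (p + 1) q)
          (grid (a t) (d t) p q) (grid (a t) (d t) p (q + 1)) ≠ 0 := by
      rw [eventually_all_finset]
      intro p hp
      rw [eventually_all_finset]
      intro q hq
      simp only [Finset.mem_range] at hp hq
      obtain ⟨eu, du⟩ := key (p + 1) q (by push_cast; omega) (by omega)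
      obtain ⟨ex, dx⟩ := key p q (by omega) (by omega)
      obtain ⟨ez, dz⟩ := key p (q + 1) (by omega) (by push_cast; omega)
      refine (hasDerivAt_aqy ha du dx dz).continuousAt.eventually_ne ?_
      rw [eu, ex, ez]
      obtain ⟨-, h2, -⟩ := h (i₁ - (p + 1)) (j₀ + q) (by omega) (by omega) (by omega) (by omega)
      simp only [sqy, Prod.mk_add_mk, add_zero] at h2
      rw [show i₁ - ((p : ℤ) + 1) + 1 = i₁ - p by ring, add_assoc] at h2
      push_cast
      exact h2
    filter_upwards [hy] with t ht i j hi hi' hj hj'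
    have m1 : (i, j) ∈ Finset.Icc i₀ i₁ ×ˢ Finset.Icc j₀ j₁ := by
      simp only [Finset.mem_product, Finset.mem_Icc]; omega
    have m2 : (i + 1, j) ∈ Finset.Icc i₀ i₁ ×ˢ Finset.Icc j₀ j₁ := by
      simp only [Finset.mem_product, Finset.mem_Icc]; omega
    have m3 : (i, j + 1) ∈ Finset.Icc i₀ i₁ ×ˢ Finset.Icc j₀ j₁ := by
      simp only [Finset.mem_product, Finset.mem_Icc]; omega
    have m4 : (i + 1, j + 1) ∈ Finset.Icc i₀ i₁ ×ˢ Finset.Icc j₀ j₁ := by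
      simp only [Finset.mem_product, Finset.mem_Icc]; omega
    simp only [sqv, Prod.mk_add_mk, add_zero, m1, m2, m3, m4, if_true]
    have := ht (i₁ - (i + 1)).toNat (by rw [Finset.mem_range]; omega) (j - j₀).toNat
      (by rw [Finset.mem_range]; omega)
    rw [show (i₁ - i).toNat = (i₁ - (i + 1)).toNat + 1 by omega,
      show (j + 1 - j₀).toNat = (j - j₀).toNat + 1 by omega, grid, aq_eq]
    field_simp
    ring

/-! ### Evaluation along curves which move finitely many values -/

section Window

variable {G D : Type} [AddCommGroup G] [Directions G D] [DecidableEq G]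

open Directions

/-- Only finitely many values move, so only finitely many inequalities are at stake, and each of
them is an open condition. -/
theorem RegAll.eventually_curve [Finite D] {w : ℂ → G → ℂ} {B : Finset G} {t₀ : ℂ}
    (hw : RegAll D (w t₀)) (hB : ∀ q ∈ B, ContinuousAt (fun t => w t q) t₀)
    (hB' : ∀ q ∉ B, ∀ t, w t q = w t₀ q) : ∀ᶠ t in 𝓝 t₀, RegAll D (w t) := by
  have hc : ∀ q, ContinuousAt (fun t => w t q) t₀ := fun q => by
    by_cases hq : q ∈ B
    · exact hB q hq
    · simp only [hB' q hq]; exact continuousAt_const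
  refine eventually_all.2 fun d => ?_
  have h1 : ∀ᶠ t in 𝓝 t₀, ∀ q ∈ B, w t q ≠ w t (q - vec d - vec d) ∧
      w t (q + vec d + vec d) ≠ w t q := by
    rw [eventually_all_finset]
    intro q _
    have ha := hw d (q - vec d)
    rw [sub_add_cancel] at ha
    have hb := hw d (q + vec d)
    rw [add_sub_cancel_right] at hb
    filter_upwards [((hc q).sub (hc (q - vec d - vec d))).eventually_ne (sub_ne_zero.2 ha),
      ((hc (q + vec d + vec d)).sub (hc q)).eventually_ne (sub_ne_zero.2 hb)] with t h2 h3
    exact ⟨sub_ne_zero.1 h2, sub_ne_zero.1 h3⟩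
  filter_upwards [h1] with t ht q
  by_cases h2 : q + vec d ∈ B
  · have := (ht _ h2).1
    rwa [add_sub_cancel_right] at this
  · by_cases h3 : q - vec d ∈ B
    · have := (ht _ h3).2
      rwa [sub_add_cancel] at this
    · rw [hB' _ h2, hB' _ h3]; exact hw d q

/-- The values outside `B` stand still instead of moving with velocity `xx`, but P does not depend
on them, so the derivative is the same. -/
theorem hasDerivAt_ev_window [Fintype D] [DecidableEq D] {cv : ℂ → D → Fin 6 → ℂ} {w : ℂ → G → ℂ}
    {t₀ : ℂ} {cc : D → Fin 6 → LAlg G D} {xx : G → LAlg G D} {B : Finset G} {P : LAlg G D}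
    (hc : ∀ d j, HasDerivAt (fun t => cv t d j) (ev (cv t₀) (w t₀) (cc d j)) t₀)
    (hx : ∀ q ∈ B, HasDerivAt (fun t => w t q) (ev (cv t₀) (w t₀) (xx q)) t₀)
    (hB : ∀ q ∉ B, ∀ t, w t q = w t₀ q) (hu : RegAll D (w t₀)) (hP : ∀ q ∉ B, pd q P = 0) :
    HasDerivAt (fun t => ev (cv t) (w t) P) (ev (cv t₀) (w t₀) (goodDer cc xx P)) t₀ := by
  have h := hasDerivAt_ev (xx := fun q => if q ∈ B then xx q else 0) hc (fun q => ?_) hu P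
  · refine h.congr_deriv ?_
    rw [goodDer_split cc xx, goodDer_split cc (fun q => _), goodDer_eq_sum hP, goodDer_eq_sum hP]
    congr 2
    exact Finset.sum_congr rfl fun q hq => by simp [hq]
  · by_cases hq : q ∈ B
    · simpa [hq] using hx q hq
    · simpa [hq, hB q hq] using hasDerivAt_const t₀ (w t₀ q)

end Window

/-! ### The extended symmetry on a strip -/

/-- The coefficients of the biquadratic polynomial `Q_y Q_z - Q Q_{yz}`. -/
def aDisc (a : Fin 7 → ℂ) : Fin 6 → ℂ :=
  ![a 1 ^ 2 - a 0 * a 2, (a 1 * (a 3 + a 4) - a 1 * a 2 - a 0 * a 5) / 2, a 3 * a 4 - a 1 * a 5,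
    (a 3 ^ 2 + a 4 ^ 2 - a 2 ^ 2 - a 0 * a 6) / 2,
    (a 5 * (a 3 + a 4) - a 5 * a 2 - a 6 * a 1) / 2, a 5 ^ 2 - a 2 * a 6]

/-- The coefficients of the affine-linear part of
`Q_{xz} Q_u Q_y - (F_x(u, x) Q_u + F_z(y, z) Q_y) / 2`, where `F` is `aDisc`. -/
def aTau (a : Fin 7 → ℂ) : Fin 7 → ℂ :=
  ![a 0 * a 1 * a 5 - a 0 * a 2 ^ 2 + a 1 ^ 2 * a 2 - a 1 ^ 2 * a 3,
    (-a 0 * a 2 * a 5 + a 0 * a 3 * a 5 + 2 * a 1 ^ 2 * a 5 - a 1 * a 2 ^ 2 + a 1 * a 2 * a 4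
      - a 1 * a 3 ^ 2 - a 1 * a 3 * a 4) / 2,
    (-a 0 * a 2 * a 6 + a 0 * a 5 ^ 2 + a 1 ^ 2 * a 6 + 2 * a 1 * a 2 * a 5 - 2 * a 1 * a 4 * a 5
      - a 2 ^ 3 - a 2 * a 3 ^ 2 + a 2 * a 4 ^ 2) / 2,
    (a 0 * a 3 * a 6 - a 0 * a 5 ^ 2 - a 1 ^ 2 * a 6 + 2 * a 1 * a 3 * a 5 + 2 * a 1 * a 4 * a 5
      - a 2 ^ 2 * a 3 - a 3 ^ 3 - a 3 * a 4 ^ 2) / 2,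
    -a 1 * a 2 * a 5 + a 1 * a 3 * a 5 + a 1 * a 4 * a 5 - a 3 ^ 2 * a 4,
    (-a 1 * a 2 * a 6 + a 1 * a 3 * a 6 + 2 * a 1 * a 5 ^ 2 - a 2 ^ 2 * a 5 + a 2 * a 4 * a 5
      - a 3 ^ 2 * a 5 - a 3 * a 4 * a 5) / 2,
    a 1 * a 5 * a 6 - a 2 ^ 2 * a 6 + a 2 * a 5 ^ 2 - a 3 * a 5 ^ 2]

/-- As Q is affine in y and in z, the expression Q_y Q_z - Q Q_{yz} contains neither of them. On
solutions it factorizes the biquadratic polynomial as Q_y Q_z. -/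
theorem bq_aDisc (a : Fin 7 → ℂ) (u x y z : ℂ) : bq (aDisc a) u x =
    aqy a u x z * aqz a u x y - aq a u x y z * (a 0 * u * x + a 1 * (u + x) + a 2) := by
  simp [bq, aDisc, aqy, aqz, aq, affineQ]; ring

/-- Modulo Q, the edge expression reduces to an affine-linear polynomial with the same symmetries as
Q, which can then be compared with ∂_α Q coefficient by coefficient. -/
theorem aTau_spec (a : Fin 7 → ℂ) (u x y z : ℂ) :
    (a 0 * u * y + a 1 * (u + y) + a 4) * aqu a x y z * aqy a u x z
      - (bqh (aDisc a) u x * aqu a x y z + bqh (aDisc a) y z * aqy a u x z) =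
    aq (aTau a) u x y z + ((a 0 * y * z + a 1 * (y + z) + a 2) * (a 0 * u * x + a 1 * (u + x) + a 2)
      + (a 0 * a 4 - a 1 ^ 2) * u * y
      + (a 1 * (a 4 - a 3 - a 2) + a 0 * a 5) / 2 * (u + y)) * aq a u x y z := by
  simp [bqh, aDisc, aqy, aqu, aq, affineQ, aTau]; ring

theorem bq_mul (κ : ℂ) (c C : Fin 6 → ℂ) (h : ∀ j, C j = κ * c j) (u x : ℂ) :
    bq C u x = κ * bq c u x := by simp only [bq, h]; ring

theorem bqh_mul (κ : ℂ) (c C : Fin 6 → ℂ) (h : ∀ j, C j = κ * c j) (u x : ℂ) :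
    bqh C u x = κ * bqh c u x := by simp only [bqh, h]; ring

theorem bqp_div (c : Fin 6 → ℂ) {u x x' : ℂ} (h : x - x' ≠ 0) :
    bqp c u x x' / (x - x') = bq c u x / (x - x') - bqh c u x := by
  field_simp
  linear_combination -bq_sub c u x x'

/-- The coefficients `a`, `c` of the lattice equation and of the biquadratic polynomial, at a value
of the parameter where the derivative of `a` is `a'`. -/
def Compatible (a a' : Fin 7 → ℂ) (c : Fin 6 → ℂ) (r : ℂ) : Prop :=
  ∃ κ lam : ℂ, κ ≠ 0 ∧ (∀ j, aDisc a j = κ * c j) ∧ ∀ k, κ * (r * a' k) + aTau a k = lam * a k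

/-- The squares (u, x, y, z) and (u, x', y, z') share the edge from u to y. Subtracting their
equations gives Q_z/(x - x') + Q_x/(z - z') = Q_{xz} (`e9`), which eliminates x' and z'. After
multiplication by κ the values of f factorize (`e1`, `e2`), the sum of the two characteristic terms
is the left side of `aTau_spec`, and compatibility identifies the result with -κ r ∂_α Q. -/
theorem half_extended {a a' : Fin 7 → ℂ} {c : Fin 6 → ℂ} {r : ℂ} (h : Compatible a a' c r)
    {u x y z x' z' : ℂ} (hQ : aq a u x y z = 0) (hQ' : aq a u x' y z' = 0) (hx : x - x' ≠ 0)
    (hz : z - z' ≠ 0) :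
    bqp c u x x' / (x - x') * aqu a x y z + bqp c y z z' / (z - z') * aqy a u x z
      + r * aq a' u x y z = 0 := by
  obtain ⟨κ, lam, hκ, hc, ha⟩ := h
  refine (mul_eq_zero.1 (?_ : κ * _ = 0)).resolve_left hκ
  rw [bqp_div c hx, bqp_div c hz]
  have e1 : κ * bq c u x = aqy a u x z * aqz a u x y := by
    rw [← bq_mul κ c _ hc, bq_aDisc a u x y z, hQ]; ring
  have e2 : κ * bq c y z = aqu a x y z * aqx a u y z := by
    rw [← bq_mul κ c _ hc, bq_aDisc a y z u x]
    have : aq a y z u x = 0 := by rw [← hQ]; simp only [aq, affineQ]; ring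
    rw [this]
    simp only [aqy, aqz, aqu, aqx]; ring
  have e3 : κ * bqh c u x = bqh (aDisc a) u x := (bqh_mul κ c _ hc _ _).symm
  have e4 : κ * bqh c y z = bqh (aDisc a) y z := (bqh_mul κ c _ hc _ _).symm
  have e5 : κ * (r * aq a' u x y z) = -aq (aTau a) u x y z := by
    have : κ * (r * aq a' u x y z) + aq (aTau a) u x y z = lam * aq a u x y z := by
      simp only [aq, affineQ]
      linear_combination u * x * y * z * ha 0 + (u * y * z + x * y * z + u * x * z + u * x * y) * ha 1
        + (u * x + y * z) * ha 2 + (u * z + x * y) * ha 3 + (x * z + u * y) * ha 4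
        + (u + x + y + z) * ha 5 + ha 6
    rw [hQ] at this
    linear_combination this
  have e6 := aTau_spec a u x y z
  rw [hQ, mul_zero, add_zero] at e6
  have e7 : (x - x') * aqx a u y z = -(z - z') * aqz a u x' y := by
    have : aq a u x y z - aq a u x' y z' = (x - x') * aqx a u y z + (z - z') * aqz a u x' y := by
      simp only [aq, affineQ, aqx, aqz]; ring
    rw [hQ, hQ'] at this
    linear_combination -this
  have e8 : aqz a u x y - aqz a u x' y = (x - x') * (a 0 * u * y + a 1 * (u + y) + a 4) := by
    simp only [aqz]; ring
  have e9 : aqz a u x y / (x - x') + aqx a u y z / (z - z') =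
      a 0 * u * y + a 1 * (u + y) + a 4 := by
    rw [div_add_div _ _ hx hz, div_eq_iff (mul_ne_zero hx hz)]
    linear_combination e7 + (z - z') * e8
  linear_combination aqu a x y z / (x - x') * e1 + aqy a u x z / (z - z') * e2
    - aqu a x y z * e3 - aqy a u x z * e4 + e5 + e6 + aqu a x y z * aqy a u x z * e9

/-- A row of a function on the lattice. -/
def row (u : ℤ × ℤ → ℂ) (j : ℤ) : ℤ → ℂ := fun i => u (i, j)

/-- The value of a function of the variables of a row at the lattice point `q`. -/
def re (c : Fin 6 → ℂ) (u : ℤ × ℤ → ℂ) (P : L1) (q : ℤ × ℤ) : ℂ :=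
  e1 c (row u q.2) (shiftHom q.1 P)

theorem re_R0 (c : Fin 6 → ℂ) (u : ℤ × ℤ → ℂ) (i j : ℤ) : re c u R0 (i, j) =
    bqp c (u (i, j)) (u (i + 1, j)) (u (i - 1, j)) / (u (i + 1, j) - u (i - 1, j)) :=
  e1_shift_R0 _ _ _

theorem reg_row_sub {u : ℤ × ℤ → ℂ} {j : ℤ} (h : Reg (row u j)) (i : ℤ) :
    u (i + 1, j) - u (i - 1, j) ≠ 0 := sub_ne_zero.2 (h.ne i)

theorem half_extended_left {a a' : Fin 7 → ℂ} {c : Fin 6 → ℂ} {r : ℂ} (h : Compatible a a' c r)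
    {u : ℤ × ℤ → ℂ} {i j : ℤ} (h₀ : Reg (row u j)) (h₁ : Reg (row u (j + 1)))
    (hQ : sqv a u (i, j) = 0) (hQ' : sqv a u (i - 1, j) = 0) :
    re c u R0 (i, j) * aqu a (u (i + 1, j)) (u (i, j + 1)) (u (i + 1, j + 1))
      + re c u R0 (i, j + 1) * aqy a (u (i, j)) (u (i + 1, j)) (u (i + 1, j + 1))
      + r * sqv a' u (i, j) = 0 := by
  simp only [sqv, Prod.mk_add_mk, add_zero, sub_add_cancel] at hQ hQ' ⊢
  rw [re_R0, re_R0]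
  refine half_extended h hQ ?_ (reg_row_sub h₀ i) (reg_row_sub h₁ i)
  rw [← hQ']
  simp only [aq, affineQ]; ring

/-- The reflection u ↔ x, y ↔ z preserves Q and exchanges the forward and backward neighbours. It
changes the sign of the denominators but not the polarizations, so the parameter term appears with
the opposite sign. -/
theorem half_extended_right {a a' : Fin 7 → ℂ} {c : Fin 6 → ℂ} {r : ℂ} (h : Compatible a a' c r)
    {u : ℤ × ℤ → ℂ} {i j : ℤ} (h₀ : Reg (row u j)) (h₁ : Reg (row u (j + 1)))
    (hQ : sqv a u (i, j) = 0) (hQ' : sqv a u (i + 1, j) = 0) :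
    re c u R0 (i + 1, j) * aqx a (u (i, j)) (u (i, j + 1)) (u (i + 1, j + 1))
      + re c u R0 (i + 1, j + 1) * aqz a (u (i, j)) (u (i + 1, j)) (u (i, j + 1))
      = r * sqv a' u (i, j) := by
  simp only [sqv, Prod.mk_add_mk, add_zero] at hQ hQ' ⊢
  rw [re_R0, re_R0]
  have n0 := reg_row_sub h₀ (i + 1)
  have n1 := reg_row_sub h₁ (i + 1)
  simp only [add_sub_cancel_right] at n0 n1 ⊢
  have := half_extended h (u := u (i + 1, j)) (x := u (i, j)) (x' := u (i + 1 + 1, j))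
    (y := u (i + 1, j + 1)) (z := u (i, j + 1)) (z' := u (i + 1 + 1, j + 1))
    (by rw [← hQ]; simp only [aq, affineQ]; ring) (by rw [← hQ']) (by
      rw [← neg_sub]; exact neg_ne_zero.2 n0) (by rw [← neg_sub]; exact neg_ne_zero.2 n1)
  rw [← neg_sub (u (i + 1 + 1, j)), ← neg_sub (u (i + 1 + 1, j + 1)), div_neg, div_neg,
    bqp_comm c (u (i + 1, j)), bqp_comm c (u (i + 1, j + 1))] at this
  simp only [aqu, aqx, aqy, aqz, aq, affineQ] at this ⊢
  linear_combination -this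

theorem sqd_add (a : Fin 7 → ℂ) (u U V : ℤ × ℤ → ℂ) (q : ℤ × ℤ) :
    sqd a u (fun p => U p + V p) q = sqd a u U q + sqd a u V q := by
  simp only [sqd, aqd]; ring

theorem sqd_smul (a : Fin 7 → ℂ) (u U : ℤ × ℤ → ℂ) (s : ℂ) (q : ℤ × ℤ) :
    sqd a u (fun p => s * U p) q = s * sqd a u U q := by
  simp only [sqd, aqd]; ring

/-- The parameter terms of the left and the right half cancel. -/
theorem sqd_R0 {a a' : Fin 7 → ℂ} {c : Fin 6 → ℂ} {r : ℂ} (h : Compatible a a' c r)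
    {u : ℤ × ℤ → ℂ} {i j : ℤ} (h₀ : Reg (row u j)) (h₁ : Reg (row u (j + 1)))
    (hQ : sqv a u (i, j) = 0) (hl : sqv a u (i - 1, j) = 0) (hr : sqv a u (i + 1, j) = 0) :
    sqd a u (re c u R0) (i, j) = 0 := by
  have e1 := half_extended_left h h₀ h₁ hQ hl
  have e2 := half_extended_right h h₀ h₁ hQ hr
  simp only [sqd, aqd, Prod.mk_add_mk, add_zero]
  linear_combination e1 + e2

/-- The extended symmetry on a strip. -/
theorem sqd_extended {a a' : Fin 7 → ℂ} {c : Fin 6 → ℂ} {r : ℂ} (h : Compatible a a' c r)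
    {u : ℤ × ℤ → ℂ} {i j : ℤ} (h₀ : Reg (row u j)) (h₁ : Reg (row u (j + 1)))
    (hQ : sqv a u (i, j) = 0) (hl : sqv a u (i - 1, j) = 0) (hr : sqv a u (i + 1, j) = 0) :
    sqd a u (fun p => (p.1 : ℂ) * re c u R0 p) (i, j) = r * sqv a' u (i, j) := by
  have e1 := half_extended_left h h₀ h₁ hQ hl
  have e2 := half_extended_right h h₀ h₁ hQ hr
  simp only [sqd, aqd, Prod.mk_add_mk, add_zero]
  push_cast
  -- The halves contribute -i and i + 1 times the parameter term, so exactly one copy is left.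
  linear_combination (i : ℂ) * e1 + (i + 1 : ℂ) * e2

/-! ### The hierarchy on a strip -/

/-- The characteristic `P` annihilates `aq` on the strips of solutions, in the square `(0, 0)`. -/
def StripSymmetry (a : Fin 7 → ℂ) (c : Fin 6 → ℂ) (P : L1) (N : ℤ) : Prop :=
  ∀ u : ℤ × ℤ → ℂ, Reg (row u 0) → Reg (row u 1) →
    (∀ i : ℤ, |i| ≤ N → sqv a u (i, 0) = 0 ∧ sqy a u (i, 0) ≠ 0) → sqd a u (re c u P) (0, 0) = 0

theorem StripSymmetry.translate {a : Fin 7 → ℂ} {c : Fin 6 → ℂ} {P : L1} {N : ℤ}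
    (h : StripSymmetry a c P N) {u : ℤ × ℤ → ℂ} (s j : ℤ) (h₀ : Reg (row u j))
    (h₁ : Reg (row u (j + 1)))
    (hu : ∀ i : ℤ, |i - s| ≤ N → sqv a u (i, j) = 0 ∧ sqy a u (i, j) ≠ 0) :
    sqd a u (re c u P) (s, j) = 0 := by
  have h0 : ∀ p, re c (fun p => u (p + (s, j))) P p = re c u P (p + (s, j)) := fun p => by
    simp only [re, e1_shift, row, Prod.mk_add_mk, Prod.fst_add, Prod.snd_add, add_assoc]
  have := h (fun p => u (p + (s, j))) ?_ ?_ ?_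
  · simp only [sqd, h0] at this
    simpa only [sqd, add_comm _ (s, j), add_zero, Prod.mk_add_mk, zero_add] using this
  · have e : row (fun p => u (p + (s, j))) 0 = fun q => row u j (q + s) := by
      funext q; simp [row]
    rw [e]; exact h₀.shift s
  · have e : row (fun p => u (p + (s, j))) 1 = fun q => row u (j + 1) (q + s) := by
      funext q; simp [row, add_comm]
    rw [e]; exact h₁.shift s
  · intro i hi
    have := hu (i + s) (by simpa using hi)
    simpa only [sqv, sqy, Prod.mk_add_mk, zero_add, add_zero, add_comm 1 j,
      add_right_comm i 1 s] using this

/-- A function on a rectangle moving along a curve has regular rows. -/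
theorem eventually_reg_row {w : ℂ → ℤ × ℤ → ℂ} {u U : ℤ × ℤ → ℂ} {i₀ i₁ j₀ j₁ j : ℤ} (hw0 : w 0 = u)
    (hw : ∀ q ∈ Finset.Icc i₀ i₁ ×ˢ Finset.Icc j₀ j₁, HasDerivAt (fun t => w t q) (U q) 0)
    (hw' : ∀ q ∉ Finset.Icc i₀ i₁ ×ˢ Finset.Icc j₀ j₁, ∀ t, w t q = u q) (hj₀ : j₀ ≤ j)
    (hj₁ : j ≤ j₁) (hu : Reg (row u j)) :
    ∀ᶠ t in 𝓝 0, Reg (row (w t) j) := by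
  refine RegAll.eventually_curve (w := fun t => row (w t) j) (B := Finset.Icc i₀ i₁) ?_ ?_ ?_
  · simpa [hw0] using hu
  · intro i hi
    exact (hw (i, j) (Finset.mem_product.2 ⟨hi, Finset.mem_Icc.2 ⟨hj₀, hj₁⟩⟩)).continuousAt
  · intro i hi t
    have : (i, j) ∉ Finset.Icc i₀ i₁ ×ˢ Finset.Icc j₀ j₁ := fun h => hi (Finset.mem_product.1 h).1
    change w t (i, j) = w 0 (i, j)
    rw [hw0, hw' _ this]

/-- The derivative of a function of the variables of a row along a curve. -/
theorem hasDerivAt_re {w : ℂ → ℤ × ℤ → ℂ} {u U : ℤ × ℤ → ℂ} {i₀ i₁ j₀ j₁ : ℤ} (hw0 : w 0 = u)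
    (hw : ∀ q ∈ Finset.Icc i₀ i₁ ×ˢ Finset.Icc j₀ j₁, HasDerivAt (fun t => w t q) (U q) 0)
    (hw' : ∀ q ∉ Finset.Icc i₀ i₁ ×ˢ Finset.Icc j₀ j₁, ∀ t, w t q = u q)
    {c : ℂ → Fin 6 → ℂ} {cc : Fin 6 → L1} {xx : ℤ → L1} {i j : ℤ} (hj₀ : j₀ ≤ j) (hj₁ : j ≤ j₁)
    (hu : Reg (row u j))
    (hc : ∀ k, HasDerivAt (fun t => c t k) (e1 (c 0) (row u j) (cc k)) 0)
    (hx : ∀ l ∈ Finset.Icc i₀ i₁, U (l, j) = e1 (c 0) (row u j) (xx l)) {P : L1}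
    (hP : ∀ l ∉ Finset.Icc i₀ i₁, pd l (shiftHom i P) = 0) :
    HasDerivAt (fun t => re (c t) (w t) P (i, j))
      (e1 (c 0) (row u j) (goodDer (fun _ => cc) xx (shiftHom i P))) 0 := by
  have := hasDerivAt_ev_window (D := Unit) (cv := fun t _ => c t) (w := fun t => row (w t) j)
    (t₀ := 0) (cc := fun _ => cc) (xx := xx) (B := Finset.Icc i₀ i₁) (P := shiftHom i P)
    ?_ ?_ ?_ ?_ hP
  · simp only [hw0] at this; exact this
  · intro _ k; simpa only [hw0] using hc k
  · intro l hl
    have := hw (l, j) (Finset.mem_product.2 ⟨hl, Finset.mem_Icc.2 ⟨hj₀, hj₁⟩⟩)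
    rw [hx l hl] at this
    simp only [hw0]; exact this
  · intro l hl t
    have : (l, j) ∉ Finset.Icc i₀ i₁ ×ˢ Finset.Icc j₀ j₁ := fun h => hl (Finset.mem_product.1 h).1
    change w t (l, j) = w 0 (l, j)
    rw [hw0, hw' _ this]
  · simpa only [hw0] using hu

theorem corners_subset {i₀ i₁ j₀ j₁ i j : ℤ} (h1 : i₀ ≤ i) (h2 : i < i₁) (h3 : j₀ ≤ j)
    (h4 : j < j₁) : ∀ p ∈ corners (i, j), p ∈ Finset.Icc i₀ i₁ ×ˢ Finset.Icc j₀ j₁ := by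
  intro p hp
  simp only [corners, Set.mem_insert_iff, Set.mem_singleton_iff, Prod.mk_add_mk, add_zero] at hp
  simp only [Finset.mem_product, Finset.mem_Icc]
  rcases hp with rfl | rfl | rfl | rfl <;> simp <;> omega

theorem pd_shift_Rk_eq_zero (k : ℕ) {i l : ℤ} (h : (k : ℤ) + 1 < |l - i|) :
    pd l (shiftHom i (Rk k)) = 0 := by
  rw [pd_shiftHom, pd_Rk_eq_zero k h, map_zero]

/-- The coefficients of the lattice equation as functions of its first parameter. -/
structure Family (U : Set ℂ) (a : ℂ → Fin 7 → ℂ) (c : ℂ → Fin 6 → ℂ) (r : ℂ → ℂ) : Prop where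
  isOpen : IsOpen U
  deriv_c : ∀ s ∈ U, ∀ j, ∃ c', HasDerivAt (fun t => c t j) c' s ∧ r s * c' = bqDelta (c s) j
  deriv_a : ∀ s ∈ U, ∃ a', (∀ k, HasDerivAt (fun t => a t k) (a' k) s) ∧
    Compatible (a s) a' (c s) (r s)

theorem Family.curve_c {U : Set ℂ} {a : ℂ → Fin 7 → ℂ} {c : ℂ → Fin 6 → ℂ} {r : ℂ → ℂ}
    (hF : Family U a c r) {s : ℂ} (hs : s ∈ U) (j : Fin 6) :
    HasDerivAt (fun t => c (s - t * r s) j) (-bqDelta (c s) j) 0 := by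
  obtain ⟨c', h, e⟩ := hF.deriv_c s hs j
  have hl : HasDerivAt (fun t : ℂ => s - t * r s) (-r s) 0 := by
    simpa using! ((hasDerivAt_id (0 : ℂ)).mul_const (r s)).const_sub s
  have := HasDerivAt.comp (0 : ℂ) (h₂ := fun t => c t j) (by simpa using h) hl
  exact this.congr_deriv (by rw [← e]; ring)

theorem curve_a {a : ℂ → Fin 7 → ℂ} {a' : Fin 7 → ℂ} {s r : ℂ} {k : Fin 7}
    (h : HasDerivAt (fun t => a t k) (a' k) s) :
    HasDerivAt (fun t => a (s - t * r) k) (-r * a' k) 0 := by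
  have hl : HasDerivAt (fun t : ℂ => s - t * r) (-r) 0 := by
    simpa using! ((hasDerivAt_id (0 : ℂ)).mul_const r).const_sub s
  have := HasDerivAt.comp (0 : ℂ) (h₂ := fun t => a t k) (by simpa using h) hl
  exact this.congr_deriv (by ring)

theorem e1_bqDelta (c : Fin 6 → ℂ) (x : ℤ → ℂ) (j : Fin 6) :
    e1 c x (bqDelta cs j) = bqDelta c j := by
  fin_cases j <;> simp [bqDelta]

theorem sqv_smul (s : ℂ) (a : Fin 7 → ℂ) (u : ℤ × ℤ → ℂ) (q : ℤ × ℤ) :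
    sqv (fun k => s * a k) u q = s * sqv a u q := by simp only [sqv, aq, affineQ]; ring

theorem sqd_smul_left (s : ℂ) (a : Fin 7 → ℂ) (u U : ℤ × ℤ → ℂ) (q : ℤ × ℤ) :
    sqd (fun k => s * a k) u U q = s * sqd a u U q := by
  simp only [sqd, aqd, aqu, aqx, aqy, aqz]; ring

/-- Commutators of tangent fields are tangent. The linearized equation for `R_k` is differentiated
along a curve of solutions with tangent V, the parameter moving as well, and the one for V along a
curve with tangent `R_k`. The second differentials agree by symmetry and the terms with `a'` cancel.
What remains is the linearized equation for the characteristic of [V, v^{[k]}], which is that of `Rk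
(k + 1)` up to a multiple of the commutator vanishing by `hC`. The first differentiation varies the
parameter, so `hP` is needed on a whole open set. -/
theorem StripSymmetry.succ {U : Set ℂ} {a : ℂ → Fin 7 → ℂ} {c : ℂ → Fin 6 → ℂ} {r : ℂ → ℂ}
    (hF : Family U a c r) (k : ℕ)
    (hP : ∀ s ∈ U, StripSymmetry (a s) (c s) (Rk k) (2 * k + 2)) {s : ℂ} (hs : s ∈ U)
    (hC : ∀ x, Reg x → e1 (c s) x (br (Rk k) R0) = 0) :
    StripSymmetry (a s) (c s) (Rk (k + 1)) (2 * (k + 1 : ℕ) + 2) := by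
  intro u h₀ h₁ hu
  push_cast at hu
  obtain ⟨a', ha', hcomp⟩ := hF.deriv_a s hs
  have hQ : ∀ i : ℤ, |i| ≤ 2 * (k + 1) + 2 → sqv (a s) u (i, 0) = 0 := fun i hi => (hu i hi).1
  set V : ℤ × ℤ → ℂ := fun p => (p.1 : ℂ) * re (c s) u R0 p with hV
  set K : ℤ × ℤ → ℂ := re (c s) u (Rk k) with hK
  -- `sqd_extended` consults the two neighbouring squares, so one square is lost on each side.
  have hVlin : ∀ i : ℤ, |i| ≤ 2 * k + 3 → sqd (a s) u V (i, 0) = r s * sqv a' u (i, 0) := by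
    intro i hi
    rw [abs_le] at hi
    refine sqd_extended hcomp h₀ h₁ (hQ _ ?_) (hQ _ ?_) (hQ _ ?_) <;> rw [abs_le] <;> omega
  have hKlin : ∀ i : ℤ, |i| ≤ 2 → sqd (a s) u K (i, 0) = 0 := by
    intro i hi
    refine (hP s hs).translate i 0 h₀ h₁ fun l hl => hu l ?_
    rw [abs_le] at hi hl ⊢; omega
  -- the curve with tangent `V`
  have hl : Tendsto (fun t : ℂ => s - t * r s) (𝓝 0) (𝓝 s) := by
    have : Continuous fun t : ℂ => s - t * r s := by fun_prop
    simpa using this.tendsto 0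
  have E1 : sqd (fun k => -r s * a' k) u K (0, 0) + sqdd (a s) u V K (0, 0)
      + sqd (a s) u (fun p => re (c s) u (Rk (k + 1)) p
          + p.1 * re (c s) u (evo R0 (Rk k)) p) (0, 0) = 0 := by
    obtain ⟨w, hw0, hw, hw', hwQ⟩ := exists_tangent_curve (a := fun t => a (s - t * r s))
      (a' := fun k => -r s * a' k) (fun k => curve_a (ha' k)) u V (-(2 * k + 3)) (2 * k + 4) 0 1
      (by
        intro i j h1 h2 h3 h4
        obtain rfl : j = 0 := by omega
        have := hu i (by rw [abs_le]; omega)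
        simp only [zero_mul, sub_zero]
        refine ⟨this.1, this.2, ?_⟩
        rw [hVlin i (by rw [abs_le]; omega), sqv_smul]
        ring)
    have hre : ∀ i j : ℤ, 0 ≤ i → i ≤ 1 → 0 ≤ j → j ≤ 1 →
        HasDerivAt (fun t => re (c (s - t * r s)) (w t) (Rk k) (i, j))
        (re (c s) u (Rk (k + 1)) (i, j) + i * re (c s) u (evo R0 (Rk k)) (i, j)) 0 := by
      intro i j hi hi' hj hj'
      have hreg : Reg (row u j) := by
        obtain rfl | rfl : j = 0 ∨ j = 1 := by omega
        exacts [h₀, h₁]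
      have := hasDerivAt_re hw0 hw hw' (c := fun t => c (s - t * r s))
        (cc := fun j => -bqDelta cs j) (xx := fun l => C (l : ℂ) * shiftHom l R0) hj hj' hreg
        (i := i) (P := Rk k) ?_ ?_ ?_
      · refine this.congr_deriv ?_
        change e1 _ _ (recD _) = _
        rw [recD_shiftHom]
        simp [re, Rk]
      · intro l
        simpa [e1_bqDelta] using hF.curve_c hs l
      · intro l _
        simp [hV, re]
      · intro l hl
        refine pd_shift_Rk_eq_zero k ?_
        rw [Finset.mem_Icc] at hl
        rw [lt_abs]; omega
    have hd := hasDerivAt_sqd (q := (0, 0)) (fun k => curve_a (r := r s) (ha' k))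
      (fun p hp => hw p (corners_subset (by omega) (by omega) le_rfl (by omega) p hp))
      (V := fun t => re (c (s - t * r s)) (w t) (Rk k))
      (V' := fun p => re (c s) u (Rk (k + 1)) p + p.1 * re (c s) u (evo R0 (Rk k)) p) (by
        intro p hp
        have := corners_subset (i₀ := 0) (i₁ := 1) (j₀ := 0) (j₁ := 1) le_rfl (by omega) le_rfl
          (by omega) p hp
        simp only [Finset.mem_product, Finset.mem_Icc] at this
        exact hre p.1 p.2 this.1.1 this.1.2 this.2.1 this.2.2)
    have hz := hd.unique ((hasDerivAt_const (0 : ℂ) (0 : ℂ)).congr_of_eventuallyEq ?_)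
    · simpa only [zero_mul, sub_zero, hw0] using hz
    · have hy : ∀ᶠ t in 𝓝 (0 : ℂ), ∀ i ∈ Finset.Icc (-(2 * k + 2) : ℤ) (2 * k + 2),
          sqy (a (s - t * r s)) (w t) (i, 0) ≠ 0 := by
        rw [eventually_all_finset]
        intro i hi
        rw [Finset.mem_Icc] at hi
        have hc := fun p hp => hw p (corners_subset (i := i) (j := 0) (by omega) (by omega) le_rfl
          (by omega) p hp)
        have := (hasDerivAt_aqy (fun k => curve_a (r := r s) (ha' k)) (hc (i, 0) (by simp [corners]))
          (hc ((i, 0) + (1, 0)) (by simp [corners])) (hc ((i, 0) + (1, 1))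
          (by simp [corners]))).continuousAt.eventually_ne (y := 0)
        refine this ?_
        simp only [zero_mul, sub_zero, hw0]
        exact (hu i (by rw [abs_le]; omega)).2
      filter_upwards [hwQ, hy, hl.eventually (hF.isOpen.mem_nhds hs),
        eventually_reg_row hw0 hw hw' le_rfl (by omega) h₀,
        eventually_reg_row hw0 hw hw' (by omega) le_rfl h₁] with t t1 t2 t3 t4 t5
      refine hP _ t3 _ t4 t5 fun i hi => ?_
      rw [abs_le] at hi
      exact ⟨t1 i 0 (by omega) (by omega) le_rfl (by omega), t2 i (Finset.mem_Icc.2 hi)⟩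
  -- the curve with tangent `K`
  have E2 : sqd (a s) u (fun p => p.1 * re (c s) u (evo (Rk k) R0) p) (0, 0)
      + sqdd (a s) u K V (0, 0) - r s * sqd a' u K (0, 0) = 0 := by
    obtain ⟨w, hw0, hw, hw', hwQ⟩ := exists_tangent_curve (a := fun _ => a s)
      (a' := 0) (fun k => hasDerivAt_const _ _) u K (-1) 2 0 1
      (by
        intro i j h1 h2 h3 h4
        obtain rfl : j = 0 := by omega
        have := hu i (by rw [abs_le]; omega)
        refine ⟨this.1, this.2, ?_⟩
        rw [hKlin i (by rw [abs_le]; omega)]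
        simp [sqv, aq, affineQ])
    have hre : ∀ i j : ℤ, 0 ≤ i → i ≤ 1 → 0 ≤ j → j ≤ 1 →
        HasDerivAt (fun t => i * re (c s) (w t) R0 (i, j))
        (i * re (c s) u (evo (Rk k) R0) (i, j)) 0 := by
      intro i j hi hi' hj hj'
      have hreg : Reg (row u j) := by
        obtain rfl | rfl : j = 0 ∨ j = 1 := by omega
        exacts [h₀, h₁]
      refine HasDerivAt.const_mul _ ?_
      have := hasDerivAt_re hw0 hw hw' (c := fun t => c s)
        (cc := 0) (xx := fun l => shiftHom l (Rk k)) hj hj' hreg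
        (i := i) (P := R0) ?_ ?_ ?_
      · refine this.congr_deriv ?_
        change e1 _ _ (evo _ _) = _
        rw [evo_shiftHom]
        simp [re]
      · intro l
        simpa using hasDerivAt_const _ _
      · intro l _
        simp [hK, re]
      · intro l hl
        refine pd_shift_Rk_eq_zero 0 ?_
        rw [Finset.mem_Icc] at hl
        rw [lt_abs]; push_cast; omega
    have hc := fun p hp => hw p (corners_subset (i := 0) (j := 0) (by omega) (by omega) le_rfl
      (by omega) p hp)
    have hd := hasDerivAt_sqd (q := (0, 0)) (a := fun _ => a s) (a' := 0)
      (fun k => hasDerivAt_const _ _) hc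
      (V := fun t p => p.1 * re (c s) (w t) R0 p)
      (V' := fun p => p.1 * re (c s) u (evo (Rk k) R0) p) (by
        intro p hp
        have := corners_subset (i₀ := 0) (i₁ := 1) (j₀ := 0) (j₁ := 1) le_rfl (by omega) le_rfl
          (by omega) p hp
        simp only [Finset.mem_product, Finset.mem_Icc] at this
        exact hre p.1 p.2 this.1.1 this.1.2 this.2.1 this.2.2)
    have hd2 := (hasDerivAt_sqv (a := fun _ => a') (a' := 0)
      (fun k => hasDerivAt_const _ _) hc).const_mul (r s)
    have hz := (hd.sub hd2).unique ((hasDerivAt_const (0 : ℂ) (0 : ℂ)).congr_of_eventuallyEq ?_)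
    · have z1 : ∀ (x : ℤ × ℤ → ℂ), sqv 0 x (0, 0) = 0 := fun x => by simp [sqv, aq, affineQ]
      have z2 : ∀ (x y : ℤ × ℤ → ℂ), sqd 0 x y (0, 0) = 0 := fun x y => by
        simp [sqd, aqd, aqu, aqx, aqy, aqz]
      rw [z1, z2, hw0] at hz
      linear_combination hz
    · filter_upwards [hwQ, eventually_reg_row hw0 hw hw' le_rfl (by omega) h₀,
        eventually_reg_row hw0 hw hw' (by omega) le_rfl h₁] with t t1 t4 t5
      have := sqd_extended hcomp t4 t5 (t1 0 0 (by omega) (by omega) le_rfl (by omega))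
        (t1 (0 - 1) 0 (by omega) (by omega) le_rfl (by omega))
        (t1 (0 + 1) 0 (by omega) (by omega) le_rfl (by omega))
      simpa [sub_eq_zero] using this
  rw [sqd_smul_left, sqdd_comm, sqd_add] at E1
  have hbr : ∀ p ∈ corners (0, 0), re (c s) u (evo R0 (Rk k)) p = re (c s) u (evo (Rk k) R0) p := by
    intro p hp
    have hreg : Reg (row u p.2) := by
      have := corners_subset (i₀ := 0) (i₁ := 1) (j₀ := 0) (j₁ := 1) le_rfl (by omega) le_rfl
          (by omega) p hp
      simp only [Finset.mem_product, Finset.mem_Icc] at this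
      obtain h | h : p.2 = 0 ∨ p.2 = 1 := by omega
      all_goals rw [h]; assumption
    have := hC _ (hreg.shift p.1)
    rw [br, map_sub, ← e1_shift, ← e1_shift, sub_eq_zero] at this
    exact this.symm
  have e : sqd (a s) u (fun p => p.1 * re (c s) u (evo R0 (Rk k)) p) (0, 0) =
      sqd (a s) u (fun p => p.1 * re (c s) u (evo (Rk k) R0) p) (0, 0) := by
    simp only [sqd]
    rw [hbr _ (by simp [corners]), hbr _ (by simp [corners]), hbr _ (by simp [corners]),
      hbr _ (by simp [corners])]
  linear_combination E1 - E2 - e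

/-! ### Commutation with the basic symmetry, as a limit of the strips -/

theorem evo_C_mul (s : ℂ) (F P : L1) : evo (C s * F) P = C s * evo F P := by
  have : evo (C s * F) = (C s : L1) • evo F := by
    refine derivation_ext fun g => ?_
    rcases g with ⟨d, j⟩ | q | ⟨d, q⟩
    · simp
    · simp [← algebraMap_eq]
    · simp [evo, ← algebraMap_eq]; ring
  rw [this]; rfl

/-- If the strips of solutions degenerate to a row and its translate, then their symmetries commute
with the basic one. -/
theorem commute_of_strips {b : ℂ → Fin 7 → ℂ} {b' : Fin 7 → ℂ} {c : Fin 6 → ℂ} {μ ν : ℂ}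
    (hb : ∀ k, HasDerivAt (fun t => b t k) (b' k) 0) (hμ : μ ≠ 0) (hν : ν ≠ 0)
    (h0 : b 0 = ![0, 0, μ, 0, -μ, 0, 0])
    (hb' : b' 0 = ν * c 0 ∧ b' 1 = ν * c 1 ∧ b' 3 = ν * c 2 ∧ b' 2 + b' 4 = ν * c 3 ∧
      b' 5 = ν * c 4 ∧ b' 6 = ν * c 5) (k : ℕ) {N : ℤ}
    (hP : ∀ᶠ t in 𝓝[≠] 0, StripSymmetry (b t) c (Rk k) N) {x : ℤ → ℂ} (hx : Reg x) :
    e1 c x (br (Rk k) R0) = 0 := by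
  -- The upper row will be the translate of the lower one, so the commutator appears at site 1.
  suffices key : ∀ {x : ℤ → ℂ}, Reg x → e1 c x (shiftHom 1 (br (Rk k) R0)) = 0 by
    have := key (hx.shift (-1))
    rw [← e1_shift, shiftHom_shiftHom] at this
    simpa using this
  clear hx x
  intro x hx
  -- At t = 0 the polynomial is μ(u - z)(x - y); a row with its translate by one above it satisfies
  -- x = y on every square.
  set u : ℤ × ℤ → ℂ := fun p => if p.2 = 0 then x p.1 else x (p.1 + 1) with hu
  -- With the lower row held fixed, the first-order equation forces this velocity of the upper row:
  -- `b'` evaluated on the square gives ν times the polarization of f, and Q_y at t = 0 is μ(x_{i+2}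
  -- - x_i). The strip is thus a Bäcklund transformation whose derivative at the translation is the
  -- basic flow.
  set U : ℤ × ℤ → ℂ := fun p => if p.2 = 0 then 0 else e1 c x (shiftHom (p.1 + 1) (C (-(ν / μ)) * R0))
    with hU
  have hr0 : row u 0 = x := by funext i; simp [row, hu]
  have hr1 : row u 1 = fun i => x (i + 1) := by funext i; simp [row, hu]
  have hu0 : ∀ i, u (i, 0) = x i := fun i => by simp [hu]
  have hu1 : ∀ i, u (i, 1) = x (i + 1) := fun i => by simp [hu]
  have hU0 : ∀ i, U (i, 0) = 0 := fun i => by simp [hU]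
  have hf : ∀ p q r : ℂ, μ * r + -(μ * p) ≠ 0 → aqy ![0, 0, μ, 0, -μ, 0, 0] p q r ≠ 0 := by
    intro p q r h
    simpa [aqy] using h
  have hreg0 : Reg (row u 0) := by rw [hr0]; exact hx
  have hreg1 : Reg (row u 1) := by rw [hr1]; exact hx.shift 1
  have hne : ∀ i : ℤ, x (i + 1 + 1) - x i ≠ 0 := fun i => by
    have := hx.ne (i + 1)
    rwa [add_sub_cancel_right, ← sub_ne_zero] at this
  have hR : ∀ i : ℤ, e1 c x (shiftHom (i + 1) (C (-(ν / μ)) * R0)) =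
      -(ν / μ) * (bqp c (x (i + 1)) (x (i + 1 + 1)) (x i) / (x (i + 1 + 1) - x i)) := by
    intro i
    have := e1_shift_R0 c x (i + 1)
    rw [add_sub_cancel_right] at this
    rw [map_mul, map_mul, this]
    simp [← algebraMap_eq]
  have hU1 : ∀ i : ℤ, U (i, 1) =
      -(ν / μ) * (bqp c (x (i + 1)) (x (i + 1 + 1)) (x i) / (x (i + 1 + 1) - x i)) := fun i => by
    rw [← hR]; simp [hU]
  set M : ℤ := max N (k + 3) with hM
  obtain ⟨w, hw0, hw, hw', hwQ⟩ := exists_tangent_curve hb u U (-M) (M + 1) 0 1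
    (by
      intro i j _ _ h3 h4
      obtain rfl : j = 0 := by omega
      refine ⟨?_, ?_, ?_⟩
      · simp [sqv, aq, affineQ, hu, h0]; ring
      · have := mul_ne_zero hμ (hne i)
        rw [mul_sub, sub_eq_add_neg] at this
        simpa only [sqy, aqy, Prod.mk_add_mk, add_zero, zero_add, hu0, hu1, h0] using hf _ _ _ this
      · simp only [sqv, sqd, aqd, aq, affineQ, aqu, aqx, aqy, aqz, hu, hU, h0, Prod.mk_add_mk,
          hR, hb'.1, hb'.2.1, hb'.2.2.1, hb'.2.2.2.2.1, hb'.2.2.2.2.2, bqp]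
        have := hne i
        simp
        field_simp
        -- Since y = x on the square, ux + yz equals xz + uy, so only the sum of the corresponding
        -- coefficients of `b'` matters.
        linear_combination (x (i + 1 + 1) - x i) * (x (i + 1) * x i + x (i + 1) * x (i + 1 + 1)) * hb'.2.2.2.1)
  have hMN : N ≤ M := le_max_left _ _
  have hMk : (k : ℤ) + 3 ≤ M := le_max_right _ _
  have hre0 : ∀ i : ℤ, 0 ≤ i → i ≤ 1 → HasDerivAt (fun t => re c (w t) (Rk k) (i, 0)) 0 0 := by
    intro i hi hi'
    have := hasDerivAt_re hw0 hw hw' (c := fun t => c) (cc := 0) (xx := 0) le_rfl (by omega) hreg0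
        (i := i) (P := Rk k) ?_ ?_ ?_
    · refine this.congr_deriv ?_
      change e1 _ _ (goodDer 0 0 _) = _
      rw [goodDer_zero_zero, map_zero]
    · intro l
      simpa using hasDerivAt_const _ _
    · intro l _
      simp [hU]
    · intro l hl
      refine pd_shift_Rk_eq_zero k ?_
      rw [Finset.mem_Icc] at hl
      rw [lt_abs]; omega
  have hre1 : ∀ i : ℤ, 0 ≤ i → i ≤ 1 → HasDerivAt (fun t => re c (w t) (Rk k) (i, 1))
      (-(ν / μ) * e1 c x (shiftHom (i + 1) (evo R0 (Rk k)))) 0 := by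
    intro i hi hi'
    have := hasDerivAt_re hw0 hw hw' (c := fun t => c) (cc := 0)
        (xx := fun l => shiftHom l (C (-(ν / μ)) * R0)) (j := 1) (by omega) le_rfl hreg1
        (i := i) (P := Rk k) ?_ ?_ ?_
    · refine this.congr_deriv ?_
      change e1 _ _ (evo _ _) = _
      rw [evo_shiftHom, evo_C_mul, map_mul, hr1, map_mul, ← e1_shift c x 1, ← e1_shift c x 1]
      simp [← algebraMap_eq, shiftHom_shiftHom]
    · intro l
      simpa using hasDerivAt_const _ _
    · intro l _
      rw [hr1, ← e1_shift c x 1, shiftHom_shiftHom]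
      simp [hU]
    · intro l hl
      refine pd_shift_Rk_eq_zero k ?_
      rw [Finset.mem_Icc] at hl
      rw [lt_abs]; omega
  have hcor := fun p hp => hw p (corners_subset (i := 0) (j := 0) (by omega) (by omega) le_rfl
      (by omega) p hp)
  have hd := hasDerivAt_sqd (q := (0, 0)) hb hcor
    (V := fun t p => re c (w t) (Rk k) p)
    (V' := fun p => if p.2 = 0 then 0 else
      -(ν / μ) * e1 c x (shiftHom (p.1 + 1) (evo R0 (Rk k)))) (by
      intro p hp
      simp only [corners, Set.mem_insert_iff, Set.mem_singleton_iff, Prod.mk_add_mk,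
        add_zero, zero_add] at hp
      rcases hp with rfl | rfl | rfl | rfl
      · simpa using hre0 0 le_rfl (by omega)
      · simpa using hre0 1 (by omega) le_rfl
      · simpa using hre1 0 le_rfl (by omega)
      · simpa using hre1 1 (by omega) le_rfl)
  have k0 : ∀ i : ℤ, re c u (Rk k) (i, 0) = e1 c x (shiftHom i (Rk k)) := fun i => by
    simp only [re, hr0]
  have k1 : ∀ i : ℤ, re c u (Rk k) (i, 1) = e1 c x (shiftHom (i + 1) (Rk k)) := fun i => by
    simp only [re, hr1]
    rw [← e1_shift c x 1, shiftHom_shiftHom]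
  -- The linearized equation for `Rk k` holds along the whole curve. Its derivative at t = 0 is, up
  -- to nonzero factors, the commutator with `R0`.
  have hz := hd.unique ((hasDerivAt_const (0 : ℂ) (0 : ℂ)).congr_of_eventuallyEq ?_)
  · rw [hw0] at hz
    simp only [sqd, sqdd, aqd, aqdd, aqu, aqx, aqy, aqz, h0, Prod.mk_add_mk, add_zero, zero_add, k0, k1,
      hu0, hu1, hU0, hU1, hb'.1, hb'.2.1, hb'.2.2.1, hb'.2.2.2.2.1] at hz
    have n0 := hne 0
    rw [br, map_sub, map_sub, evo_R0]
    simp only [map_add, map_mul, shiftHom_shiftHom, e1_shift_rho c hx, e1_shift_rhom c hx]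
    have e0 : e1 c x (shiftHom 1 rho0) = bqpu c (x 1) (x 2) (x 0) / (x 2 - x 0) := by
      rw [e1_shift, e1_rho0]; norm_num
    rw [e0]
    simp only [show (1 : ℤ) + 1 = 2 from rfl, show (2 : ℤ) + 1 = 3 from rfl, one_ne_zero, if_true,
      if_false, Matrix.cons_val, zero_add, show (-1 : ℤ) + 1 = 0 from rfl, sub_self] at hz n0 ⊢
    generalize e1 c x (shiftHom 0 (Rk k)) = p0 at hz ⊢
    generalize e1 c x (shiftHom 1 (Rk k)) = p1 at hz ⊢
    generalize e1 c x (shiftHom 2 (Rk k)) = p2 at hz ⊢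
    generalize e1 c x (shiftHom 1 (evo R0 (Rk k))) = E at hz ⊢
    generalize e1 c x (shiftHom 2 (evo R0 (Rk k))) = E2 at hz ⊢
    simp only [bqp, bqpu, bq] at hz ⊢
    field_simp at hz ⊢
    refine mul_left_cancel₀ (mul_ne_zero hν hμ) ?_
    linear_combination hz
      - μ * (x 2 - x 0) * (x 1 * (p0 + p2) + p1 * (x 0 + x 2)) * hb'.2.2.2.1
  -- The hypothesis covers t ≠ 0 only. At t = 0 the linearized equation is μ(u - z)(X - Y) = 0,
  -- which holds because the characteristic in the upper row is the translate of that in the lower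
  -- one.
  · have F0 : sqd (b 0) (w 0) (re c (w 0) (Rk k)) (0, 0) = 0 := by
      rw [hw0]
      simp only [sqd, aqd, aqu, aqx, aqy, aqz, Prod.mk_add_mk, add_zero, zero_add, k0, k1, h0, hu0, hu1]
      simp
      ring
    have hy : ∀ᶠ t in 𝓝 (0 : ℂ), ∀ i ∈ Finset.Icc (-M) M, sqy (b t) (w t) (i, 0) ≠ 0 := by
      rw [eventually_all_finset]
      intro i hi
      rw [Finset.mem_Icc] at hi
      have hc := fun p hp => hw p (corners_subset (i := i) (j := 0) (by omega) (by omega) le_rfl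
        (by omega) p hp)
      have := (hasDerivAt_aqy hb (hc (i, 0) (by simp [corners]))
        (hc ((i, 0) + (1, 0)) (by simp [corners])) (hc ((i, 0) + (1, 1))
        (by simp [corners]))).continuousAt.eventually_ne (y := 0)
      refine this ?_
      have h2 := mul_ne_zero hμ (hne i)
      rw [mul_sub, sub_eq_add_neg] at h2
      simpa only [hw0, Prod.mk_add_mk, add_zero, zero_add, hu0, hu1, h0] using hf _ _ _ h2
    filter_upwards [hwQ, hy, eventually_nhdsWithin_iff.1 hP,
        eventually_reg_row hw0 hw hw' le_rfl (by omega) hreg0,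
        eventually_reg_row hw0 hw hw' (by omega) le_rfl hreg1] with t t1 t2 t3 t4 t5
    by_cases ht : t = 0
    · rw [ht]; exact F0
    · refine t3 ht _ t4 t5 fun i hi => ?_
      rw [abs_le] at hi
      exact ⟨t1 i 0 (by omega) (by omega) le_rfl (by omega),
        t2 i (Finset.mem_Icc.2 ⟨by omega, by omega⟩)⟩

/-! ### The coefficients of the ABS equations -/

/-- The coefficients of `Q4`. -/
def coefQ4 (a b α β g₂ g₃ : ℂ) : Fin 7 → ℂ :=
  ![a + b, -(a * β) - b * α,
    a * b * (a + b) / (2 * (α - β)) + a * β ^ 2 - (2 * α ^ 2 - g₂ / 4) * b,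
    a * β ^ 2 + b * α ^ 2,
    a * b * (a + b) / (2 * (β - α)) + b * α ^ 2 - (2 * β ^ 2 - g₂ / 4) * a,
    g₃ / 2 * (a + b) - g₂ / 4 * (-(a * β) - b * α),
    g₂ ^ 2 / 16 * (a + b) - g₃ * (-(a * β) - b * α)]

/-- The derivatives of the coefficients of `Q4` with respect to `α`. -/
def coefQ4' (a b α β g₂ g₃ : ℂ) : Fin 7 → ℂ :=
  let a' := (12 * α ^ 2 - g₂) / (2 * a)
  ![a', -(a' * β) - b,
    b * (2 * a * a' + a' * b) / (2 * (α - β)) - a * b * (a + b) / (2 * (α - β) ^ 2)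
      + a' * β ^ 2 - 4 * α * b,
    a' * β ^ 2 + b * (2 * α),
    b * (2 * a * a' + a' * b) / (2 * (β - α)) + a * b * (a + b) / (2 * (β - α) ^ 2)
      + b * (2 * α) - (2 * β ^ 2 - g₂ / 4) * a',
    g₃ / 2 * a' - g₂ / 4 * (-(a' * β) - b),
    g₂ ^ 2 / 16 * a' - g₃ * (-(a' * β) - b)]

/-- Rational parametrization of the pairs of points of an elliptic curve. -/
theorem weierstrass_param {a b α β g₂ g₃ : ℂ} (h1 : α - β ≠ 0)
    (ea : a ^ 2 = 4 * α ^ 3 - g₂ * α - g₃) (eb : b ^ 2 = 4 * β ^ 3 - g₂ * β - g₃) :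
    g₂ = 4 * (α ^ 2 + α * β + β ^ 2) - (a ^ 2 - b ^ 2) / (α - β) ∧
    g₃ = 4 * α ^ 3
      - (4 * (α ^ 2 + α * β + β ^ 2) - (a ^ 2 - b ^ 2) / (α - β)) * α - a ^ 2 := by
  have : g₂ = 4 * (α ^ 2 + α * β + β ^ 2) - (a ^ 2 - b ^ 2) / (α - β) := by
    field_simp
    linear_combination ea - eb
  refine ⟨this, ?_⟩
  rw [← this, ea]; ring

/-- Up to the factor 1/a the listed vector consists of the coefficients of f. Expressing g₂ and g₃
rationally by the two curve points removes the curve equations, and the claim becomes a rational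
identity in the free variables a, b, β and d = α - β. -/
theorem aDisc_coefQ4 {a b α β g₂ g₃ : ℂ} (h1 : α - β ≠ 0)
    (ea : a ^ 2 = 4 * α ^ 3 - g₂ * α - g₃) (eb : b ^ 2 = 4 * β ^ 3 - g₂ * β - g₃) (j : Fin 6) :
    aDisc (coefQ4 a b α β g₂ g₃) j = ![1, -α, α ^ 2, g₂ / 4 - α ^ 2, g₂ * α / 4 + g₃ / 2,
      g₂ ^ 2 / 16 + g₃ * α] j * aDisc (coefQ4 a b α β g₂ g₃) 0 := by
  obtain ⟨e1, e2⟩ := weierstrass_param h1 ea eb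
  rw [coefQ4, ← neg_sub α β, e2, e1]
  clear ea eb e1 e2
  have : α = β + (α - β) := by ring
  generalize α - β = d at *
  subst this
  fin_cases j <;> simp only [aDisc, Matrix.cons_val, Fin.reduceFinMk, Fin.zero_eta, Fin.mk_one,
    Fin.isValue] <;> field_simp <;> ring

-- This is the compatibility of `Q4` with κ = a · `aDisc` 0, r = -a/2 and an explicit multiplier;
-- the curve equations are eliminated as in `aDisc_coefQ4`.
set_option maxHeartbeats 2000000 in
theorem aTau_coefQ4 {a b α β g₂ g₃ : ℂ} (h1 : α - β ≠ 0)
    (ea : a ^ 2 = 4 * α ^ 3 - g₂ * α - g₃) (eb : b ^ 2 = 4 * β ^ 3 - g₂ * β - g₃) (ha : a ≠ 0)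
    (k : Fin 7) : a * aDisc (coefQ4 a b α β g₂ g₃) 0 * (-(1 / 2) * a * coefQ4' a b α β g₂ g₃ k)
      + aTau (coefQ4 a b α β g₂ g₃) k =
    (coefQ4 a b α β g₂ g₃ 1 * coefQ4 a b α β g₂ g₃ 5 - coefQ4 a b α β g₂ g₃ 2 * coefQ4 a b α β g₂ g₃ 3
      + aDisc (coefQ4 a b α β g₂ g₃) 0 * (a * b / (2 * (α - β)) - (3 * α ^ 2 - g₂ / 4)))
      * coefQ4 a b α β g₂ g₃ k := by
  obtain ⟨e1, e2⟩ := weierstrass_param h1 ea eb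
  rw [coefQ4, coefQ4', ← neg_sub α β, e2, e1]
  clear ea eb e1 e2
  have : α = β + (α - β) := by ring
  generalize α - β = d at *
  subst this
  fin_cases k <;> simp only [aDisc, aTau, Matrix.cons_val, Fin.reduceFinMk, Fin.zero_eta,
    Fin.mk_one, Fin.isValue] <;> field_simp <;> ring

/-- The coefficients of `Q`. -/
def ABS.coefA (e : ABS) (A B : ℂ → ℂ) (α β : ℂ) : Fin 7 → ℂ :=
  match e with
  | .H1 => ![0, 0, 1, 0, -1, 0, β - α]
  | .H2 => ![0, 0, 1, 0, -1, β - α, β ^ 2 - α ^ 2]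
  | .H3 δ => ![0, 0, α, 0, -β, 0, δ * (α ^ 2 - β ^ 2)]
  | .Q1 δ => ![0, 0, α, β - α, -β, 0, δ ^ 2 * α * β * (α - β)]
  | .Q2 => ![0, 0, α, β - α, -β, α * β * (α - β),
      α * β * (β - α) * (α ^ 2 - α * β + β ^ 2)]
  | .Q3 δ => ![0, 0, β * (α ^ 2 - 1), β ^ 2 - α ^ 2, α * (1 - β ^ 2), 0,
      -(δ ^ 2 * (α ^ 2 - β ^ 2) * (α ^ 2 - 1) * (β ^ 2 - 1)) / (4 * α * β)]
  | .Q4 g₂ g₃ => coefQ4 (A α) (B β) α β g₂ g₃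

theorem ABS.Q_eq (e : ABS) (A B : ℂ → ℂ) (u x y z α β : ℂ) :
    e.Q A B u x y z α β = aq (e.coefA A B α β) u x y z := by cases e <;> rfl

/-- The coefficients of `f`. -/
def ABS.coefC (e : ABS) (s : ℂ → ℂ) (c : ℂ) : Fin 6 → ℂ :=
  match e with
  | .H1 => ![0, 0, 0, 0, 0, 1]
  | .H2 => ![0, 0, 0, 0, 1, 2 * c]
  | .H3 δ => ![0, 0, 0, 1 / 2, 0, c * δ]
  | .Q1 δ => ![0, 0, 1 / c, -1 / c, 0, -c * δ ^ 2]
  | .Q2 => ![0, 0, 1 / c, -1 / c, -c, c ^ 3]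
  | .Q3 δ => ![0, 0, -c / (c ^ 2 - 1), (1 + c ^ 2) / (2 * (c ^ 2 - 1)), 0,
      -(c ^ 2 - 1) * δ ^ 2 / (4 * c)]
  | .Q4 g₂ g₃ => ![1 / s c, -c / s c, c ^ 2 / s c, (g₂ / 4 - c ^ 2) / s c,
      (g₂ * c / 4 + g₃ / 2) / s c, (g₂ ^ 2 / 16 + g₃ * c) / s c]

theorem ABS.f_eq (e : ABS) {s : ℂ → ℂ} {c : ℂ} (h : e.Admissible s c) (u x : ℂ) :
    e.f s u x c = bq (e.coefC s c) u x := by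
  cases e with
  | H1 => simp [ABS.f, coefC, bq]
  | H2 => simp [ABS.f, coefC, bq]; ring
  | H3 δ => simp [ABS.f, coefC, bq]
  | Q1 δ =>
    have : c ≠ 0 := h
    simp [ABS.f, coefC, bq]; field_simp; ring
  | Q2 =>
    have : c ≠ 0 := h
    simp [ABS.f, coefC, bq]; field_simp; ring
  | Q3 δ =>
    have h1 : c ≠ 0 := h.1
    have h2 : c ^ 2 - 1 ≠ 0 := sub_ne_zero.2 h.2
    simp [ABS.f, coefC, bq]; field_simp; ring
  | Q4 g₂ g₃ =>
    have : s c ≠ 0 := h.1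
    simp [ABS.f, coefC, bq]; field_simp; ring

theorem ABS.Admissible.eventually {e : ABS} {s : ℂ → ℂ} {c : ℂ} (h : e.Admissible s c) :
    ∀ᶠ x in 𝓝 c, e.Admissible s x := by
  cases e with
  | H1 => exact Eventually.of_forall fun _ => trivial
  | H2 => exact Eventually.of_forall fun _ => trivial
  | H3 δ => exact Eventually.of_forall fun _ => trivial
  | Q1 δ => exact eventually_ne_nhds h
  | Q2 => exact eventually_ne_nhds h
  | Q3 δ =>
    have : ContinuousAt (fun x : ℂ => x ^ 2) c := by fun_prop
    exact (eventually_ne_nhds h.1).and (this.eventually_ne h.2)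
  | Q4 g₂ g₃ =>
    filter_upwards [h.2.self_of_nhds.1.continuousAt.eventually_ne h.1, eventually_eventually_nhds.2 h.2]
      with x h1 h2 using ⟨h1, h2⟩

/-- The derivative of a branch of `√(4x³ - g₂x - g₃)`. -/
theorem hasDerivAt_branch {s : ℂ → ℂ} {c g₂ g₃ : ℂ} (h0 : s c ≠ 0)
    (h : ∀ᶠ x in 𝓝 c, DifferentiableAt ℂ s x ∧ s x ^ 2 = 4 * x ^ 3 - g₂ * x - g₃) :
    HasDerivAt s ((12 * c ^ 2 - g₂) / (2 * s c)) c := by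
  have h1 := h.self_of_nhds.1.hasDerivAt
  have h2 : HasDerivAt (fun x => s x ^ 2) (12 * c ^ 2 - g₂) c := by
    have h3 : HasDerivAt (fun x : ℂ => 4 * x ^ 3 - g₂ * x - g₃) (12 * c ^ 2 - g₂) c := by
      refine ((((hasDerivAt_pow 3 c).const_mul 4).sub
        ((hasDerivAt_id' c).const_mul g₂)).sub_const g₃).congr_deriv ?_
      push_cast; ring
    exact h3.congr_of_eventuallyEq (h.mono fun x hx => hx.2)
  have h4 := (h1.pow 2).unique h2
  refine h1.congr_deriv ?_
  rw [eq_div_iff (mul_ne_zero two_ne_zero h0), ← h4]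
  push_cast; ring

/-- In coefficients this is r ∂_α f = (f_u f_x - f f_{ux})/2. It allows the parameter part of V to
be represented by a derivation polynomial in the coefficients of f. For `Q4` the constant g₃ is
eliminated by means of the curve equation. -/
theorem ABS.hasDerivAt_coefC {e : ABS} {s : ℂ → ℂ} {c : ℂ} (h : e.Admissible s c) (j : Fin 6) :
    ∃ c', HasDerivAt (fun t => e.coefC s t j) c' c ∧ e.r s c * c' = bqDelta (e.coefC s c) j := by
  have hid := hasDerivAt_id' c
  cases e with
  | H1 =>
    refine ⟨0, hasDerivAt_const _ _, ?_⟩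
    fin_cases j <;> simp [bqDelta, coefC]
  | H2 =>
    fin_cases j
    · exact ⟨0, hasDerivAt_const _ _, by simp [bqDelta, coefC]⟩
    · exact ⟨0, hasDerivAt_const _ _, by simp [bqDelta, coefC]⟩
    · exact ⟨0, hasDerivAt_const _ _, by simp [bqDelta, coefC]⟩
    · exact ⟨0, hasDerivAt_const _ _, by simp [bqDelta, coefC]⟩
    · exact ⟨0, hasDerivAt_const _ _, by simp [bqDelta, coefC]⟩
    · exact ⟨_, hid.const_mul 2, by simp [bqDelta, coefC, ABS.r]⟩
  | H3 δ =>
    fin_cases j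
    · exact ⟨0, hasDerivAt_const _ _, by simp [bqDelta, coefC]⟩
    · exact ⟨0, hasDerivAt_const _ _, by simp [bqDelta, coefC]⟩
    · exact ⟨0, hasDerivAt_const _ _, by simp [bqDelta, coefC]⟩
    · exact ⟨0, hasDerivAt_const _ _, by simp [bqDelta, coefC]⟩
    · exact ⟨0, hasDerivAt_const _ _, by simp [bqDelta, coefC]⟩
    · exact ⟨_, hid.mul_const δ, by simp [bqDelta, coefC, ABS.r]; ring⟩
  | Q1 δ =>
    have h0 : c ≠ 0 := h
    have hi := (hasDerivAt_const c (1 : ℂ)).div hid h0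
    have hi' := (hasDerivAt_const c (-1 : ℂ)).div hid h0
    fin_cases j
    · exact ⟨0, hasDerivAt_const _ _, by simp [bqDelta, coefC]⟩
    · exact ⟨0, hasDerivAt_const _ _, by simp [bqDelta, coefC]⟩
    · exact ⟨_, hi, by simp [bqDelta, coefC, ABS.r]; field_simp⟩
    · exact ⟨_, hi', by simp [bqDelta, coefC, ABS.r]⟩
    · exact ⟨0, hasDerivAt_const _ _, by simp [bqDelta, coefC]⟩
    · exact ⟨_, hid.neg.mul_const (δ ^ 2), by simp [bqDelta, coefC, ABS.r]; field_simp⟩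
  | Q2 =>
    have h0 : c ≠ 0 := h
    have hi := (hasDerivAt_const c (1 : ℂ)).div hid h0
    have hi' := (hasDerivAt_const c (-1 : ℂ)).div hid h0
    fin_cases j
    · exact ⟨0, hasDerivAt_const _ _, by simp [bqDelta, coefC]⟩
    · exact ⟨0, hasDerivAt_const _ _, by simp [bqDelta, coefC]⟩
    · exact ⟨_, hi, by simp [bqDelta, coefC, ABS.r]; field_simp⟩
    · exact ⟨_, hi', by simp [bqDelta, coefC, ABS.r]⟩
    · exact ⟨_, hid.neg, by simp [bqDelta, coefC, ABS.r]; field_simp⟩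
    · exact ⟨_, hasDerivAt_pow 3 c, by simp [bqDelta, coefC, ABS.r]; field_simp; ring⟩
  | Q3 δ =>
    have h0 : c ≠ 0 := h.1
    have h1 : c ^ 2 - 1 ≠ 0 := sub_ne_zero.2 h.2
    have hp := (hasDerivAt_pow 2 c).sub_const 1
    fin_cases j
    · exact ⟨0, hasDerivAt_const _ _, by simp [bqDelta, coefC]⟩
    · exact ⟨0, hasDerivAt_const _ _, by simp [bqDelta, coefC]⟩
    · exact ⟨_, hid.neg.div hp h1, by simp [bqDelta, coefC, ABS.r]; field_simp; ring⟩
    · exact ⟨_, ((hasDerivAt_pow 2 c).const_add 1).div (hp.const_mul 2) (mul_ne_zero two_ne_zero h1),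
        by simp [bqDelta, coefC, ABS.r]; field_simp; ring⟩
    · exact ⟨0, hasDerivAt_const _ _, by simp [bqDelta, coefC]⟩
    · exact ⟨_, (hp.neg.mul_const (δ ^ 2)).div (hid.const_mul 4) (mul_ne_zero (by norm_num) h0),
        by simp [bqDelta, coefC, ABS.r]; field_simp; ring⟩
  | Q4 g₂ g₃ =>
    have h0 : s c ≠ 0 := h.1
    have hs := hasDerivAt_branch h.1 h.2
    have hp := hasDerivAt_pow 2 c
    have h3 : g₃ = 4 * c ^ 3 - g₂ * c - s c ^ 2 := by rw [h.2.self_of_nhds.2]; ring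
    fin_cases j
    · exact ⟨_, (hasDerivAt_const c 1).div hs h0,
        by simp [bqDelta, coefC, ABS.r]; field_simp; ring⟩
    · exact ⟨_, hid.neg.div hs h0, by simp [bqDelta, coefC, ABS.r]; field_simp; simp only [h3]; ring⟩
    · exact ⟨_, hp.div hs h0, by simp [bqDelta, coefC, ABS.r]; field_simp; simp only [h3]; ring⟩
    · exact ⟨_, (hp.const_sub (g₂ / 4)).div hs h0,
        by simp [bqDelta, coefC, ABS.r]; field_simp; simp only [h3]; ring⟩
    · exact ⟨_, (((hid.const_mul g₂).div_const 4).add_const (g₃ / 2)).div hs h0,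
        by simp [bqDelta, coefC, ABS.r]; field_simp; simp only [h3]; ring⟩
    · exact ⟨_, ((hid.const_mul g₃).const_add (g₂ ^ 2 / 16)).div hs h0,
        by simp [bqDelta, coefC, ABS.r]; field_simp; simp only [h3]; ring⟩

/-- The derivatives of the coefficients of `Q` with respect to `α`. -/
def ABS.coefA' (e : ABS) (A B : ℂ → ℂ) (α β : ℂ) : Fin 7 → ℂ :=
  match e with
  | .H1 => ![0, 0, 0, 0, 0, 0, -1]
  | .H2 => ![0, 0, 0, 0, 0, -1, -2 * α]
  | .H3 δ => ![0, 0, 1, 0, 0, 0, δ * (2 * α)]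
  | .Q1 δ => ![0, 0, 1, -1, 0, 0, δ ^ 2 * β * (2 * α - β)]
  | .Q2 => ![0, 0, 1, -1, 0, β * (2 * α - β),
      β * (-4 * α ^ 3 + 6 * α ^ 2 * β - 4 * α * β ^ 2 + β ^ 3)]
  | .Q3 δ => ![0, 0, β * (2 * α), -2 * α, 1 - β ^ 2, 0,
      -(δ ^ 2 * (β ^ 2 - 1)) / (4 * β) * (3 * α ^ 2 - (β ^ 2 + 1) - β ^ 2 / α ^ 2)]
  | .Q4 g₂ g₃ => coefQ4' (A α) (B β) α β g₂ g₃

theorem ABS.hasDerivAt_coefA {e : ABS} {A B : ℂ → ℂ} {α β : ℂ} (hα : e.Admissible A α)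
    (hβ : e.Admissible B β) (hαβ : α ≠ β) (k : Fin 7) :
    HasDerivAt (fun t => e.coefA A B t β k) (e.coefA' A B α β k) α := by
  have hid := hasDerivAt_id' α
  have hp := hasDerivAt_pow 2 α
  cases e with
  | H1 =>
    fin_cases k
    iterate 6 exact hasDerivAt_const _ _
    exact hid.const_sub β
  | H2 =>
    fin_cases k
    iterate 5 exact hasDerivAt_const _ _
    · exact hid.const_sub β
    · exact (hp.const_sub (β ^ 2)).congr_deriv (by simp [coefA'])
  | H3 δ =>
    fin_cases k
    · exact hasDerivAt_const _ _
    · exact hasDerivAt_const _ _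
    · exact hid
    · exact hasDerivAt_const _ _
    · exact hasDerivAt_const _ _
    · exact hasDerivAt_const _ _
    · exact ((hp.sub_const (β ^ 2)).const_mul δ).congr_deriv (by simp [coefA'])
  | Q1 δ =>
    fin_cases k
    · exact hasDerivAt_const _ _
    · exact hasDerivAt_const _ _
    · exact hid
    · exact hid.const_sub β
    · exact hasDerivAt_const _ _
    · exact hasDerivAt_const _ _
    · exact (((hid.const_mul (δ ^ 2)).mul_const β).mul (hid.sub_const β)).congr_deriv
        (by simp [coefA']; ring)
  | Q2 =>
    fin_cases k
    · exact hasDerivAt_const _ _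
    · exact hasDerivAt_const _ _
    · exact hid
    · exact hid.const_sub β
    · exact hasDerivAt_const _ _
    · exact ((hid.mul_const β).mul (hid.sub_const β)).congr_deriv (by simp [coefA']; ring)
    · exact (((hid.mul_const β).mul (hid.const_sub β)).mul ((hp.sub (hid.mul_const β)).add_const
        (β ^ 2))).congr_deriv (by simp [coefA']; ring)
  | Q3 δ =>
    have h0 : α ≠ 0 := hα.1
    have h1 : β ≠ 0 := hβ.1
    fin_cases k
    · exact hasDerivAt_const _ _
    · exact hasDerivAt_const _ _
    · exact ((hp.sub_const 1).const_mul β).congr_deriv (by simp [coefA'])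
    · exact (hp.const_sub (β ^ 2)).congr_deriv (by simp [coefA'])
    · exact (hid.mul_const (1 - β ^ 2)).congr_deriv (by simp [coefA'])
    · exact hasDerivAt_const _ _
    · refine (((((hp.sub_const (β ^ 2)).const_mul (δ ^ 2)).mul (hp.sub_const 1)).mul_const
        (β ^ 2 - 1)).neg.div ((hid.const_mul 4).mul_const β) ?_).congr_deriv ?_
      · exact mul_ne_zero (mul_ne_zero (by norm_num) h0) h1
      · simp [coefA']; field_simp; ring
  | Q4 g₂ g₃ =>
    have h0 : A α ≠ 0 := hα.1
    have h1 : α - β ≠ 0 := sub_ne_zero.2 hαβ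
    have h2 : β - α ≠ 0 := sub_ne_zero.2 hαβ.symm
    have hA := hasDerivAt_branch hα.1 hα.2
    have h5 := (hA.mul_const β).neg.sub (hid.const_mul (B β))
    fin_cases k
    · exact hA.add_const _
    · exact h5.congr_deriv (by simp [coefA', coefQ4'])
    · refine (((((hA.mul_const (B β)).mul (hA.add_const (B β))).div
        ((hid.sub_const β).const_mul 2) (mul_ne_zero two_ne_zero h1)).add
        (hA.mul_const (β ^ 2))).sub
        (((hp.const_mul 2).sub_const (g₂ / 4)).mul_const (B β))).congr_deriv ?_
      simp [coefA', coefQ4']; field_simp; ring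
    · exact ((hA.mul_const (β ^ 2)).add (hp.const_mul (B β))).congr_deriv (by simp [coefA', coefQ4'])
    · refine (((((hA.mul_const (B β)).mul (hA.add_const (B β))).div
        ((hid.const_sub β).const_mul 2) (mul_ne_zero two_ne_zero h2)).add
        (hp.const_mul (B β))).sub
        (hA.const_mul (2 * β ^ 2 - g₂ / 4))).congr_deriv ?_
      simp [coefA', coefQ4']; field_simp; ring
    · exact (((hA.add_const (B β)).const_mul (g₃ / 2)).sub (h5.const_mul (g₂ / 4))).congr_deriv
        (by simp [coefA', coefQ4'])
    · exact (((hA.add_const (B β)).const_mul (g₂ ^ 2 / 16)).sub (h5.const_mul g₃)).congr_deriv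
        (by simp [coefA', coefQ4'])

/-- The proportionality factor between `aDisc` of the coefficients of `Q` and the coefficients
of `f`. -/
def ABS.kappa (e : ABS) (A B : ℂ → ℂ) (α β : ℂ) : ℂ :=
  match e with
  | .H1 => α - β
  | .H2 => α - β
  | .H3 _ => β ^ 2 - α ^ 2
  | .Q1 _ => α * β * (α - β)
  | .Q2 => α * β * (α - β)
  | .Q3 _ => (β ^ 2 - α ^ 2) * (α ^ 2 - 1) * (β ^ 2 - 1)
  | .Q4 g₂ g₃ => A α * aDisc (ABS.coefA (.Q4 g₂ g₃) A B α β) 0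

theorem ABS.aDisc_coefA {e : ABS} {A B : ℂ → ℂ} {α β : ℂ} (hα : e.Admissible A α)
    (hβ : e.Admissible B β) (hαβ : α ≠ β) (j : Fin 6) :
    aDisc (e.coefA A B α β) j = e.kappa A B α β * e.coefC A α j := by
  cases e with
  | H1 => fin_cases j <;> simp [aDisc, coefA, kappa, coefC]
  | H2 => fin_cases j <;> simp [aDisc, coefA, kappa, coefC] <;> ring
  | H3 δ => fin_cases j <;> simp [aDisc, coefA, kappa, coefC] <;> ring
  | Q1 δ =>
    have h0 : α ≠ 0 := hα
    fin_cases j <;> simp [aDisc, coefA, kappa, coefC] <;> field_simp <;> ring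
  | Q2 =>
    have h0 : α ≠ 0 := hα
    fin_cases j <;> simp [aDisc, coefA, kappa, coefC] <;> field_simp <;> ring
  | Q3 δ =>
    have h0 : α ≠ 0 := hα.1
    have h1 : β ≠ 0 := hβ.1
    have h2 : α ^ 2 - 1 ≠ 0 := sub_ne_zero.2 hα.2
    fin_cases j <;> simp [aDisc, coefA, kappa, coefC] <;> field_simp <;> ring
  | Q4 g₂ g₃ =>
    have h0 : A α ≠ 0 := hα.1
    have h1 : α - β ≠ 0 := sub_ne_zero.2 hαβ
    have ea := hα.2.self_of_nhds.2
    have eb := hβ.2.self_of_nhds.2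
    rw [coefA, aDisc_coefQ4 h1 ea eb, kappa, coefA, coefC]
    fin_cases j <;> simp <;> field_simp

/-- The hypothesis on `aDisc` excludes κ = 0, which happens for instance at β = -α for `H3` and
`Q3`. It remains to exhibit the multiplier in the relation between ∂_α Q, τ and Q. -/
theorem ABS.compatible_coefA {e : ABS} {A B : ℂ → ℂ} {α β : ℂ} (hα : e.Admissible A α)
    (hβ : e.Admissible B β) (hαβ : α ≠ β) (hd : aDisc (e.coefA A B α β) ≠ 0) :
    Compatible (e.coefA A B α β) (e.coefA' A B α β) (e.coefC A α) (e.r A α) := by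
  have hκ : e.kappa A B α β ≠ 0 := by
    intro h
    exact hd (funext fun j => by rw [aDisc_coefA hα hβ hαβ, h, zero_mul]; rfl)
  suffices h : ∃ lam, ∀ k, e.kappa A B α β * (e.r A α * e.coefA' A B α β k)
      + aTau (e.coefA A B α β) k = lam * e.coefA A B α β k by
    obtain ⟨lam, h⟩ := h
    exact ⟨_, lam, hκ, aDisc_coefA hα hβ hαβ, h⟩
  cases e with
  | H1 => exact ⟨0, fun k => by fin_cases k <;> simp [aTau, coefA, coefA', kappa, ABS.r]⟩
  | H2 =>
    exact ⟨0, fun k => by fin_cases k <;> simp [aTau, coefA, coefA', kappa, ABS.r]; ring⟩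
  | H3 δ =>
    exact ⟨0, fun k => by fin_cases k <;> simp [aTau, coefA, coefA', kappa, ABS.r] <;> ring⟩
  | Q1 δ =>
    -- In the cases `Q1`, `Q2` and `Q3` the multiplier is forced by the coefficient of ux + yz.
    exact ⟨-(α - β) ^ 2, fun k => by
      fin_cases k <;> simp [aTau, coefA, coefA', kappa, ABS.r] <;> first | ring1 | (left; ring1)⟩
  | Q2 =>
    exact ⟨-(α - β) ^ 2, fun k => by
      fin_cases k <;> simp [aTau, coefA, coefA', kappa, ABS.r] <;> first | ring1 | (left; ring1)⟩
  | Q3 δ =>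
    have h0 : α ≠ 0 := hα.1
    have h1 : β ≠ 0 := hβ.1
    refine ⟨α ^ 2 * (α ^ 2 - 1) * (β ^ 2 - 1) - ((β * (α ^ 2 - 1)) ^ 2 + (β ^ 2 - α ^ 2) ^ 2
      + (α * (1 - β ^ 2)) ^ 2) / 2, fun k => ?_⟩
    fin_cases k <;> simp [aTau, coefA, coefA', kappa, ABS.r] <;> field_simp <;> ring
  | Q4 g₂ g₃ =>
    exact ⟨_, aTau_coefQ4 (sub_ne_zero.2 hαβ) hα.2.self_of_nhds.2 hβ.2.self_of_nhds.2 hα.1⟩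

/-! ### The commuting hierarchies of the ABS equations -/

/-- The values of the first parameter at which the equation is nondegenerate. -/
def ABS.dom (e : ABS) (A B : ℂ → ℂ) (β : ℂ) : Set ℂ :=
  {t | e.Admissible A t ∧ t ≠ β ∧ aDisc (e.coefA A B t β) ≠ 0}

theorem continuous_aDisc : Continuous aDisc := by
  refine continuous_pi fun j => ?_
  fin_cases j <;> simp [aDisc] <;> fun_prop

theorem ABS.family {e : ABS} {A B : ℂ → ℂ} {β : ℂ} (hβ : e.Admissible B β) :
    Family (e.dom A B β) (fun t => e.coefA A B t β) (e.coefC A) (e.r A) where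
  isOpen := by
    refine isOpen_iff_mem_nhds.2 fun t ht => ?_
    have hc : ContinuousAt (fun t => aDisc (e.coefA A B t β)) t :=
      continuous_aDisc.continuousAt.comp (continuousAt_pi.2 fun k =>
        (hasDerivAt_coefA ht.1 hβ ht.2.1 k).continuousAt)
    filter_upwards [ht.1.eventually, eventually_ne_nhds ht.2.1, hc.eventually_ne ht.2.2]
      with s h1 h2 h3 using ⟨h1, h2, h3⟩
  deriv_c s hs j := hasDerivAt_coefC hs.1 j
  deriv_a s hs := ⟨_, fun k => hasDerivAt_coefA hs.1 hβ hs.2.1 k,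
    compatible_coefA hs.1 hβ hs.2.1 hs.2.2⟩

/-- Rescaling Q changes neither its solutions nor their tangents. This makes it possible to remove
the pole of the coefficients of `Q4` at β = α before passing to the limit. -/
theorem StripSymmetry.of_smul {a : Fin 7 → ℂ} {c : Fin 6 → ℂ} {P : L1} {N : ℤ} {σ : ℂ} (hσ : σ ≠ 0)
    (h : StripSymmetry a c P N) : StripSymmetry (fun k => σ * a k) c P N := by
  intro u h0 h1 hu
  rw [sqd_smul_left, h u h0 h1 fun i hi => ?_, mul_zero]
  obtain ⟨h2, h3⟩ := hu i hi
  rw [sqv_smul] at h2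
  refine ⟨(mul_eq_zero.1 h2).resolve_left hσ, fun h4 => h3 ?_⟩
  have : sqy (fun k => σ * a k) u (i, 0) = σ * sqy a u (i, 0) := by
    simp only [sqy, aqy]; ring
  rw [this, h4, mul_zero]

/-- Nondegeneracy of the strips which are close to a row and its translate. -/
theorem eventually_aDisc_ne {b : ℂ → Fin 7 → ℂ} {b' : Fin 7 → ℂ} {c : Fin 6 → ℂ} {μ ν : ℂ}
    (hb : ∀ k, HasDerivAt (fun t => b t k) (b' k) 0) (hμ : μ ≠ 0) (hν : ν ≠ 0)
    (h0 : b 0 = ![0, 0, μ, 0, -μ, 0, 0])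
    (hb' : b' 0 = ν * c 0 ∧ b' 1 = ν * c 1 ∧ b' 3 = ν * c 2 ∧ b' 2 + b' 4 = ν * c 3 ∧
      b' 5 = ν * c 4 ∧ b' 6 = ν * c 5) (hc : c ≠ 0) :
    ∀ᶠ t in 𝓝[≠] 0, aDisc (b t) ≠ 0 := by
  obtain ⟨j, hj⟩ := Function.ne_iff.1 hc
  -- `aDisc (b t)` vanishes at t = 0, but its derivative there is -μν c, so some component is
  -- nonzero for small t ≠ 0.
  have hd : HasDerivAt (fun t => aDisc (b t) j) (-μ * ν * c j) 0 := by
    fin_cases j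
    · refine (((hb 1).pow 2).sub ((hb 0).mul (hb 2))).congr_deriv ?_
      simp [h0]; linear_combination μ * hb'.1
    · refine (((((hb 1).mul ((hb 3).add (hb 4))).sub ((hb 1).mul (hb 2))).sub
        ((hb 0).mul (hb 5))).div_const 2).congr_deriv ?_
      simp [h0]; linear_combination -μ * hb'.2.1
    · refine (((hb 3).mul (hb 4)).sub ((hb 1).mul (hb 5))).congr_deriv ?_
      simp [h0]; linear_combination μ * hb'.2.2.1
    · refine ((((((hb 3).pow 2).add ((hb 4).pow 2)).sub ((hb 2).pow 2)).sub
        ((hb 0).mul (hb 6))).div_const 2).congr_deriv ?_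
      simp [h0]; linear_combination -μ * hb'.2.2.2.1
    · refine (((((hb 5).mul ((hb 3).add (hb 4))).sub ((hb 5).mul (hb 2))).sub
        ((hb 6).mul (hb 1))).div_const 2).congr_deriv ?_
      simp [h0]; linear_combination -μ * hb'.2.2.2.2.1
    · refine (((hb 5).pow 2).sub ((hb 2).mul (hb 6))).congr_deriv ?_
      simp [h0]; linear_combination μ * hb'.2.2.2.2.2
  have := hd.eventually_ne (c := 0) (mul_ne_zero (mul_ne_zero (neg_ne_zero.2 hμ) hν) hj)
  exact this.mono fun t ht h => ht (by rw [h]; rfl)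

theorem ABS.coefC_ne_zero {e : ABS} {s : ℂ → ℂ} {c : ℂ} (h : e.Admissible s c) :
    e.coefC s c ≠ 0 := by
  rw [Function.ne_iff]
  cases e with
  | H1 => exact ⟨5, by simp [coefC]⟩
  | H2 => exact ⟨4, by simp [coefC]⟩
  | H3 δ => exact ⟨3, by simp [coefC]⟩
  | Q1 δ => exact ⟨2, by simpa [coefC] using! (h : c ≠ 0)⟩
  | Q2 => exact ⟨2, by simpa [coefC] using! (h : c ≠ 0)⟩
  | Q3 δ =>
    have h0 : c ≠ 0 := h.1
    have h1 : c ^ 2 - 1 ≠ 0 := sub_ne_zero.2 h.2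
    exact ⟨2, div_ne_zero (neg_ne_zero.2 h0) h1⟩
  | Q4 g₂ g₃ => exact ⟨0, by simpa [coefC] using h.1⟩

/-- The strips between a row and its translate, up to a factor. -/
theorem ABS.exists_limit {e : ABS} {A : ℂ → ℂ} {α : ℂ} (h : e.Admissible A α)
    (hr : e.r A α ≠ 0) : ∃ (σ : ℂ → ℂ) (b : ℂ → Fin 7 → ℂ) (b' : Fin 7 → ℂ) (μ ν : ℂ),
      (∀ k, HasDerivAt (fun t => b t k) (b' k) 0) ∧ μ ≠ 0 ∧ ν ≠ 0 ∧
      b 0 = ![0, 0, μ, 0, -μ, 0, 0] ∧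
      (b' 0 = ν * e.coefC A α 0 ∧ b' 1 = ν * e.coefC A α 1 ∧ b' 3 = ν * e.coefC A α 2 ∧
        b' 2 + b' 4 = ν * e.coefC A α 3 ∧ b' 5 = ν * e.coefC A α 4 ∧ b' 6 = ν * e.coefC A α 5) ∧
      ∀ t ≠ 0, σ t ≠ 0 ∧ b t = fun k => σ t * e.coefA A A α (α + t) k := by
  have hid := (hasDerivAt_id' (0 : ℂ)).const_add α
  have hp := hid.pow 2
  cases e with
  | H1 =>
    refine ⟨fun _ => 1, fun t => coefA .H1 A A α (α + t), ![0, 0, 0, 0, 0, 0, 1], 1, 1, ?_,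
      one_ne_zero, one_ne_zero, by simp [coefA], by simp [coefC], by simp⟩
    intro k
    fin_cases k
    iterate 6 exact hasDerivAt_const _ _
    exact hid.sub_const _
  | H2 =>
    refine ⟨fun _ => 1, fun t => coefA .H2 A A α (α + t), ![0, 0, 0, 0, 0, 1, 2 * α], 1, 1, ?_,
      one_ne_zero, one_ne_zero, by simp [coefA], by simp [coefC], by simp⟩
    intro k
    fin_cases k
    iterate 5 exact hasDerivAt_const _ _
    · exact hid.sub_const _
    · exact (hp.sub_const _).congr_deriv (by simp)
  | H3 δ =>
    refine ⟨fun _ => 1, fun t => coefA (.H3 δ) A A α (α + t), ![0, 0, 0, 0, -1, 0, -2 * δ * α], α,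
      -2, ?_, ?_, by norm_num, by simp [coefA], by simp [coefC]; ring, by simp⟩
    · intro k
      fin_cases k
      iterate 4 exact hasDerivAt_const _ _
      · exact hid.neg
      · exact hasDerivAt_const _ _
      · exact ((hp.const_sub _).const_mul δ).congr_deriv (by simp; ring)
    -- For `H3` one has μ = α; this is the only place where r ≠ 0 is needed.
    · rintro rfl; simp [ABS.r] at hr
  | Q1 δ =>
    have h0 : α ≠ 0 := h
    refine ⟨fun _ => 1, fun t => coefA (.Q1 δ) A A α (α + t),
      ![0, 0, 0, 1, -1, 0, -δ ^ 2 * α ^ 2], α, α, ?_, h0, h0, by simp [coefA],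
      by simp [coefC]; field_simp; simp, by simp⟩
    intro k
    fin_cases k
    iterate 3 exact hasDerivAt_const _ _
    · exact hid.sub_const _
    · exact hid.neg
    · exact hasDerivAt_const _ _
    · exact ((hid.const_mul _).mul (hid.const_sub _)).congr_deriv (by simp; ring)
  | Q2 =>
    have h0 : α ≠ 0 := h
    refine ⟨fun _ => 1, fun t => coefA .Q2 A A α (α + t),
      ![0, 0, 0, 1, -1, -α ^ 2, α ^ 4], α, α, ?_, h0, h0, by simp [coefA],
      by simp [coefC]; field_simp; simp, by simp⟩
    intro k
    fin_cases k
    iterate 3 exact hasDerivAt_const _ _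
    · exact hid.sub_const _
    · exact hid.neg
    · exact ((hid.const_mul _).mul (hid.const_sub _)).congr_deriv (by simp; ring)
    · exact (((hid.const_mul _).mul (hid.sub_const _)).mul ((hid.const_mul _).const_sub _ |>.add hp)
        ).congr_deriv (by simp; ring)
  | Q3 δ =>
    have h0 : α ≠ 0 := h.1
    have h1 : α ^ 2 - 1 ≠ 0 := sub_ne_zero.2 h.2
    refine ⟨fun _ => 1, fun t => coefA (.Q3 δ) A A α (α + t),
      ![0, 0, α ^ 2 - 1, 2 * α, -2 * α ^ 2, 0, δ ^ 2 * (α ^ 2 - 1) ^ 2 / (2 * α)],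
      α * (α ^ 2 - 1), -2 * (α ^ 2 - 1), ?_, mul_ne_zero h0 h1, mul_ne_zero (by norm_num) h1,
      ?_, ?_, by simp⟩
    · intro k
      fin_cases k
      · exact hasDerivAt_const _ _
      · exact hasDerivAt_const _ _
      · exact (hid.mul_const _).congr_deriv (by simp)
      · exact (hp.sub_const _).congr_deriv (by simp)
      · exact ((hp.const_sub _).const_mul _).congr_deriv (by simp; ring)
      · exact hasDerivAt_const _ _
      · refine (((((hp.const_sub _).const_mul _).mul_const _).mul (hp.sub_const _)).neg.div
          (hid.const_mul _) (by simpa using h0)).congr_deriv ?_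
        simp; field_simp; ring
    · simp [coefA]; ring
    · simp [coefC]
      refine ⟨by field_simp, by field_simp; ring, by field_simp; ring⟩
  | Q4 g₂ g₃ =>
    have h0 : A α ≠ 0 := h.1
    have hA' : HasDerivAt A ((12 * α ^ 2 - g₂) / (2 * A α)) (α + 0) := by
      simpa using hasDerivAt_branch h.1 h.2
    have hA := hA'.comp 0 hid
    have ht := hasDerivAt_neg (0 : ℂ)
    -- Multiplication by α - β = -t cancels the poles of the coefficients a₃ and a₅. With the same
    -- branch at α and α + t these tend to ±A(α)³, and all other coefficients tend to 0.
    refine ⟨fun t => -t, fun t => ![-t * (A α + A (α + t)),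
      -t * (-(A α * (α + t)) - A (α + t) * α),
      A α * A (α + t) * (A α + A (α + t)) / 2 +
        -t * (A α * (α + t) ^ 2 - (2 * α ^ 2 - g₂ / 4) * A (α + t)),
      -t * (A α * (α + t) ^ 2 + A (α + t) * α ^ 2),
      -(A α * A (α + t) * (A α + A (α + t)) / 2) +
        -t * (A (α + t) * α ^ 2 - (2 * (α + t) ^ 2 - g₂ / 4) * A α),
      -t * (g₃ / 2 * (A α + A (α + t)) - g₂ / 4 * (-(A α * (α + t)) - A (α + t) * α)),
      -t * (g₂ ^ 2 / 16 * (A α + A (α + t)) - g₃ * (-(A α * (α + t)) - A (α + t) * α))],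
      ![-2 * A α, 2 * A α * α,
        (A α ^ 2 + 2 * A α * A α) * ((12 * α ^ 2 - g₂) / (2 * A α)) / 2
          - (A α * α ^ 2 - (2 * α ^ 2 - g₂ / 4) * A α),
        -2 * A α * α ^ 2,
        -((A α ^ 2 + 2 * A α * A α) * ((12 * α ^ 2 - g₂) / (2 * A α)) / 2)
          - (A α * α ^ 2 - (2 * α ^ 2 - g₂ / 4) * A α),
        -(g₃ * A α) - g₂ / 2 * A α * α,
        -(g₂ ^ 2 / 8 * A α) - 2 * g₃ * A α * α],
      A α ^ 3, -2 * A α ^ 2, ?_, pow_ne_zero 3 h0, mul_ne_zero (by norm_num) (pow_ne_zero 2 h0),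
      ?_, ?_, ?_⟩
    · intro k
      fin_cases k
      · exact (ht.mul (hA.const_add (A α))).congr_deriv (by simp; ring)
      · exact (ht.mul ((hid.const_mul (A α)).neg.sub (hA.mul_const α))).congr_deriv (by simp; ring)
      · exact ((((hA.const_mul (A α)).mul (hA.const_add (A α))).div_const 2).add
          (ht.mul ((hp.const_mul (A α)).sub (hA.const_mul (2 * α ^ 2 - g₂ / 4))))).congr_deriv
          (by simp; ring)
      · exact (ht.mul ((hp.const_mul (A α)).add (hA.mul_const (α ^ 2)))).congr_deriv
          (by simp; ring)
      · exact ((((hA.const_mul (A α)).mul (hA.const_add (A α))).div_const 2).neg.add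
          (ht.mul ((hA.mul_const (α ^ 2)).sub
            (((hp.const_mul 2).sub_const (g₂ / 4)).mul_const (A α))))).congr_deriv
          (by simp; ring)
      · exact (ht.mul (((hA.const_add (A α)).const_mul (g₃ / 2)).sub
          (((hid.const_mul (A α)).neg.sub (hA.mul_const α)).const_mul (g₂ / 4)))).congr_deriv
          (by simp; ring)
      · exact (ht.mul (((hA.const_add (A α)).const_mul (g₂ ^ 2 / 16)).sub
          (((hid.const_mul (A α)).neg.sub (hA.mul_const α)).const_mul g₃))).congr_deriv
          (by simp; ring)
    · simp; ring
    · simp [coefC]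
      refine ⟨?_, ?_, ?_, ?_, ?_, ?_⟩ <;> field_simp <;> ring
    · intro t ht0
      refine ⟨neg_ne_zero.2 ht0, ?_⟩
      funext k
      fin_cases k <;> simp [coefA, coefQ4] <;> field_simp <;> ring

/-- The two statements feed each other: symmetry at level k + 1 uses symmetry and commutation at
level k, and commutation at level k + 1 is the limit β → α of symmetry at level k + 1. Symmetry is
stated for all branches and parameters, because one step varies α and the other sends β to α with
the branch A on both sides. -/
theorem ABS.strips_and_commutation (e : ABS) (k : ℕ) :
    (∀ (A B : ℂ → ℂ) (α β : ℂ), e.Admissible B β → α ∈ e.dom A B β →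
      StripSymmetry (e.coefA A B α β) (e.coefC A α) (Rk k) (2 * k + 2)) ∧
    ∀ (A : ℂ → ℂ) (α : ℂ), e.Admissible A α → ∀ x, Reg x →
      e1 (e.coefC A α) x (br (Rk k) ABSLattice.R0) = 0 := by
  induction k with
  | zero =>
    refine ⟨fun A B α β hβ hα u h0 h1 hu => ?_, fun A α _ x _ => ?_⟩
    · exact sqd_R0 (compatible_coefA hα.1 hβ hα.2.1 hα.2.2) h0 h1 (hu _ (by simp)).1
        (hu _ (by norm_num)).1 (hu _ (by norm_num)).1
    · rw [Rk, br_self, map_zero]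
  | succ k ih =>
    have hP : ∀ (A B : ℂ → ℂ) (α β : ℂ), e.Admissible B β → α ∈ e.dom A B β →
        StripSymmetry (e.coefA A B α β) (e.coefC A α) (Rk (k + 1)) (2 * (k + 1 : ℕ) + 2) :=
      fun A B α β hβ hα => StripSymmetry.succ (family hβ) k (fun s hs => ih.1 A B s β hβ hs) hα
        (ih.2 A α hα.1)
    refine ⟨hP, fun A α hα x hx => ?_⟩
    have main : ∀ α, e.Admissible A α → e.r A α ≠ 0 →
        e1 (e.coefC A α) x (br (Rk (k + 1)) ABSLattice.R0) = 0 := by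
      intro α hα hr
      obtain ⟨σ, b, b', μ, ν, hb, hμ, hν, h0, hb', hσ⟩ := exists_limit hα hr
      refine commute_of_strips hb hμ hν h0 hb' (k + 1) (N := 2 * (k + 1 : ℕ) + 2) ?_ hx
      have hcont : ContinuousAt (fun t : ℂ => α + t) 0 := by fun_prop
      have ha : ∀ᶠ t in 𝓝 (0 : ℂ), e.Admissible A (α + t) :=
        hcont.eventually (by simpa using hα.eventually)
      filter_upwards [eventually_aDisc_ne hb hμ hν h0 hb' (coefC_ne_zero hα), self_mem_nhdsWithin,
        ha.filter_mono nhdsWithin_le_nhds] with t h1 h2 h3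
      obtain ⟨h4, h5⟩ := hσ t h2
      rw [h5]
      refine (hP A A α (α + t) h3 ⟨hα, ?_, ?_⟩).of_smul h4
      · simpa using h2
      · intro h6
        apply h1
        have : ∀ j, aDisc (fun k => σ t * e.coefA A A α (α + t) k) j =
            σ t ^ 2 * aDisc (e.coefA A A α (α + t)) j := by
          intro j; fin_cases j <;> simp [aDisc] <;> ring
        rw [h5]; funext j; rw [this, h6]; simp
    -- Among admissible parameters r vanishes only for `H3` at α = 0. There the commutator is the
    -- limit of its zero values at α ≠ 0.
    by_cases hr : e.r A α = 0
    · choose c' hc' _ using fun j => hasDerivAt_coefC hα j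
      have hd := hasDerivAt_ev (D := Unit) (cv := fun t _ => e.coefC A t) (u := fun _ => x)
        (t₀ := α) (cc := fun _ j => C (c' j)) (xx := 0) (fun _ j => by simpa using hc' j)
        (fun q => by simpa using hasDerivAt_const _ _) hx (br (Rk (k + 1)) ABSLattice.R0)
      refine tendsto_nhds_unique (hd.continuousAt.tendsto.mono_left nhdsWithin_le_nhds)
        ((tendsto_const_nhds (x := (0 : ℂ)) (f := 𝓝[≠] α)).congr' ?_)
      cases e with
      | H3 δ =>
        filter_upwards [self_mem_nhdsWithin] with t ht
        have : α = 0 := by simpa [ABS.r] using hr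
        subst this
        exact (main t trivial (by simpa [ABS.r] using ht)).symm
      | H1 => simp [ABS.r] at hr
      | H2 => simp [ABS.r] at hr
      | Q1 δ => simp [ABS.r] at hr
      | Q2 => simp [ABS.r] at hr
      | Q3 δ => exact absurd (by simpa [ABS.r] using hr) hα.1
      | Q4 g₂ g₃ => exact absurd (by simpa [ABS.r] using hr) hα.1
    · exact main α hα hr

/-! ### The two directions -/

/-- The coefficients after exchanging the vertices `x` and `y`. -/
def aSwap (a : Fin 7 → ℂ) : Fin 7 → ℂ := ![a 0, a 1, a 4, a 3, a 2, a 5, a 6]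

/-- The coefficients after exchanging the vertices `x` and `z`. -/
def aDiag (a : Fin 7 → ℂ) : Fin 7 → ℂ := ![a 0, a 1, a 3, a 2, a 4, a 5, a 6]

theorem aDisc_aDiag_aSwap (a : Fin 7 → ℂ) : aDisc (aDiag (aSwap a)) = aDisc (aDiag a) := by
  funext j
  fin_cases j <;> simp [aDisc, aDiag, aSwap] <;> first | ring1 | (left; ring1)

theorem bq_aDisc_aDiag (a : Fin 7 → ℂ) (u x y z : ℂ) : bq (aDisc (aDiag a)) y x =
    aqu a x y z * aqz a u x y - aq a u x y z * (a 0 * x * y + a 1 * (x + y) + a 3) := by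
  simp [bq, aDisc, aDiag, aqu, aqz, aq, affineQ]; ring

/-- On solutions, the half derivatives of the edge and the diagonal polynomial at y add up to Q_u
Q_{xz}. This is what converts a characteristic along an edge into one along the diagonals. -/
theorem bqh_aDisc_add (a : Fin 7 → ℂ) (u x y z : ℂ) :
    bqh (aDisc a) y z + bqh (aDisc (aDiag a)) y x =
      aqu a x y z * (a 0 * u * y + a 1 * (u + y) + a 4) - aq a u x y z * (a 0 * y + a 1) := by
  simp [bqh, aDisc, aDiag, aqu, aq, affineQ]; ring

/-- The characteristic at the opposite edge, in terms of the vertices of the cross. -/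
theorem kappa_mul_opposite {a : Fin 7 → ℂ} {c : Fin 6 → ℂ} {κ u x x' y z z' : ℂ}
    (hc : ∀ j, aDisc a j = κ * c j) (hQ : aq a u x y z = 0) (hQ' : aq a u x' y z' = 0)
    (hx : x - x' ≠ 0) (hz : z - z' ≠ 0) :
    κ * (bqp c y z z' / (z - z')) = -(bqp (aDisc (aDiag a)) y x x' / (x - x')) := by
  rw [bqp_div c hz, bqp_div _ hx]
  have e2 : κ * bq c y z = aqu a x y z * aqx a u y z := by
    rw [← bq_mul κ c _ hc, bq_aDisc a y z u x]
    have : aq a y z u x = 0 := by rw [← hQ]; simp only [aq, affineQ]; ring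
    rw [this]
    simp only [aqy, aqz, aqu, aqx]; ring
  have e4 : κ * bqh c y z = bqh (aDisc a) y z := (bqh_mul κ c _ hc _ _).symm
  have e5 := bq_aDisc_aDiag a u x y z
  have e6 := bqh_aDisc_add a u x y z
  rw [hQ] at e5 e6
  have e7 : (x - x') * aqx a u y z = -(z - z') * aqz a u x' y := by
    have : aq a u x y z - aq a u x' y z' = (x - x') * aqx a u y z + (z - z') * aqz a u x' y := by
      simp only [aq, affineQ, aqx, aqz]; ring
    rw [hQ, hQ'] at this
    linear_combination -this
  have e8 : aqz a u x y - aqz a u x' y = (x - x') * (a 0 * u * y + a 1 * (u + y) + a 4) := by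
    simp only [aqz]; ring
  -- As in `half_extended`, subtracting the equations of the two squares trades the denominator z -
  -- z' for x - x'.
  have e9 : aqz a u x y / (x - x') + aqx a u y z / (z - z') =
      a 0 * u * y + a 1 * (u + y) + a 4 := by
    rw [div_add_div _ _ hx hz, div_eq_iff (mul_ne_zero hx hz)]
    linear_combination e7 + (z - z') * e8
  linear_combination e2 / (z - z') - e4 + e5 / (x - x') - e6 + aqu a x y z * e9

-- This is the numerator of [v_n, v_m] at the centre of a 3 × 3 block, after the corner values have
-- been eliminated. It vanishes for arbitrary coefficients and arbitrary values on the cross, so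
-- neither the lattice equation nor the ABS list enters.
set_option maxHeartbeats 4000000 in
theorem cross_identity (a : Fin 7 → ℂ) (u x x' y y' : ℂ) :
    (x - x') * (-bqp (aDisc (aDiag a)) y x x' * bq (aDisc (aSwap a)) u y'
        + bqp (aDisc (aDiag a)) y' x x' * bq (aDisc (aSwap a)) u y)
      - (x - x') * (y - y') * bqp (aDisc a) u x x' * bqpu (aDisc (aSwap a)) u y y'
      - (y - y') * (-bqp (aDisc (aDiag a)) x y y' * bq (aDisc a) u x'
        + bqp (aDisc (aDiag a)) x' y y' * bq (aDisc a) u x)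
      + (x - x') * (y - y') * bqp (aDisc (aSwap a)) u y y' * bqpu (aDisc a) u x x' = 0 := by
  simp [bq, bqp, bqpu, aDisc, aDiag, aSwap]; ring

instance : DecidableEq Dir
  | .n, .n => isTrue rfl
  | .n, .m => isFalse (by simp)
  | .m, .n => isFalse (by simp)
  | .m, .m => isTrue rfl

instance : Fintype Dir := ⟨{.n, .m}, by rintro (_ | _) <;> simp⟩

instance : Directions (ℤ × ℤ) Dir where
  vec := Dir.vec
  vec_ne d := by cases d <;> simp [Dir.vec, Dir.pick]

theorem vec_n : Directions.vec Dir.n = ((1, 0) : ℤ × ℤ) := rfl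

theorem vec_m : Directions.vec Dir.m = ((0, 1) : ℤ × ℤ) := rfl

theorem vec_eq (d : Dir) : Directions.vec d = d.vec := rfl

/-- The difference algebra of the plane. -/
abbrev L2 := LAlg (ℤ × ℤ) Dir

/-- The embedding of the difference algebra of a line. -/
def inc (d : Dir) : L1 →ₐ[ℂ] L2 :=
  rename fun
    | .c _ j => .c d j
    | .x l => .x (l • d.vec)
    | .w _ l => .w d (l • d.vec)

@[simp] theorem inc_c (d : Dir) (t : Unit) (j : Fin 6) : inc d (gc t j) = gc d j := rename_X _ _

@[simp] theorem inc_x (d : Dir) (l : ℤ) : inc d (gx l) = gx (l • d.vec) := rename_X _ _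

@[simp] theorem inc_w (d : Dir) (t : Unit) (l : ℤ) : inc d (gw t l) = gw d (l • d.vec) :=
  rename_X _ _

theorem ev_inc (cv : Dir → Fin 6 → ℂ) (u : ℤ × ℤ → ℂ) (d : Dir) (P : L1) :
    ev cv u (inc d P) = e1 (cv d) (fun l => u (l • d.vec)) P := by
  rw [inc, ev, aeval_rename, e1, ev]
  congr 2
  funext g
  rcases g with ⟨t, j⟩ | l | ⟨t, l⟩
  · rfl
  · rfl
  · simp [vec_eq, add_smul, sub_smul, -zsmul_eq_mul]

theorem shiftHom_inc (d : Dir) (l : ℤ) (P : L1) :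
    shiftHom (l • d.vec) (inc d P) = inc d (shiftHom l P) := by
  rw [inc, shiftHom, shiftHom, rename_rename, rename_rename]
  congr 2
  funext g
  rcases g with ⟨t, j⟩ | k | ⟨t, k⟩ <;> simp [add_smul, -zsmul_eq_mul]

theorem goodDer_inc (d : Dir) {cc : Unit → Fin 6 → L1} {xx : ℤ → L1} {cc' : Dir → Fin 6 → L2}
    {xx' : ℤ × ℤ → L2} (hc : ∀ j, cc' d j = inc d (cc () j))
    (hx : ∀ l : ℤ, xx' (l • d.vec) = inc d (xx l)) (P : L1) :
    goodDer cc' xx' (inc d P) = inc d (goodDer cc xx P) := by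
  refine intertwine _ _ _ (fun g => ?_) P
  rcases g with ⟨t, j⟩ | l | ⟨t, l⟩
  · simp [hc]
  · simp [hx, -zsmul_eq_mul]
  · have h1 : l • d.vec + d.vec = (l + 1) • d.vec := by rw [add_smul, one_smul]
    have h2 : l • d.vec - d.vec = (l - 1) • d.vec := by rw [sub_smul, one_smul]
    simp [vec_eq, h1, h2, hx, -zsmul_eq_mul]

/-- The coordinate of a lattice point in a direction. -/
def Dir.coord (d : Dir) (q : ℤ × ℤ) : ℤ := d.pick q.1 q.2

@[simp] theorem coord_smul (d : Dir) (l : ℤ) : d.coord (l • d.vec) = l := by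
  cases d <;> simp [Dir.coord, Dir.vec, Dir.pick]

theorem coord_add (d : Dir) (p q : ℤ × ℤ) : d.coord (p + q) = d.coord p + d.coord q := by
  cases d <;> rfl

theorem coord_smul_of_ne {d d' : Dir} (h : d' ≠ d) (l : ℤ) : d.coord (l • d'.vec) = 0 := by
  cases d <;> cases d' <;> simp [Dir.coord, Dir.vec, Dir.pick] at h ⊢

/-- The characteristic of the basic symmetry of a direction. -/
abbrev R2 (d : Dir) : L2 := inc d R0

/-- The extended symmetry of a direction, at the origin. -/
def recD2 (d : Dir) : Derivation ℂ L2 L2 :=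
  goodDer (fun d' j => if d' = d then -bqDelta (gc d) j else 0)
    fun q => C (d.coord q : ℂ) * shiftHom q (R2 d)

theorem inc_bqDelta (d : Dir) (j : Fin 6) : inc d (bqDelta cs j) = bqDelta (gc d) j := by
  fin_cases j <;> simp [bqDelta]

theorem recD2_inc (d : Dir) (P : L1) : recD2 d (inc d P) = inc d (recD P) := by
  refine goodDer_inc d ?_ ?_ P
  · intro j; simp [inc_bqDelta]
  · intro l; simp [shiftHom_inc, ← algebraMap_eq, -zsmul_eq_mul]

/-- Points on the other axis have weight 0 in direction d, and the coefficients of the other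
direction do not move. -/
theorem recD2_inc_of_ne {d d' : Dir} (h : d' ≠ d) (P : L1) : recD2 d (inc d' P) = 0 := by
  rw [recD2, goodDer_inc (d := d') (cc := 0) (xx := 0), goodDer_zero_zero, map_zero]
  · intro j; simp [h]
  · intro l; simp [coord_smul_of_ne h, -zsmul_eq_mul]

theorem recD2_shiftHom (d : Dir) (s : ℤ × ℤ) (P : L2) :
    recD2 d (shiftHom s P) = shiftHom s (recD2 d P + C (d.coord s : ℂ) * evo (R2 d) P) := by
  have h : recD2 d + (C (d.coord s : ℂ) : L2) • evo (R2 d) =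
      goodDer (fun d' j => if d' = d then -bqDelta (gc d) j else 0)
      (fun q => C ((d.coord (q + s) : ℤ) : ℂ) * shiftHom q (R2 d)) := by
    refine derivation_ext fun g => ?_
    rcases g with ⟨d, j⟩ | q | ⟨d, q⟩
    · simp [recD2]
    · simp [recD2, coord_add]; ring
    · simp [recD2, evo, coord_add]; ring
  have h2 := shiftHom_goodDer s (fun d' j => if d' = d then -bqDelta (gc d) j else 0)
    (fun d' j => if d' = d then -bqDelta (gc d) j else 0)
    (fun q => C ((d.coord (q + s) : ℤ) : ℂ) * shiftHom q (R2 d))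
    (fun q => C (d.coord q : ℂ) * shiftHom q (R2 d))
    (fun d' j => by split_ifs; · fin_cases j <;> simp [bqDelta]
                    · simp)
    (fun l => by simp [shiftHom_shiftHom, ← algebraMap_eq]) P
  rw [← h] at h2
  simpa [recD2] using h2

/-- `recD2 d` commutes with translations only up to multiples of the evolution along `R2 d`. Hence
its commutator with an evolution has an extra part, the translates of the bracket weighted by the
coordinate, which disappears wherever the bracket does. -/
theorem recD2_lie_evo (d : Dir) (H : L2) : ⁅recD2 d, evo H⁆ = evo (recD2 d H)
    + goodDer 0 fun q => C (d.coord q : ℂ) * shiftHom q (br (R2 d) H) := by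
  rw [evo.eq_1 (recD2 d H), goodDer_add]
  refine (goodDer_lie _ _ _ _).trans ?_
  congr 1
  · funext d' j
    change recD2 d 0 - evo H (if d' = d then -bqDelta (gc d) j else 0) = _
    have : evo H (bqDelta (gc d) j) = 0 := by fin_cases j <;> simp [bqDelta]
    by_cases h : d' = d <;> simp [h, this]
  · funext q
    change recD2 d (shiftHom q H) - evo H (C (d.coord q : ℂ) * shiftHom q (R2 d)) = _
    rw [recD2_shiftHom, Derivation.leibniz, evo_shiftHom]
    simp [br, ← algebraMap_eq]; ring

/-- The Jacobi identity for `[[V, v], F]` when `V` annihilates `F`. -/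
theorem br_recD2_R2 (d : Dir) {F : L2} (hF : recD2 d F = 0) : br (recD2 d (R2 d)) F =
    recD2 d (br (R2 d) F)
      + goodDer 0 (fun q => C (d.coord q : ℂ) * shiftHom q (br (R2 d) F)) (R2 d) := by
  have h1 := congrArg (fun E => E F) (recD2_lie_evo d (R2 d))
  have h2 := congrArg (fun E => E (R2 d)) (recD2_lie_evo d F)
  simp only [Derivation.commutator_apply, Derivation.add_apply, hF, br_self, map_zero, mul_zero,
    sub_zero] at h1 h2
  have h3 : goodDer (0 : Dir → Fin 6 → L2) (fun _ => (0 : L2)) F = 0 := goodDer_zero_zero F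
  have h4 : evo (0 : L2) (R2 d) = 0 := by
    have : evo (0 : L2) = goodDer 0 0 := by
      refine derivation_ext fun g => ?_
      rcases g with ⟨d, j⟩ | q | ⟨d, q⟩ <;> simp [evo]
    rw [this, goodDer_zero_zero]
  rw [h3, add_zero] at h1
  rw [h4, zero_add] at h2
  rw [← h2, br, ← h1, br]
  simp only [map_sub, sub_add_sub_cancel]

/-! ### The basic symmetries commute on the solutions -/

theorem ev_shift_R2 (cv : Dir → Fin 6 → ℂ) (u : ℤ × ℤ → ℂ) (d : Dir) (q : ℤ × ℤ) :
    ev cv u (shiftHom q (R2 d)) = bqp (cv d) (u q) (u (q + d.vec)) (u (q - d.vec))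
      / (u (q + d.vec) - u (q - d.vec)) := by
  rw [ev_shiftHom, ev_inc, e1_R0]
  simp only [zero_smul, one_smul, neg_smul, zero_add]
  rw [add_comm d.vec, neg_add_eq_sub]

theorem evo_R2 (d : Dir) (F : L2) : evo F (R2 d) =
    shiftHom d.vec F * inc d rho + F * inc d rho0 + shiftHom (-d.vec) F * inc d rhom := by
  have h : ∀ l : ℤ, pd (l • d.vec) (R2 d) = inc d (pd l R0) := by
    intro l
    refine goodDer_inc d (by simp) (fun k => ?_) R0
    have : k • d.vec = l • d.vec ↔ k = l := by
      refine ⟨fun h => ?_, fun h => by rw [h]⟩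
      have := congrArg d.coord h
      simpa [-zsmul_eq_mul] using this
    split_ifs <;> simp_all
  rw [evo_eq_sum (T := {(1 : ℤ) • d.vec, (0 : ℤ) • d.vec, (-1 : ℤ) • d.vec})]
  · rw [Finset.sum_insert, Finset.sum_insert, Finset.sum_singleton, h, h, h]
    · simp [rho, rho0, rhom]; ring
    all_goals cases d <;> simp [Dir.vec, Dir.pick, Prod.ext_iff]
  · intro q hq
    rw [pd]
    by_cases hl : ∃ l : ℤ, q = l • d.vec
    · obtain ⟨l, rfl⟩ := hl
      rw [← pd, h, pd_R0, map_zero]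
      all_goals rintro rfl; simp at hq
    · rw [goodDer_inc (d := d) (cc := 0) (xx := 0) (by simp), goodDer_zero_zero, map_zero]
      intro l
      rw [if_neg fun h => hl ⟨l, h.symm⟩]; simp

theorem RegAll.plane {u : ℤ × ℤ → ℂ} (hu : RegAll Dir u) (d : Dir) (q : ℤ × ℤ) :
    Reg fun l => u (q + l • d.vec) := by
  intro _ l
  have := hu d (q + l • d.vec)
  simp only [vec_eq] at this
  simpa only [vec_unit, add_smul, sub_smul, one_smul, ← add_assoc, ← add_sub_assoc] using this

theorem ev_evo_R2 (cv : Dir → Fin 6 → ℂ) {u : ℤ × ℤ → ℂ} (hu : RegAll Dir u) (d : Dir) (F : L2) :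
    ev cv u (evo F (R2 d)) = (ev cv u F * bqpu (cv d) (u 0) (u d.vec) (u (-d.vec))
        * (u d.vec - u (-d.vec))
      - ev cv u (shiftHom d.vec F) * bq (cv d) (u 0) (u (-d.vec))
      + ev cv u (shiftHom (-d.vec) F) * bq (cv d) (u 0) (u d.vec)) / (u d.vec - u (-d.vec)) ^ 2 := by
  have hr : Reg fun l : ℤ => u (l • d.vec) := by simpa only [zero_add] using hu.plane d 0
  have h := hr.sub_ne
  rw [evo_R2]
  simp only [map_add, map_mul, ev_inc, e1_rho _ hr, e1_rhom _ hr, e1_rho0]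
  simp only [zero_smul, one_smul, neg_smul] at h ⊢
  field_simp
  ring

/-- The basic symmetries of the two directions commute on the solutions. -/
theorem ev_br_R2 {a : Fin 7 → ℂ} {cv : Dir → Fin 6 → ℂ} {κ : ℂ} (hκ : κ ≠ 0)
    (hn : ∀ j, aDisc a j = κ * cv .n j) (hm : ∀ j, aDisc (aSwap a) j = -κ * cv .m j)
    {u : ℤ × ℤ → ℂ} (hu : RegAll Dir u) (h₁ : sqv a u (0, 0) = 0) (h₂ : sqv a u (-1, 0) = 0)
    (h₃ : sqv a u (0, -1) = 0) (h₄ : sqv a u (-1, -1) = 0) :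
    ev cv u (br (R2 .n) (R2 .m)) = 0 := by
  have dn : ∀ j : ℤ, u (1, j) - u (-1, j) ≠ 0 := fun j => by
    have := hu .n (0, j)
    simpa [vec_n, sub_eq_zero] using this
  have dm : ∀ i : ℤ, u (i, 1) - u (i, -1) ≠ 0 := fun i => by
    have := hu .m (i, 0)
    simpa [vec_m, sub_eq_zero] using this
  simp only [sqv, Prod.mk_add_mk, add_zero, zero_add, neg_add_cancel] at h₁ h₂ h₃ h₄
  have sw : ∀ u x y z, aq (aSwap a) u x y z = aq a u y x z := fun u x y z => by
    simp only [aq, affineQ, aSwap, Matrix.cons_val]; ring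
  -- The four relations `k₁` to `k₄` eliminate the corners (±1, ±1), by expressing the shifted
  -- characteristics through values on the cross.
  have k₁ := kappa_mul_opposite (u := u (0, 0)) (x := u (1, 0)) (x' := u (-1, 0)) (y := u (0, 1))
    (z := u (1, 1)) (z' := u (-1, 1)) hn h₁ (by rw [← h₂]; simp only [aq, affineQ]; ring)
    (dn 0) (dn 1)
  have k₂ := kappa_mul_opposite (u := u (0, 0)) (x := u (1, 0)) (x' := u (-1, 0)) (y := u (0, -1))
    (z := u (1, -1)) (z' := u (-1, -1)) hn (by rw [← h₃]; simp only [aq, affineQ]; ring)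
    (by rw [← h₄]; simp only [aq, affineQ]; ring) (dn 0) (dn (-1))
  have k₃ := kappa_mul_opposite (u := u (0, 0)) (x := u (0, 1)) (x' := u (0, -1)) (y := u (1, 0))
    (z := u (1, 1)) (z' := u (1, -1)) hm (by rw [sw, ← h₁])
    (by rw [sw, ← h₃]; simp only [aq, affineQ]; ring) (dm 0) (dm 1)
  have k₄ := kappa_mul_opposite (u := u (0, 0)) (x := u (0, 1)) (x' := u (0, -1)) (y := u (-1, 0))
    (z := u (-1, 1)) (z' := u (-1, -1)) hm (by rw [sw, ← h₂]; simp only [aq, affineQ]; ring)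
    (by rw [sw, ← h₄]; simp only [aq, affineQ]; ring) (dm 0) (dm (-1))
  -- Exchanging the directions leaves the diagonals in place, so both directions use the same
  -- diagonal polynomial.
  rw [aDisc_aDiag_aSwap] at k₃ k₄
  have c₁ := bq_mul κ _ _ hn (u (0, 0)) (u (1, 0))
  have c₂ := bq_mul κ _ _ hn (u (0, 0)) (u (-1, 0))
  have c₃ := bq_mul (-κ) _ _ hm (u (0, 0)) (u (0, 1))
  have c₄ := bq_mul (-κ) _ _ hm (u (0, 0)) (u (0, -1))
  have c₅ : bqp (aDisc a) (u (0, 0)) (u (1, 0)) (u (-1, 0)) =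
      κ * bqp (cv .n) (u (0, 0)) (u (1, 0)) (u (-1, 0)) := by simp only [bqp, hn]; ring
  have c₆ : bqp (aDisc (aSwap a)) (u (0, 0)) (u (0, 1)) (u (0, -1)) =
      -κ * bqp (cv .m) (u (0, 0)) (u (0, 1)) (u (0, -1)) := by simp only [bqp, hm]; ring
  have c₇ : bqpu (aDisc a) (u (0, 0)) (u (1, 0)) (u (-1, 0)) =
      κ * bqpu (cv .n) (u (0, 0)) (u (1, 0)) (u (-1, 0)) := by simp only [bqpu, hn]; ring
  have c₈ : bqpu (aDisc (aSwap a)) (u (0, 0)) (u (0, 1)) (u (0, -1)) =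
      -κ * bqpu (cv .m) (u (0, 0)) (u (0, 1)) (u (0, -1)) := by simp only [bqpu, hm]; ring
  have key := cross_identity a (u (0, 0)) (u (1, 0)) (u (-1, 0)) (u (0, 1)) (u (0, -1))
  rw [c₁, c₂, c₃, c₄, c₅, c₆, c₇, c₈] at key
  have e1 : bqp (aDisc (aDiag a)) (u (0, 1)) (u (1, 0)) (u (-1, 0)) = -(u (1, 0) - u (-1, 0)) *
      (κ * (bqp (cv .n) (u (0, 1)) (u (1, 1)) (u (-1, 1)) / (u (1, 1) - u (-1, 1)))) := by
    rw [k₁]; have := dn 0; field_simp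
  have e2 : bqp (aDisc (aDiag a)) (u (0, -1)) (u (1, 0)) (u (-1, 0)) = -(u (1, 0) - u (-1, 0)) *
      (κ * (bqp (cv .n) (u (0, -1)) (u (1, -1)) (u (-1, -1)) / (u (1, -1) - u (-1, -1)))) := by
    rw [k₂]; have := dn 0; field_simp
  have e3 : bqp (aDisc (aDiag a)) (u (1, 0)) (u (0, 1)) (u (0, -1)) = -(u (0, 1) - u (0, -1)) *
      (-κ * (bqp (cv .m) (u (1, 0)) (u (1, 1)) (u (1, -1)) / (u (1, 1) - u (1, -1)))) := by
    rw [k₃]; have := dm 0; field_simp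
  have e4 : bqp (aDisc (aDiag a)) (u (-1, 0)) (u (0, 1)) (u (0, -1)) = -(u (0, 1) - u (0, -1)) *
      (-κ * (bqp (cv .m) (u (-1, 0)) (u (-1, 1)) (u (-1, -1)) / (u (-1, 1) - u (-1, -1)))) := by
    rw [k₄]; have := dm 0; field_simp
  rw [e1, e2, e3, e4] at key
  have r0 : ∀ d, ev cv u (R2 d) = ev cv u (shiftHom 0 (R2 d)) := fun d => by rw [shiftHom_zero]
  rw [br, map_sub, ev_evo_R2 cv hu, ev_evo_R2 cv hu, r0, r0]
  simp only [ev_shift_R2, Dir.vec, Dir.pick, Prod.mk_add_mk, Prod.mk_sub_mk, Prod.neg_mk, zero_add,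
    add_zero, neg_zero, sub_zero, zero_sub]
  simp only [show (0 : ℤ × ℤ) = (0, 0) from rfl] at key ⊢
  generalize bqp (cv .n) (u (0, 1)) (u (1, 1)) (u (-1, 1)) / (u (1, 1) - u (-1, 1)) = p1 at key ⊢
  generalize bqp (cv .n) (u (0, -1)) (u (1, -1)) (u (-1, -1)) / (u (1, -1) - u (-1, -1)) = p2
    at key ⊢
  generalize bqp (cv .m) (u (1, 0)) (u (1, 1)) (u (1, -1)) / (u (1, 1) - u (1, -1)) = p3 at key ⊢
  generalize bqp (cv .m) (u (-1, 0)) (u (-1, 1)) (u (-1, -1)) / (u (-1, 1) - u (-1, -1)) = p4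
    at key ⊢
  have n0 := dn 0
  have m0 := dm 0
  field_simp
  refine mul_left_cancel₀ (mul_ne_zero hκ hκ) ?_
  linear_combination key

/-! ### Exchanging the two directions -/

/-- The sign by which `Q` changes when the two directions are exchanged. -/
def ABS.sgn (e : ABS) : ℂ :=
  match e with
  | .Q4 _ _ => 1
  | _ => -1

theorem ABS.sgn_mul_self (e : ABS) : e.sgn * e.sgn = 1 := by cases e <;> simp [sgn]

theorem ABS.sgn_ne_zero (e : ABS) : e.sgn ≠ 0 := fun h => by simpa [h] using e.sgn_mul_self

/-- Exchanging the directions together with the parameters reproduces the equation up to a sign, so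
results for direction m follow from those for direction n. -/
theorem ABS.coefA_swap (e : ABS) (A B : ℂ → ℂ) (α β : ℂ) (k : Fin 7) :
    e.coefA B A β α k = e.sgn * aSwap (e.coefA A B α β) k := by
  cases e <;> fin_cases k <;> simp [coefA, sgn, aSwap, coefQ4] <;> ring

theorem aDisc_smul (s : ℂ) (a : Fin 7 → ℂ) (j : Fin 6) :
    aDisc (fun k => s * a k) j = s ^ 2 * aDisc a j := by
  fin_cases j <;> simp [aDisc] <;> ring

theorem ABS.aDisc_coefA_swap (e : ABS) (A B : ℂ → ℂ) (α β : ℂ) (j : Fin 6) :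
    aDisc (e.coefA B A β α) j = aDisc (aSwap (e.coefA A B α β)) j := by
  rw [show e.coefA B A β α = fun k => e.sgn * aSwap (e.coefA A B α β) k from
    funext (e.coefA_swap A B α β), aDisc_smul, pow_two, sgn_mul_self, one_mul]

theorem ABS.kappa_swap {e : ABS} {A B : ℂ → ℂ} {α β : ℂ} (hα : e.Admissible A α)
    (hβ : e.Admissible B β) (hαβ : α ≠ β) : e.kappa B A β α = -e.kappa A B α β := by
  cases e with
  | Q4 g₂ g₃ =>
    have h1 : α - β ≠ 0 := sub_ne_zero.2 hαβ
    obtain ⟨e1, e2⟩ := weierstrass_param h1 hα.2.self_of_nhds.2 hβ.2.self_of_nhds.2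
    simp only [kappa, aDisc, coefA, coefQ4, Matrix.cons_val]
    rw [← neg_sub α β, e1]
    field_simp
    ring
  | _ => simp [kappa] <;> ring

/-- The parameters at which the equation is nondegenerate. -/
structure ABS.Good (e : ABS) (A B : ℂ → ℂ) (α β : ℂ) : Prop where
  left : e.Admissible A α
  right : e.Admissible B β
  ne : α ≠ β
  kappa : e.kappa A B α β ≠ 0

theorem ABS.Good.symm {e : ABS} {A B : ℂ → ℂ} {α β : ℂ} (h : e.Good A B α β) :
    e.Good B A β α := ⟨h.right, h.left, h.ne.symm, by
      rw [kappa_swap h.left h.right h.ne]; exact neg_ne_zero.2 h.kappa⟩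

theorem ABS.Good.mem_dom {e : ABS} {A B : ℂ → ℂ} {α β : ℂ} (h : e.Good A B α β) :
    α ∈ e.dom A B β := by
  refine ⟨h.left, h.ne, fun h0 => ?_⟩
  obtain ⟨j, hj⟩ := Function.ne_iff.1 (coefC_ne_zero h.left)
  have := aDisc_coefA h.left h.right h.ne j
  rw [h0] at this
  exact mul_ne_zero h.kappa hj this.symm

theorem ABS.good_of_mem_dom {e : ABS} {A B : ℂ → ℂ} {α β : ℂ} (hβ : e.Admissible B β)
    (h : α ∈ e.dom A B β) : e.Good A B α β :=
  ⟨h.1, hβ, h.2.1, fun h0 => h.2.2 (funext fun j => by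
    rw [aDisc_coefA h.1 hβ h.2.1, h0, zero_mul]; rfl)⟩

/-- The coefficients of the biquadratic polynomials of both directions. -/
def ABS.cv (e : ABS) (A B : ℂ → ℂ) (α β : ℂ) : Dir → Fin 6 → ℂ :=
  fun d => d.pick (e.coefC A α) (e.coefC B β)

/-- The coordinates of a lattice point, that of the given direction first. -/
def Dir.tr (d : Dir) (q : ℤ × ℤ) : ℤ × ℤ := d.pick q q.swap

@[simp] theorem Dir.tr_tr (d : Dir) (q : ℤ × ℤ) : d.tr (d.tr q) = q := by cases d <;> rfl

theorem Dir.tr_fst (d : Dir) (q : ℤ × ℤ) : (d.tr q).1 = d.coord q := by cases d <;> rfl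

/-- The coefficients of `Q`, the given direction being the first one. -/
def ABS.coefD (e : ABS) (d : Dir) (A B : ℂ → ℂ) (α β : ℂ) : Fin 7 → ℂ :=
  d.pick (e.coefA A B α β) (e.coefA B A β α)

/-- The sign relating `coefD` and `coefA`. -/
def ABS.sgnD (e : ABS) (d : Dir) : ℂ := d.pick 1 e.sgn

theorem ABS.sgnD_ne_zero (e : ABS) (d : Dir) : e.sgnD d ≠ 0 := by
  cases d
  · exact one_ne_zero
  · exact e.sgn_ne_zero

theorem sqv_aSwap (a : Fin 7 → ℂ) (u : ℤ × ℤ → ℂ) (q : ℤ × ℤ) :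
    sqv (aSwap a) (fun p => u p.swap) q.swap = sqv a u q := by
  rcases q with ⟨i, j⟩
  simp [sqv, aSwap, aq, affineQ]; ring

theorem sqd_aSwap (a : Fin 7 → ℂ) (u U : ℤ × ℤ → ℂ) (q : ℤ × ℤ) :
    sqd (aSwap a) (fun p => u p.swap) (fun p => U p.swap) q.swap = sqd a u U q := by
  rcases q with ⟨i, j⟩
  simp [sqd, aSwap, aqd, aqu, aqx, aqy, aqz]; ring

theorem ABS.sqv_coefD (e : ABS) (d : Dir) (A B : ℂ → ℂ) (α β : ℂ) (u : ℤ × ℤ → ℂ) (q : ℤ × ℤ) :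
    sqv (e.coefD d A B α β) (fun p => u (d.tr p)) (d.tr q) =
      e.sgnD d * sqv (e.coefA A B α β) u q := by
  cases d
  · simp [coefD, sgnD, Dir.pick, Dir.tr]
  · rw [← sqv_aSwap (e.coefA A B α β), ← sqv_smul]
    congr 1
    exact _root_.funext (e.coefA_swap A B α β)

theorem ABS.sqd_coefD (e : ABS) (d : Dir) (A B : ℂ → ℂ) (α β : ℂ) (u U : ℤ × ℤ → ℂ)
    (q : ℤ × ℤ) : sqd (e.coefD d A B α β) (fun p => u (d.tr p)) (fun p => U (d.tr p)) (d.tr q) =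
      e.sgnD d * sqd (e.coefA A B α β) u U q := by
  cases d
  · simp [coefD, sgnD, Dir.pick, Dir.tr]
  · rw [← sqd_aSwap (e.coefA A B α β), ← sqd_smul_left]
    congr 1
    exact _root_.funext (e.coefA_swap A B α β)

theorem ev_shift_inc (cv : Dir → Fin 6 → ℂ) (u : ℤ × ℤ → ℂ) (d : Dir) (P : L1) (q : ℤ × ℤ) :
    ev cv u (shiftHom q (inc d P)) = re (cv d) (fun p => u (d.tr p)) P (d.tr q) := by
  rw [ev_shiftHom, ev_inc, re, e1_shift]
  congr 2
  funext l
  rcases q with ⟨i, j⟩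
  cases d <;> simp [row, Dir.tr, Dir.vec, Dir.pick]

theorem RegAll.row {u : ℤ × ℤ → ℂ} (hu : RegAll Dir u) (d : Dir) (j : ℤ) :
    Reg (row (fun p => u (d.tr p)) j) := by
  have := hu.plane d (d.tr (0, j))
  convert this using 2 with l
  cases d <;> simp [ABSLattice.row, Dir.tr, Dir.vec, Dir.pick]

/-! ### The extended symmetries are tangent to the solutions -/

/-- The parameters along the flow of the extended symmetry of a direction. -/
def ABS.flow (e : ABS) (d : Dir) (A B : ℂ → ℂ) (α β t : ℂ) : ℂ × ℂ :=
  d.pick (α - t * e.r A α, β) (α, β - t * e.r B β)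

theorem ABS.flow_zero (e : ABS) (d : Dir) (A B : ℂ → ℂ) (α β : ℂ) :
    e.flow d A B α β 0 = (α, β) := by cases d <;> simp [flow, Dir.pick]

theorem tendsto_sub_mul (s r : ℂ) : Tendsto (fun t : ℂ => s - t * r) (𝓝 0) (𝓝 s) := by
  have : Continuous fun t : ℂ => s - t * r := by fun_prop
  simpa using this.tendsto 0

theorem ABS.Good.flow {e : ABS} {A B : ℂ → ℂ} {α β : ℂ} (h : e.Good A B α β) (d : Dir) :
    ∀ᶠ t in 𝓝 0, e.Good A B (e.flow d A B α β t).1 (e.flow d A B α β t).2 := by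
  cases d
  · filter_upwards [(tendsto_sub_mul α (e.r A α)).eventually
      ((family h.right).isOpen.mem_nhds h.mem_dom)] with t ht using good_of_mem_dom h.right ht
  · filter_upwards [(tendsto_sub_mul β (e.r B β)).eventually
      ((family h.left).isOpen.mem_nhds h.symm.mem_dom)] with t ht
      using (good_of_mem_dom h.left ht).symm

theorem ABS.Good.flow_cv {e : ABS} {A B : ℂ → ℂ} {α β : ℂ} (h : e.Good A B α β) (d d' : Dir)
    (j : Fin 6) : HasDerivAt
      (fun t => e.cv A B (e.flow d A B α β t).1 (e.flow d A B α β t).2 d' j)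
      (if d' = d then -bqDelta (e.cv A B α β d) j else 0) 0 := by
  cases d <;> cases d'
  · exact (family h.right).curve_c h.mem_dom j
  · simpa [ABS.flow, cv, Dir.pick] using! hasDerivAt_const (0 : ℂ) (e.coefC B β j)
  · simpa [ABS.flow, cv, Dir.pick] using! hasDerivAt_const (0 : ℂ) (e.coefC A α j)
  · exact (family h.left).curve_c h.symm.mem_dom j

/-- This is the tangency of V to the solutions, in either direction; `a'` is the velocity of the
coefficients along the flow of the parameter. For direction m the equation is read with exchanged
axes, and the sign of `ABS.coefA_swap` drops out because its square is 1. -/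
theorem ABS.Good.flow_coefA {e : ABS} {A B : ℂ → ℂ} {α β : ℂ} (h : e.Good A B α β) (d : Dir) :
    ∃ a' : Fin 7 → ℂ, (∀ k, HasDerivAt
      (fun t => e.coefA A B (e.flow d A B α β t).1 (e.flow d A B α β t).2 k) (a' k) 0) ∧
      ∀ u : ℤ × ℤ → ℂ, (∀ j, Reg (row (fun p => u (d.tr p)) j)) →
        ∀ q, sqv (e.coefA A B α β) u q = 0 →
        sqv (e.coefA A B α β) u (q - d.vec) = 0 → sqv (e.coefA A B α β) u (q + d.vec) = 0 →
        sqv a' u q + sqd (e.coefA A B α β) u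
          (fun p => d.coord p * ev (e.cv A B α β) u (shiftHom p (R2 d))) q = 0 := by
  obtain ⟨r, c, a', hd, hc, hr⟩ : ∃ (r : ℂ) (c : Fin 6 → ℂ) (a' : Fin 7 → ℂ),
      (∀ k, HasDerivAt (fun t => e.coefD d A B (e.flow d A B α β t).1 (e.flow d A B α β t).2 k)
        (-r * a' k) 0) ∧ Compatible (e.coefD d A B α β) a' c r ∧ c = e.cv A B α β d := by
    cases d
    · obtain ⟨a', h1, h2⟩ := (family h.right).deriv_a α h.mem_dom
      exact ⟨_, _, a', fun k => curve_a (h1 k), h2, rfl⟩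
    · obtain ⟨a', h1, h2⟩ := (family h.left).deriv_a β h.symm.mem_dom
      exact ⟨_, _, a', fun k => curve_a (h1 k), h2, rfl⟩
  refine ⟨fun k => d.pick (-r * a' k) (e.sgn * aSwap (fun k => -r * a' k) k), fun k => ?_, ?_⟩
  · cases d
    · exact hd k
    · have : ∀ α β : ℂ, e.coefA A B α β k = e.sgn * aSwap (e.coefA B A β α) k := fun α β =>
        e.coefA_swap B A β α k
      simp only [this]
      refine HasDerivAt.const_mul _ ?_
      fin_cases k <;> exact hd _
  · intro u hu q h0 h1 h2
    have h3 := sqd_extended hc (hu (d.tr q).2) (hu ((d.tr q).2 + 1))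
      (i := (d.tr q).1) (j := (d.tr q).2) ?_ ?_ ?_
    · have h4 := e.sqd_coefD d A B α β u
        (fun p => d.coord p * ev (e.cv A B α β) u (shiftHom p (R2 d))) q
      simp only [ev_shift_inc, Dir.tr_tr, ← Dir.tr_fst, ← hr] at h4 ⊢
      rw [h4] at h3
      refine (mul_eq_zero.1 (?_ : e.sgnD d * _ = 0)).resolve_left (e.sgnD_ne_zero d)
      rw [mul_add, h3]
      cases d
      · simp only [ABS.sgnD, Dir.pick, sqv_smul, Dir.tr, Prod.mk.eta]
        ring
      · have : ∀ b : Fin 7 → ℂ, sqv (aSwap b) u q = sqv b (fun p => u p.swap) q.swap := fun b =>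
          (sqv_aSwap b (fun p => u p.swap) q.swap).symm ▸ by simp
        simp only [Dir.pick, sqv_smul, this, Dir.tr, ABS.sgnD]
        change _ + r * sqv a' (fun p => u p.swap) q.swap = 0
        linear_combination (-r * sqv a' (fun p => u p.swap) q.swap) * e.sgn_mul_self
    · rw [Prod.mk.eta, e.sqv_coefD, h0, mul_zero]
    · have : ((d.tr q).1 - 1, (d.tr q).2) = d.tr (q - d.vec) := by
        cases d <;> simp [Dir.tr, Dir.vec, Dir.pick, Prod.ext_iff]
      rw [this, e.sqv_coefD, h1, mul_zero]
    · have : ((d.tr q).1 + 1, (d.tr q).2) = d.tr (q + d.vec) := by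
        cases d <;> simp [Dir.tr, Dir.vec, Dir.pick, Prod.ext_iff]
      rw [this, e.sqv_coefD, h2, mul_zero]

/-! ### Functions vanishing on the solutions -/

/-- `P` vanishes on the solutions of the equation, for all parameters. -/
def ABS.ShellVanish (e : ABS) (P : L2) : Prop :=
  ∃ N : ℤ, ∀ (A B : ℂ → ℂ) (α β : ℂ), e.Good A B α β → ∀ u : ℤ × ℤ → ℂ, RegAll Dir u →
    (∀ i j : ℤ, |i| ≤ N → |j| ≤ N →
      sqv (e.coefA A B α β) u (i, j) = 0 ∧ sqy (e.coefA A B α β) u (i, j) ≠ 0) →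
    ev (e.cv A B α β) u P = 0

theorem ABS.ShellVanish.zero (e : ABS) : e.ShellVanish 0 := ⟨0, by simp⟩

theorem ABS.ShellVanish.neg {e : ABS} {P : L2} (hP : e.ShellVanish P) : e.ShellVanish (-P) := by
  obtain ⟨N, hN⟩ := hP
  exact ⟨N, fun A B α β h u hu hs => by rw [map_neg, hN A B α β h u hu hs, neg_zero]⟩

theorem ABS.ShellVanish.add {e : ABS} {P Q : L2} (hP : e.ShellVanish P) (hQ : e.ShellVanish Q) :
    e.ShellVanish (P + Q) := by
  obtain ⟨N, hN⟩ := hP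
  obtain ⟨M, hM⟩ := hQ
  refine ⟨max N M, fun A B α β h u hu hs => ?_⟩
  rw [map_add, hN A B α β h u hu fun i j hi hj =>
    hs i j (hi.trans (le_max_left _ _)) (hj.trans (le_max_left _ _)),
    hM A B α β h u hu fun i j hi hj =>
    hs i j (hi.trans (le_max_right _ _)) (hj.trans (le_max_right _ _)), add_zero]

theorem ABS.ShellVanish.mul_left {e : ABS} {P : L2} (hP : e.ShellVanish P) (Q : L2) :
    e.ShellVanish (Q * P) := by
  obtain ⟨N, hN⟩ := hP
  exact ⟨N, fun A B α β h u hu hs => by rw [map_mul, hN A B α β h u hu hs, mul_zero]⟩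

theorem ABS.ShellVanish.sum {e : ABS} {ι : Type} (s : Finset ι) {P : ι → L2}
    (hP : ∀ i ∈ s, e.ShellVanish (P i)) : e.ShellVanish (∑ i ∈ s, P i) :=
  Finset.sum_induction _ _ (fun _ _ => ShellVanish.add) (ShellVanish.zero e) hP

theorem ABS.ShellVanish.shift {e : ABS} {P : L2} (hP : e.ShellVanish P) (s : ℤ × ℤ) :
    e.ShellVanish (shiftHom s P) := by
  obtain ⟨N, hN⟩ := hP
  refine ⟨N + |s.1| + |s.2|, fun A B α β h u hu hs => ?_⟩
  rw [ev_shiftHom]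
  refine hN A B α β h _ (hu.shift s) fun i j hi hj => ?_
  have := hs (i + s.1) (j + s.2)
    (by have := abs_add_le i s.1; have := abs_nonneg s.2; linarith)
    (by have := abs_add_le j s.2; have := abs_nonneg s.1; linarith)
  simpa only [sqv, sqy, Prod.mk_add_mk, add_zero, add_right_comm _ (1 : ℤ),
    show ∀ i j : ℤ, (i, j) + s = (i + s.1, j + s.2) from fun i j => rfl] using this

/-- As V is tangent to the solutions, a block of a solution can be moved along a curve of solutions
with tangent V, the parameter included. P vanishes along the curve, and its derivative there is
`recD2 d P`. The parameter moves, so vanishing at all nondegenerate parameters is needed. -/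
theorem ABS.ShellVanish.recD2 {e : ABS} {P : L2} (hP : e.ShellVanish P) (d : Dir) :
    e.ShellVanish (recD2 d P) := by
  obtain ⟨N, hN⟩ := hP
  obtain ⟨T, hT⟩ := exists_goodDer_eq_sum P
  -- The block has to contain both the squares on which P is known to vanish and all values on which
  -- P depends.
  obtain ⟨M, hM, hTM⟩ : ∃ M : ℤ, N ≤ M ∧
      T ⊆ Finset.Icc (-M) (M + 1) ×ˢ Finset.Icc (-M) (M + 1) := by
    refine ⟨max N (∑ q ∈ T, (|q.1| + |q.2|)), le_max_left _ _, fun q hq => ?_⟩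
    have h1 := Finset.single_le_sum (f := fun q : ℤ × ℤ => |q.1| + |q.2|)
      (fun _ _ => add_nonneg (abs_nonneg _) (abs_nonneg _)) hq
    have h2 := le_max_right N (∑ q ∈ T, (|q.1| + |q.2|))
    have h3 := abs_nonneg q.1
    have h4 := abs_nonneg q.2
    have h5 := abs_le.1 (le_refl |q.1|)
    have h6 := abs_le.1 (le_refl |q.2|)
    simp only [Finset.mem_product, Finset.mem_Icc] at h1 ⊢
    omega
  refine ⟨M + 1, fun A B α β h u hu hs => ?_⟩
  obtain ⟨a', ha', hV⟩ := h.flow_coefA d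
  obtain ⟨w, hw0, hw, hw', hwQ⟩ := exists_tangent_curve ha' u
    (fun p => d.coord p * ev (e.cv A B α β) u (shiftHom p (R2 d))) (-M) (M + 1) (-M) (M + 1) (by
      intro i j h1 h2 h3 h4
      simp only [flow_zero]
      have h5 := hs i j (by rw [abs_le]; omega) (by rw [abs_le]; omega)
      refine ⟨h5.1, h5.2, hV u (hu.row d) (i, j) h5.1 ?_ ?_⟩
      · cases d
        · simpa [Dir.vec, Dir.pick] using
            (hs (i - 1) j (by rw [abs_le]; omega) (by rw [abs_le]; omega)).1
        · simpa [Dir.vec, Dir.pick] using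
            (hs i (j - 1) (by rw [abs_le]; omega) (by rw [abs_le]; omega)).1
      · cases d
        · simpa [Dir.vec, Dir.pick] using
            (hs (i + 1) j (by rw [abs_le]; omega) (by rw [abs_le]; omega)).1
        · simpa [Dir.vec, Dir.pick] using
            (hs i (j + 1) (by rw [abs_le]; omega) (by rw [abs_le]; omega)).1)
  have hP0 : ∀ q ∉ Finset.Icc (-M) (M + 1) ×ˢ Finset.Icc (-M) (M + 1), pd q P = 0 := by
    intro q hq
    rw [pd, hT _ hTM]
    simp only [Pi.zero_apply, zero_mul, Finset.sum_const_zero, add_zero]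
    refine Finset.sum_eq_zero fun p hp => ?_
    rw [if_neg, zero_mul]
    rintro rfl
    exact hq hp
  have hd := hasDerivAt_ev_window (t₀ := 0) (w := w)
    (cv := fun t => e.cv A B (e.flow d A B α β t).1 (e.flow d A B α β t).2)
    (cc := fun d' j => if d' = d then -bqDelta (gc d) j else 0)
    (xx := fun q => C (d.coord q : ℂ) * shiftHom q (R2 d)) (P := P)
    (B := Finset.Icc (-M) (M + 1) ×ˢ Finset.Icc (-M) (M + 1)) ?_ ?_ ?_ ?_ hP0
  · simp only [flow_zero, hw0] at hd
    refine hd.unique ((hasDerivAt_const (0 : ℂ) (0 : ℂ)).congr_of_eventuallyEq ?_)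
    have hreg : ∀ᶠ t in 𝓝 0, RegAll Dir (w t) :=
      RegAll.eventually_curve (by rwa [hw0]) (fun q hq => (hw q hq).continuousAt)
        fun q hq t => by rw [hw' q hq, hw0]
    have hy : ∀ᶠ t in 𝓝 (0 : ℂ), ∀ q ∈ Finset.Icc (-M) M ×ˢ Finset.Icc (-M) M,
        sqy (e.coefA A B (e.flow d A B α β t).1 (e.flow d A B α β t).2) (w t) q ≠ 0 := by
      rw [eventually_all_finset]
      rintro ⟨i, j⟩ hq
      simp only [Finset.mem_product, Finset.mem_Icc] at hq
      have hc := fun p hp => hw p (corners_subset (i := i) (j := j) (by omega) (by omega)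
        (by omega) (by omega) p hp)
      have := (hasDerivAt_aqy ha' (hc (i, j) (by simp [corners]))
        (hc ((i, j) + (1, 0)) (by simp [corners])) (hc ((i, j) + (1, 1))
        (by simp [corners]))).continuousAt.eventually_ne (y := 0)
      refine this ?_
      simp only [flow_zero, hw0]
      exact (hs i j (by rw [abs_le]; omega) (by rw [abs_le]; omega)).2
    filter_upwards [h.flow d, hreg, hy, hwQ] with t h1 h2 h3 h4
    refine hN _ _ _ _ h1 _ h2 fun i j hi hj => ⟨?_, h3 (i, j) ?_⟩
    · rw [abs_le] at hi hj
      exact h4 i j (by omega) (by omega) (by omega) (by omega)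
    · rw [abs_le] at hi hj
      simp only [Finset.mem_product, Finset.mem_Icc]; omega
  · intro d' j
    refine (h.flow_cv d d' j).congr_deriv ?_
    simp only [flow_zero]
    split_ifs
    · fin_cases j <;> simp [bqDelta]
    · simp
  · intro q hq
    simp only [flow_zero, hw0]
    simpa using hw q hq
  · intro q hq t
    rw [hw' q hq, hw0]
  · rwa [hw0]

theorem ABS.shellVanish_br (e : ABS) : e.ShellVanish (br (R2 .n) (R2 .m)) := by
  refine ⟨1, fun A B α β h u hu hs => ?_⟩
  refine ev_br_R2 h.kappa (fun j => aDisc_coefA h.left h.right h.ne j) (fun j => ?_) hu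
    (hs 0 0 (by simp) (by simp)).1 (hs (-1) 0 (by simp) (by simp)).1
    (hs 0 (-1) (by simp) (by simp)).1 (hs (-1) (-1) (by simp) (by simp)).1
  rw [← aDisc_coefA_swap, aDisc_coefA h.right h.left h.ne.symm, kappa_swap h.left h.right h.ne]
  rfl

/-- By the Jacobi identity `br_recD2_R2`, the new bracket is `recD2` of the old one plus a
combination of its translates, and all of these vanish on solutions. -/
theorem ABS.ShellVanish.br_recD2 {e : ABS} {d : Dir} {F : L2} (hF : ABSLattice.recD2 d F = 0)
    (h : e.ShellVanish (br (R2 d) F)) : e.ShellVanish (br (ABSLattice.recD2 d (R2 d)) F) := by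
  rw [br_recD2_R2 d hF]
  refine (h.recD2 d).add ?_
  obtain ⟨T, hT⟩ := exists_goodDer_eq_sum (R2 d)
  rw [hT T subset_rfl]
  simp only [Pi.zero_apply, zero_mul, Finset.sum_const_zero, add_zero]
  refine ShellVanish.sum _ fun q _ => ?_
  rw [mul_comm]
  exact ((h.shift q).mul_left _).mul_left _

theorem ABS.ShellVanish.br_comm {e : ABS} {F H : L2} (h : e.ShellVanish (br F H)) :
    e.ShellVanish (br H F) := by
  rw [br_swap]; exact h.neg

/-- The first two members of the hierarchies of the two directions commute on the solutions. -/
theorem ABS.shellVanish_br_Rk (e : ABS) {d d' : Dir} (hd : d ≠ d') {k l : ℕ} (hk : k ≤ 1)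
    (hl : l ≤ 1) : e.ShellVanish (br (inc d (Rk k)) (inc d' (Rk l))) := by
  have h0 : ∀ d d' : Dir, d ≠ d' → e.ShellVanish (br (R2 d) (R2 d')) := by
    rintro (_ | _) (_ | _) h
    · exact absurd rfl h
    · exact e.shellVanish_br
    · exact e.shellVanish_br.br_comm
    · exact absurd rfl h
  have h1 : ∀ d d' : Dir, d ≠ d' → e.ShellVanish (br (inc d (Rk 1)) (R2 d')) := by
    intro d d' h
    have := (h0 d d' h).br_recD2 (recD2_inc_of_ne h.symm ABSLattice.R0)
    rwa [recD2_inc] at this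
  obtain rfl | rfl : k = 0 ∨ k = 1 := by omega
  all_goals obtain rfl | rfl : l = 0 ∨ l = 1 := by omega
  · exact h0 d d' hd
  · exact (h1 d' d hd.symm).br_comm
  · exact h1 d d' hd
  -- The first member of the other direction is also annihilated by `recD2 d`, so the argument
  -- applies once more.
  · have := (h1 d' d hd.symm).br_comm.br_recD2 (recD2_inc_of_ne hd.symm (Rk 1))
    rwa [recD2_inc] at this

/-! ### Lattice functions represented by elements of a difference algebra -/

section Representation

variable {G D : Type} [AddCommGroup G] [Directions G D] [DecidableEq G] [DecidableEq D] [Fintype D]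

theorem ev_goodDer {P : LAlg G D} {T : Finset G} (hT : ∀ cc xx, goodDer cc xx P =
      ∑ q ∈ T, xx q * pd q P + ∑ k : D × Fin 6, cc k.1 k.2 * pc k P) (cv : D → Fin 6 → ℂ)
    (u : G → ℂ) (cc : D → Fin 6 → LAlg G D) (xx : G → LAlg G D) : ev cv u (goodDer cc xx P) =
      ∑ q ∈ T, ev cv u (xx q) * ev cv u (pd q P)
        + ∑ k : D × Fin 6, ev cv u (cc k.1 k.2) * ev cv u (pc k P) := by
  rw [hT]; simp

/-- The lattice function `F` is given by the elements `P p`, at the points of a sublattice. -/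
def ABS.Rep (e : ABS) (A B : ℂ → ℂ) (φ : G →+ ℤ × ℤ) (ι : D → Dir) (F : LatFun)
    (P : ℤ × ℤ → LAlg G D) : Prop :=
  ∀ α β, e.Admissible A α → e.Admissible B β → ∀ p (u : Conf), RegAll D (fun g => u (φ g)) →
    F p u α β = ev (fun d => e.cv A B α β (ι d)) (fun g => u (φ g)) (P p)

variable {e : ABS} {A B : ℂ → ℂ} {φ : G →+ ℤ × ℤ} {ι : D → Dir} {F H : LatFun}
  {P Q : ℤ × ℤ → LAlg G D}

theorem ABS.Rep.shift (hF : e.Rep A B φ ι F P) (g : G) :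
    e.Rep A B φ ι (shift (φ g) F) fun p => shiftHom g (P (p + φ g)) := by
  intro α β hα hβ p u hu
  rw [ev_shiftHom]
  have := hF α β hα hβ (p + φ g) (fun q => u (q + φ g)) (by simpa using hu.shift g)
  simp only [← map_add] at this ⊢
  exact this

theorem ABS.Rep.dU (hF : e.Rep A B φ ι F P) (hφ : Function.Injective φ) (g : G) :
    e.Rep A B φ ι (dU (φ g) F) fun p => pd g (P p) := by
  intro α β hα hβ p u hu
  refine ((hasDerivAt_ev_update hu _ g (P p)).congr_of_eventuallyEq ?_).deriv
  filter_upwards [hu.eventually_update g] with t ht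
  have : (fun h => Function.update u (φ g) t (φ h)) =
      Function.update (fun h => u (φ h)) g t :=
    Function.update_comp_eq_of_injective u hφ g t
  rw [hF α β hα hβ p _ (by rwa [this]), this]

theorem ABS.Rep.dU_eq_zero (hF : e.Rep A B φ ι F P) {q : ℤ × ℤ} (hq : ∀ g, φ g ≠ q) {α β : ℂ}
    (hα : e.Admissible A α) (hβ : e.Admissible B β) (p : ℤ × ℤ) {u : Conf}
    (hu : RegAll D (fun g => u (φ g))) : ABSLattice.dU q F p u α β = 0 := by
  have : ∀ t, (fun h => Function.update u q t (φ h)) = fun h => u (φ h) := fun t => by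
    funext h; rw [Function.update_of_ne (hq h)]
  have h : ∀ t, F p (Function.update u q t) α β = F p u α β := fun t => by
    rw [hF α β hα hβ p u hu, hF α β hα hβ p _ (by rwa [this]), this]
  simp only [ABSLattice.dU, h, deriv_const]

/-- The factor r is kept because r times the velocity of the coefficients is `bqDelta`, polynomial
in them. The relation therefore also covers r = 0. -/
theorem ABS.Rep.dAlpha (hF : e.Rep A B φ ι F P) {α β : ℂ} (hα : e.Admissible A α)
    (hβ : e.Admissible B β) (p : ℤ × ℤ) {u : Conf} (hu : RegAll D (fun g => u (φ g))) :
    e.r A α * ABSLattice.dAlpha F p u α β =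
      ev (fun d => e.cv A B α β (ι d)) (fun g => u (φ g))
        (goodDer (fun d j => if ι d = .n then bqDelta (gc d) j else 0) 0 (P p)) := by
  choose c' hc' hr using fun j => hasDerivAt_coefC hα j
  have hd := hasDerivAt_ev (cv := fun t d => e.cv A B t β (ι d)) (u := fun _ g => u (φ g))
    (t₀ := α) (cc := fun d j => if ι d = .n then C (c' j) else 0) (xx := 0) ?_
    (fun q => by simpa using hasDerivAt_const _ _) hu (P p)
  · have := hd.congr_of_eventuallyEq (hα.eventually.mono fun t ht => hF t β ht hβ p u hu)
    rw [ABSLattice.dAlpha, this.deriv]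
    obtain ⟨T, hT⟩ := exists_goodDer_eq_sum (P p)
    rw [ev_goodDer (hT T subset_rfl), ev_goodDer (hT T subset_rfl), mul_add, Finset.mul_sum,
      Finset.mul_sum]
    congr 1
    · exact Finset.sum_congr rfl fun q _ => by simp
    · refine Finset.sum_congr rfl fun k _ => ?_
      split_ifs with h
      · rw [ev_C, ← mul_assoc, hr, show e.coefC A α = e.cv A B α β (ι k.1) by rw [h]; rfl]
        congr 1
        generalize k.2 = j
        fin_cases j <;> simp [bqDelta]
      · simp
  · intro d j
    cases h : ι d
    · simpa [cv, Dir.pick] using hc' j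
    · simpa [cv, Dir.pick] using hasDerivAt_const _ _

theorem ABS.Rep.dBeta (hF : e.Rep A B φ ι F P) {α β : ℂ} (hα : e.Admissible A α)
    (hβ : e.Admissible B β) (p : ℤ × ℤ) {u : Conf} (hu : RegAll D (fun g => u (φ g))) :
    e.r B β * ABSLattice.dBeta F p u α β =
      ev (fun d => e.cv A B α β (ι d)) (fun g => u (φ g))
        (goodDer (fun d j => if ι d = .m then bqDelta (gc d) j else 0) 0 (P p)) := by
  choose c' hc' hr using fun j => hasDerivAt_coefC hβ j
  have hd := hasDerivAt_ev (cv := fun t d => e.cv A B α t (ι d)) (u := fun _ g => u (φ g))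
    (t₀ := β) (cc := fun d j => if ι d = .m then C (c' j) else 0) (xx := 0) ?_
    (fun q => by simpa using hasDerivAt_const _ _) hu (P p)
  · have := hd.congr_of_eventuallyEq (hβ.eventually.mono fun t ht => hF α t hα ht p u hu)
    rw [ABSLattice.dBeta, this.deriv]
    obtain ⟨T, hT⟩ := exists_goodDer_eq_sum (P p)
    rw [ev_goodDer (hT T subset_rfl), ev_goodDer (hT T subset_rfl), mul_add, Finset.mul_sum,
      Finset.mul_sum]
    congr 1
    · exact Finset.sum_congr rfl fun q _ => by simp
    · refine Finset.sum_congr rfl fun k _ => ?_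
      split_ifs with h
      · rw [ev_C, ← mul_assoc, hr, show e.coefC B β = e.cv A B α β (ι k.1) by rw [h]; rfl]
        congr 1
        generalize k.2 = j
        fin_cases j <;> simp [bqDelta]
      · simp
  · intro d j
    cases h : ι d
    · simpa [cv, Dir.pick] using hasDerivAt_const _ _
    · simpa [cv, Dir.pick] using hc' j

/-- A vector field represented in the difference algebra; `s` gives the multiples of
`-r(α) ∂_α` and `-r(β) ∂_β`. -/
structure ABS.VRep (e : ABS) (A B : ℂ → ℂ) (φ : G →+ ℤ × ℤ) (ι : D → Dir) (v : VField)
    (K : ℤ × ℤ → LAlg G D) (s : Dir → ℂ) : Prop where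
  char : e.Rep A B φ ι v.char K
  xi : v.xi = fun α _ => -(s .n * e.r A α)
  zeta : v.zeta = fun _ β => -(s .m * e.r B β)

/-- The derivation which represents the prolongation of a vector field. -/
def vder (φ : G →+ ℤ × ℤ) (ι : D → Dir) (K : ℤ × ℤ → LAlg G D) (s : Dir → ℂ) (p : ℤ × ℤ) :
    Derivation ℂ (LAlg G D) (LAlg G D) :=
  goodDer (fun d j => -(C (s (ι d)) * bqDelta (gc d) j)) fun g => shiftHom g (K (p + φ g))

/-- The action of the values of `u` in the prolongation of a vector field. -/
theorem ABS.Rep.finsum (hφ : Function.Injective φ)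
    (hF : e.Rep A B φ ι F P) {α β : ℂ} (hα : e.Admissible A α) (hβ : e.Admissible B β) {p : ℤ × ℤ}
    {u : Conf} (hu : RegAll D (fun g => u (φ g))) {T : Finset G} (hT : ∀ g ∉ T, pd g (P p) = 0)
    {k : ℤ × ℤ → ℂ} {xx : G → LAlg G D}
    (hk : ∀ g, k (φ g) = ev (fun d => e.cv A B α β (ι d)) (fun g => u (φ g)) (xx g)) :
    ∑ᶠ q : ℤ × ℤ, k q * ABSLattice.dU q F p u α β =
      ∑ g ∈ T, ev (fun d => e.cv A B α β (ι d)) (fun g => u (φ g)) (xx g) *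
        ev (fun d => e.cv A B α β (ι d)) (fun g => u (φ g)) (pd g (P p)) := by
  rw [finsum_eq_sum_of_support_subset (s := T.map ⟨φ, hφ⟩), Finset.sum_map]
  · refine Finset.sum_congr rfl fun g _ => ?_
    rw [Function.Embedding.coeFn_mk, hk, hF.dU hφ g α β hα hβ p u hu]
  · intro q hq
    by_contra hq'
    apply hq
    by_cases h : ∃ g, φ g = q
    · obtain ⟨g, rfl⟩ := h
      have : g ∉ T := fun hg => hq' (by simpa [hφ.eq_iff] using hg)
      dsimp only
      rw [hF.dU hφ g α β hα hβ p u hu]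
      dsimp only
      rw [hT g this, map_zero, mul_zero]
    · dsimp only
      rw [hF.dU_eq_zero (fun g hg => h ⟨g, hg⟩) hα hβ p hu, mul_zero]

theorem pd_eq_zero_of_sum {P : LAlg G D} {T : Finset G} (hT : ∀ cc xx, goodDer cc xx P =
      ∑ q ∈ T, xx q * pd q P + ∑ k : D × Fin 6, cc k.1 k.2 * pc k P) {g : G} (hg : g ∉ T) :
    pd g P = 0 := by
  rw [pd, hT]
  simp only [Pi.zero_apply, zero_mul, Finset.sum_const_zero, add_zero]
  refine Finset.sum_eq_zero fun p hp => ?_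
  rw [if_neg, zero_mul]
  rintro rfl
  exact hg hp

theorem ABS.VRep.apply {v : VField} {K : ℤ × ℤ → LAlg G D} {s : Dir → ℂ}
    (hv : e.VRep A B φ ι v K s) (hφ : Function.Injective φ) (hF : e.Rep A B φ ι F P) :
    e.Rep A B φ ι (v.apply F) fun p => vder φ ι K s p (P p) := by
  intro α β hα hβ p u hu
  obtain ⟨T, hT'⟩ := exists_goodDer_eq_sum (P p)
  have hT := hT' T subset_rfl
  dsimp only
  rw [VField.apply, hF.finsum hφ hα hβ hu (fun g hg => pd_eq_zero_of_sum hT hg)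
    (k := fun q => shift q v.char p u α β) (xx := fun g => shiftHom g (K (p + φ g)))
    (fun g => hv.char.shift g α β hα hβ p u hu), hv.xi, hv.zeta, vder, ev_goodDer hT]
  have h1 := hF.dAlpha hα hβ p hu
  have h2 := hF.dBeta hα hβ p hu
  rw [ev_goodDer hT] at h1 h2
  simp only [Pi.zero_apply, map_zero, zero_mul, Finset.sum_const_zero, zero_add] at h1 h2
  have h3 : ∑ k : D × Fin 6, ev (fun d => e.cv A B α β (ι d)) (fun g => u (φ g))
        (-(C (s (ι k.1)) * bqDelta (gc k.1) k.2)) *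
        ev (fun d => e.cv A B α β (ι d)) (fun g => u (φ g)) (pc k (P p)) =
      -(s .n * (e.r A α * ABSLattice.dAlpha F p u α β))
        - s .m * (e.r B β * ABSLattice.dBeta F p u α β) := by
    rw [h1, h2, Finset.mul_sum, Finset.mul_sum, ← Finset.sum_neg_distrib, ← Finset.sum_sub_distrib]
    refine Finset.sum_congr rfl fun k _ => ?_
    cases h : ι k.1 <;> simp <;> ring
  rw [h3]
  ring

theorem ABS.VRep.bracket {v w : VField} {K L : ℤ × ℤ → LAlg G D} {s t : Dir → ℂ}
    (hv : e.VRep A B φ ι v K s) (hw : e.VRep A B φ ι w L t) (hφ : Function.Injective φ) :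
    e.Rep A B φ ι (v.bracket w).char fun p => vder φ ι K s p (L p) - vder φ ι L t p (K p) := by
  intro α β hα hβ p u hu
  rw [map_sub, ← hv.apply hφ hw.char α β hα hβ p u hu, ← hw.apply hφ hv.char α β hα hβ p u hu]
  rfl

theorem vder_const (K : LAlg G D) (p : ℤ × ℤ) :
    vder φ ι (fun _ => K) 0 p = evo K := by
  rw [vder, evo]
  congr 1
  funext d j
  simp

theorem ABS.Rep.congr (hF : e.Rep A B φ ι F P)
    (h : ∀ α β, e.Admissible A α → e.Admissible B β → ∀ p (u : G → ℂ), RegAll D u →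
      ev (fun d => e.cv A B α β (ι d)) u (P p) = ev (fun d => e.cv A B α β (ι d)) u (Q p)) :
    e.Rep A B φ ι F Q := fun α β hα hβ p u hu => by
  rw [hF α β hα hβ p u hu, h α β hα hβ p _ hu]

end Representation

/-! ### Vector fields without a parameter part -/

theorem bracket_eq_of_char {v w : VField} (hx : w.xi = fun _ _ => 0) (hz : w.zeta = fun _ _ => 0) :
    ((v.bracket w).xi = fun _ _ => 0) ∧ ((v.bracket w).zeta = fun _ _ => 0) ∧
      ((w.bracket v).xi = fun _ _ => 0) ∧ (w.bracket v).zeta = fun _ _ => 0 := by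
  simp [VField.bracket, hx, hz]

theorem vk_xi_zeta (e : ABS) (A B : ℂ → ℂ) (d : Dir) (k : ℕ) :
    ((e.vk A B d k).xi = fun _ _ => 0) ∧ (e.vk A B d k).zeta = fun _ _ => 0 := by
  induction k with
  | zero => exact ⟨rfl, rfl⟩
  | succ k ih =>
    have := bracket_eq_of_char (v := e.V A B d) ih.1 ih.2
    exact ⟨this.1, this.2.1⟩

/-! ### The basic symmetries -/

theorem hasDerivAt_bq (c : Fin 6 → ℂ) (u x : ℂ) :
    HasDerivAt (fun t => bq c u t) (2 * bqh c u x) x := by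
  have hid := hasDerivAt_id' x
  have hp := hasDerivAt_pow 2 x
  have := (((((hp.const_mul (c 0 * u ^ 2)).add (((hid.const_mul (u ^ 2)).add
    (hp.const_mul u)).const_mul (2 * c 1))).add ((hp.const_add (u ^ 2)).const_mul (c 2))).add
    (hid.const_mul (2 * c 3 * u))).add ((hid.const_add u).const_mul (2 * c 4))).add_const (c 5)
  refine this.congr_deriv ?_
  simp only [bqh]
  push_cast
  ring

theorem ABS.edge_eq (e : ABS) {A B : ℂ → ℂ} {α β : ℂ} (hα : e.Admissible A α)
    (hβ : e.Admissible B β) (d : Dir) (p : ℤ × ℤ) (u : Conf) :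
    e.edge A B d p u α β = bq (e.cv A B α β d) (u 0) (u d.vec) := by
  cases d
  · exact e.f_eq hα _ _
  · exact e.f_eq hβ _ _

theorem Dir.vec_ne_zero (d : Dir) : d.vec ≠ 0 := by cases d <;> simp [Dir.vec, Dir.pick]

theorem ABS.R0_eq (e : ABS) {A B : ℂ → ℂ} {α β : ℂ} (hα : e.Admissible A α)
    (hβ : e.Admissible B β) (d : Dir) (p : ℤ × ℤ) {u : Conf} (hu : u d.vec - u (-d.vec) ≠ 0) :
    e.R0 A B d p u α β = bqp (e.cv A B α β d) (u 0) (u d.vec) (u (-d.vec))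
      / (u d.vec - u (-d.vec)) := by
  have h : dU d.vec (e.edge A B d) p u α β = 2 * bqh (e.cv A B α β d) (u 0) (u d.vec) := by
    rw [dU]
    simp only [e.edge_eq hα hβ, Function.update_self, Function.update_of_ne d.vec_ne_zero.symm]
    exact (hasDerivAt_bq _ _ _).deriv
  rw [ABS.R0, h, e.edge_eq hα hβ, bqp_div _ hu]
  ring

/-- The inclusion of a line. -/
def Dir.line (d : Dir) : ℤ →+ ℤ × ℤ := zmultiplesHom (ℤ × ℤ) d.vec

theorem Dir.line_apply (d : Dir) (l : ℤ) : d.line l = l • d.vec := rfl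

theorem Dir.line_injective (d : Dir) : Function.Injective d.line := fun k l h => by
  simpa [line_apply, -zsmul_eq_mul] using congrArg d.coord h

/-! ### The dependence on finitely many values -/

/-- The elements which involve only the values `x l` with `|l| ≤ N`. -/
def window (N : ℤ) : Subalgebra ℂ L1 :=
  Algebra.adjoin ℂ {P | (∃ j, P = cs j) ∨ (∃ l, |l| ≤ N ∧ P = gx l) ∨
    ∃ l, |l| + 1 ≤ N ∧ P = gw () l}

theorem cs_mem_window (N : ℤ) (j : Fin 6) : cs j ∈ window N :=
  Algebra.subset_adjoin (Or.inl ⟨j, rfl⟩)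

theorem gx_mem_window {N l : ℤ} (h : |l| ≤ N) : (gx l : L1) ∈ window N :=
  Algebra.subset_adjoin (Or.inr (Or.inl ⟨l, h, rfl⟩))

theorem gw_mem_window {N l : ℤ} (h : |l| + 1 ≤ N) : (gw () l : L1) ∈ window N :=
  Algebra.subset_adjoin (Or.inr (Or.inr ⟨l, h, rfl⟩))

theorem C_mem_window (N : ℤ) (a : ℂ) : (C a : L1) ∈ window N := (window N).algebraMap_mem a

theorem window_mono {N M : ℤ} (h : N ≤ M) : window N ≤ window M := by
  refine Algebra.adjoin_mono ?_
  rintro P (⟨j, rfl⟩ | ⟨l, hl, rfl⟩ | ⟨l, hl, rfl⟩)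
  · exact Or.inl ⟨j, rfl⟩
  · exact Or.inr (Or.inl ⟨l, hl.trans h, rfl⟩)
  · exact Or.inr (Or.inr ⟨l, hl.trans h, rfl⟩)

theorem shiftHom_mem_window {N : ℤ} {P : L1} (hP : P ∈ window N) (s : ℤ) :
    shiftHom s P ∈ window (N + |s|) := by
  have : (window N).map (shiftHom s) ≤ window (N + |s|) := by
    rw [window, AlgHom.map_adjoin, Algebra.adjoin_le_iff]
    rintro _ ⟨P, ⟨j, rfl⟩ | ⟨l, hl, rfl⟩ | ⟨l, hl, rfl⟩, rfl⟩
    · simpa using cs_mem_window _ j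
    · simpa using gx_mem_window ((abs_add_le l s).trans (by linarith))
    · have := abs_add_le l s
      simpa using gw_mem_window (l := l + s) (by linarith)
  exact this ⟨P, hP, rfl⟩

theorem R0_mem_window : R0 ∈ window 1 := by
  have h0 : (gx 0 : L1) ∈ window 1 := gx_mem_window (by simp)
  have h1 : (gx 1 : L1) ∈ window 1 := gx_mem_window (by simp)
  have h2 : (gx (-1) : L1) ∈ window 1 := gx_mem_window (by simp)
  have h3 : (gw () 0 : L1) ∈ window 1 := gw_mem_window (by simp)
  have h4 : (2 : L1) ∈ window 1 := by simp
  have hc := cs_mem_window 1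
  unfold R0 bqp
  repeat' first
    | assumption | exact hc _ | apply add_mem | apply pow_mem | apply mul_mem

theorem bqDelta_mem_window (N : ℤ) (j : Fin 6) : bqDelta cs j ∈ window N := by
  have h4 : (2 : L1) ∈ window N := by simp
  have hc := cs_mem_window N
  fin_cases j <;> simp only [bqDelta, Fin.zero_eta, Fin.mk_one, Fin.reduceFinMk, Matrix.cons_val] <;>
  repeat' first
    | assumption | exact hc _ | apply sub_mem | apply pow_mem | apply mul_mem

/-- By the Leibniz rule only generators matter. Their images involve shifts of `R0` by at most N,
and `R0` itself reaches one step further. -/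
theorem recD_mem_window {N : ℤ} {P : L1} (hP : P ∈ window N) : recD P ∈ window (N + 1) := by
  have hs : ∀ l : ℤ, |l| ≤ N → (C (l : ℂ) : L1) * shiftHom l R0 ∈ window (N + 1) := fun l hl =>
    mul_mem (C_mem_window _ _) (window_mono (by linarith) (shiftHom_mem_window R0_mem_window l))
  induction hP using Algebra.adjoin_induction with
  | mem P hP =>
    rcases hP with ⟨j, rfl⟩ | ⟨l, hl, rfl⟩ | ⟨l, hl, rfl⟩
    · simpa [recD] using neg_mem (bqDelta_mem_window _ j)
    · simpa [recD] using hs l hl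
    · have h1 := abs_add_le l 1
      have h2 := abs_sub l 1
      rw [abs_one] at h1 h2
      simp only [recD, goodDer_w]
      exact mul_mem (neg_mem (pow_mem (gw_mem_window (by linarith)) 2))
        (sub_mem (hs _ (by simpa using h1.trans hl)) (hs _ (by simpa using h2.trans hl)))
  | algebraMap a => simp
  | add P Q _ _ hP hQ => rw [map_add]; exact add_mem hP hQ
  | mul P Q hP' hQ' hP hQ =>
    rw [Derivation.leibniz]
    exact add_mem (mul_mem (window_mono (by linarith) hP') hQ)
      (mul_mem (window_mono (by linarith) hQ') hP)

theorem Rk_mem_window (k : ℕ) : Rk k ∈ window (k + 1) := by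
  induction k with
  | zero => simpa using! R0_mem_window
  | succ k ih => exact_mod_cast recD_mem_window ih

/-- Membership in the subalgebra gives equal values for any two functions that agree on the window.
Vanishing partial derivatives would only give local independence. -/
theorem e1_congr_window {N : ℤ} {P : L1} (hP : P ∈ window N) (c : Fin 6 → ℂ) {x y : ℤ → ℂ}
    (h : ∀ l, |l| ≤ N → x l = y l) : e1 c x P = e1 c y P := by
  induction hP using Algebra.adjoin_induction with
  | mem P hP =>
    rcases hP with ⟨j, rfl⟩ | ⟨l, hl, rfl⟩ | ⟨l, hl, rfl⟩
    · simp
    · simpa using h l hl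
    · have h1 := abs_add_le l 1
      have h2 := abs_sub l 1
      rw [abs_one] at h1 h2
      simp [h (l + 1) (h1.trans hl), h (l - 1) (h2.trans hl)]
  | algebraMap a => simp
  | add P Q _ _ hP hQ => rw [map_add, map_add, hP, hQ]
  | mul P Q _ _ hP hQ => rw [map_mul, map_mul, hP, hQ]

/-! ### The hierarchy of one direction -/

theorem reg_line {d : Dir} {u : Conf} (hu : u ∈ regular d) : Reg fun l => u (d.line l) := by
  intro _ l
  have := hu (l • d.vec)
  simpa [Dir.line_apply, add_smul, sub_smul, -zsmul_eq_mul] using this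

section Line

variable {e : ABS} {A B : ℂ → ℂ} {d : Dir}

/-- Representation on a line. -/
abbrev ABS.Rep1 (e : ABS) (A B : ℂ → ℂ) (d : Dir) (F : LatFun) (P : ℤ × ℤ → L1) : Prop :=
  e.Rep A B d.line (fun _ : Unit => d) F P

theorem ABS.rep_R0 : e.Rep1 A B d (e.R0 A B d) fun _ => ABSLattice.R0 := by
  intro α β hα hβ p u hu
  have h := hu.sub_ne
  simp only [Dir.line_apply, one_smul, neg_smul] at h
  rw [e.R0_eq hα hβ d p h]
  have := e1_R0 (e.cv A B α β d) fun l => u (d.line l)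
  simp only [Dir.line_apply, one_smul, neg_smul, zero_smul] at this
  exact this.symm

theorem ABS.vrep_V : e.VRep A B d.line (fun _ : Unit => d) (e.V A B d)
    (fun p => C (d.coord p : ℂ) * ABSLattice.R0) fun d' => if d' = d then 1 else 0 where
  char α β hα hβ p u hu := by
    rw [map_mul, ev_C, ← rep_R0 α β hα hβ p u hu]
    rfl
  xi := by cases d <;> simp [V, Dir.pick]
  zeta := by cases d <;> simp [V, Dir.pick]

theorem vder_V (p : ℤ × ℤ) (P : L1) : vder d.line (fun _ : Unit => d)
    (fun p => C (d.coord p : ℂ) * R0) (fun d' => if d' = d then 1 else 0) p P =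
      recD P + C (d.coord p : ℂ) * evo R0 P := by
  have : vder d.line (fun _ : Unit => d) (fun p => C (d.coord p : ℂ) * R0)
      (fun d' => if d' = d then 1 else 0) p = recD + (C (d.coord p : ℂ) : L1) • evo R0 := by
    refine derivation_ext fun g => ?_
    rcases g with ⟨d, j⟩ | q | ⟨d, q⟩
    · simp [vder, recD]
    · simp [vder, recD, Dir.line_apply, coord_add, -zsmul_eq_mul]; ring
    · simp [vder, recD, evo, Dir.line_apply, coord_add, -zsmul_eq_mul]; ring
  rw [this]; rfl

theorem ABS.commutation (e : ABS) {A B : ℂ → ℂ} {α β : ℂ} (hα : e.Admissible A α)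
    (hβ : e.Admissible B β) (d : Dir) (k : ℕ) {x : ℤ → ℂ} (hx : Reg x) :
    e1 (e.cv A B α β d) x (br (Rk k) ABSLattice.R0) = 0 := by
  cases d
  · exact (e.strips_and_commutation k).2 A α hα x hx
  · exact (e.strips_and_commutation k).2 B β hβ x hx

/-- The characteristic of [V, v^{[k]}] is that of `recD (Rk k)` plus n times the commutator with the
basic symmetry. The latter vanishes by `ABS.commutation`, so no explicit n survives and the
hierarchy is generated by the recursion operator. -/
theorem ABS.rep_vk (k : ℕ) : e.Rep1 A B d (e.vk A B d k).char fun _ => Rk k := by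
  induction k with
  | zero => exact rep_R0
  | succ k ih =>
    have hk : e.VRep A B d.line (fun _ : Unit => d) (e.vk A B d k) (fun _ => Rk k) 0 :=
      ⟨ih, by simp [(vk_xi_zeta e A B d k).1], by simp [(vk_xi_zeta e A B d k).2]⟩
    refine (vrep_V.bracket hk d.line_injective).congr fun α β hα hβ p u hu => ?_
    have h := e.commutation hα hβ d k hu
    rw [vder_V, vder_const, Derivation.leibniz, derivation_C, smul_zero, add_zero, smul_eq_mul]
    rw [br, map_sub, sub_eq_zero] at h
    simp only [map_sub, map_add, map_mul, Rk]
    change _ + _ * e1 _ _ _ - _ * e1 _ _ _ = _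
    rw [h]; ring

theorem ABS.vrep_vk (k : ℕ) :
    e.VRep A B d.line (fun _ : Unit => d) (e.vk A B d k) (fun _ => Rk k) 0 :=
  ⟨rep_vk k, by simp [(vk_xi_zeta e A B d k).1], by simp [(vk_xi_zeta e A B d k).2]⟩

theorem ABS.rep_rD {F : LatFun} {P : ℤ × ℤ → L1} (hF : e.Rep1 A B d F P) :
    e.Rep1 A B d (e.rD A B d F) fun p => goodDer (fun _ j => bqDelta cs j) 0 (P p) := by
  intro α β hα hβ p u hu
  cases d
  · exact (hF.dAlpha hα hβ p hu).trans (by simp)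
  · exact (hF.dBeta hα hβ p hu).trans (by simp)

theorem goodDer_neg_left (cc : Unit → Fin 6 → L1) (P : L1) :
    goodDer (fun d j => -cc d j) 0 P = -goodDer cc 0 P := by
  have : goodDer (fun d j => -cc d j) 0 = -goodDer (G := ℤ) cc 0 := by
    refine derivation_ext fun g => ?_
    rcases g with ⟨d, j⟩ | q | ⟨d, q⟩ <;> simp
  rw [this]; rfl

theorem recD_eq (P : L1) : recD P = goodDer 0 (fun l : ℤ => C (l : ℂ) * shiftHom l R0) P
    - goodDer (fun _ j => bqDelta cs j) 0 P := by
  rw [recD, goodDer_split, goodDer_neg_left, sub_eq_add_neg]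

theorem ABS.rep_recOp {F : LatFun} {P : L1} (hF : e.Rep1 A B d F fun _ => P) :
    e.Rep1 A B d (e.recOp A B d F) fun _ => recD P := by
  intro α β hα hβ p u hu
  obtain ⟨T, hT'⟩ := exists_goodDer_eq_sum P
  have hT := hT' T subset_rfl
  have hd : ∀ l : ℤ, dU (l • d.vec) F p u α β =
      ev (fun _ => e.cv A B α β d) (fun g => u (d.line g)) (pd l P) := fun l =>
    hF.dU d.line_injective l α β hα hβ p u hu
  have hs : ∀ l : ℤ, shift (l • d.vec) (e.R0 A B d) p u α β =
      ev (fun _ => e.cv A B α β d) (fun g => u (d.line g)) (shiftHom l ABSLattice.R0) := fun l =>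
    rep_R0.shift l α β hα hβ p u hu
  have hD := rep_rD hF α β hα hβ p u hu
  dsimp only at hD ⊢
  rw [recOp, hD, recD_eq, map_sub, finsum_eq_sum_of_support_subset (s := T), 
    goodDer_eq_sum (T := T) fun g hg => pd_eq_zero_of_sum hT hg]
  · simp only [hd, hs]
    simp
  · intro l hl
    by_contra hl'
    apply hl
    dsimp only
    rw [hd, pd_eq_zero_of_sum hT (by simpa using hl'), map_zero, mul_zero]

theorem ABS.rep_iterate (k : ℕ) :
    e.Rep1 A B d ((e.recOp A B d)^[k] (e.R0 A B d)) fun _ => Rk k := by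
  induction k with
  | zero => exact rep_R0
  | succ k ih => rw [Function.iterate_succ_apply']; exact rep_recOp ih

variable {α β : ℂ}

theorem ABS.vk_eq_iterate (hα : e.Admissible A α) (hβ : e.Admissible B β)
    (k : ℕ) : EqAt (regular d) α β (e.vk A B d k)
    (ofChar ((e.recOp A B d)^[k] (e.R0 A B d))) := by
  refine ⟨fun p u hu => ?_, ?_, ?_⟩
  · rw [rep_vk k α β hα hβ p u (reg_line hu)]
    exact (rep_iterate k α β hα hβ p u (reg_line hu)).symm
  · rw [(vk_xi_zeta e A B d k).1]; rfl
  · rw [(vk_xi_zeta e A B d k).2]; rfl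

theorem ABS.vk_congr (hα : e.Admissible A α) (hβ : e.Admissible B β)
    (k : ℕ) (p : ℤ × ℤ) {u w : Conf} (hu : u ∈ regular d) (hw : w ∈ regular d)
    (h : ∀ i : ℤ, |i| ≤ (k : ℤ) + 1 → u (i • d.vec) = w (i • d.vec)) :
    (e.vk A B d k).char p u α β = (e.vk A B d k).char p w α β := by
  rw [rep_vk k α β hα hβ p u (reg_line hu), rep_vk k α β hα hβ p w (reg_line hw)]
  exact e1_congr_window (Rk_mem_window k) _ h

theorem ABS.shift_edge (hα : e.Admissible A α) (hβ : e.Admissible B β)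
    (p : ℤ × ℤ) (u : Conf) (i : ℤ) :
    shift (i • d.vec) (e.edge A B d) p u α β =
      bq (e.cv A B α β d) (u (d.line i)) (u (d.line (i + 1))) := by
  rw [ABSLattice.shift, e.edge_eq hα hβ, Dir.line_apply, Dir.line_apply, add_smul, one_smul,
    zero_add, add_comm d.vec]

/-- By `pd_Rk_top` and `pd_Rk_bot` the outermost derivatives are, up to sign, factorials times
products of shifts of `rho` or `rhom`, whose numerators are, up to sign, the values of f on
consecutive edges. -/
theorem ABS.dU_vk_ne (hα : e.Admissible A α) (hβ : e.Admissible B β)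
    (k : ℕ) (p : ℤ × ℤ) {u : Conf} (hu : u ∈ regular d)
    (h : ∀ i : ℤ, shift (i • d.vec) (e.edge A B d) p u α β ≠ 0) :
    dU (((k : ℤ) + 1) • d.vec) (e.vk A B d k).char p u α β ≠ 0 ∧
      dU ((-((k : ℤ) + 1)) • d.vec) (e.vk A B d k).char p u α β ≠ 0 := by
  have hr := reg_line hu
  have hd : ∀ l : ℤ, dU (l • d.vec) (e.vk A B d k).char p u α β =
      e1 (e.cv A B α β d) (fun g => u (d.line g)) (pd l (Rk k)) := fun l =>
    (rep_vk k).dU d.line_injective l α β hα hβ p u hr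
  simp only [shift_edge hα hβ] at h
  have hne : ∀ i : ℤ, u (d.line (i + 1)) - u (d.line (i - 1)) ≠ 0 := fun i =>
    sub_ne_zero.2 (hr.ne i)
  have hk : (k.factorial : ℂ) ≠ 0 := by exact_mod_cast k.factorial_ne_zero
  rw [hd, hd, pd_Rk_top, pd_Rk_bot, rhoProd]
  constructor
  · rw [map_mul, ev_C, map_prod]
    refine mul_ne_zero hk (Finset.prod_ne_zero_iff.2 fun i _ => ?_)
    rw [e1_shift_rho _ hr]
    refine div_ne_zero (neg_ne_zero.2 ?_) (pow_ne_zero 2 (hne i))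
    have := h (i - 1)
    rwa [sub_add_cancel, bq_comm] at this
  · rw [map_mul, ev_C, map_prod]
    refine mul_ne_zero (mul_ne_zero (pow_ne_zero k (by norm_num)) hk)
      (Finset.prod_ne_zero_iff.2 fun i _ => ?_)
    rw [e1_shift_rhom _ hr]
    exact div_ne_zero (h _) (pow_ne_zero 2 (hne _))

theorem ABS.vk_one_eq (hα : e.Admissible A α) (hβ : e.Admissible B β)
    (p : ℤ × ℤ) {u : Conf} (hu : u ∈ regular d) :
    (e.vk A B d 1).char p u α β = shift d.vec (e.R0 A B d) p u α β * dU d.vec (e.R0 A B d) p u α β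
      - shift (-d.vec) (e.R0 A B d) p u α β * dU (-d.vec) (e.R0 A B d) p u α β
      - e.rD A B d (e.R0 A B d) p u α β := by
  have hr := reg_line hu
  have hd : ∀ l : ℤ, dU (l • d.vec) (e.R0 A B d) p u α β =
      e1 (e.cv A B α β d) (fun g => u (d.line g)) (pd l ABSLattice.R0) := fun l =>
    rep_R0.dU d.line_injective l α β hα hβ p u hr
  have hs : ∀ l : ℤ, shift (l • d.vec) (e.R0 A B d) p u α β =
      e1 (e.cv A B α β d) (fun g => u (d.line g)) (shiftHom l ABSLattice.R0) := fun l =>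
    rep_R0.shift l α β hα hβ p u hr
  have d1 := hd 1
  have d2 := hd (-1)
  have s1 := hs 1
  have s2 := hs (-1)
  rw [one_smul] at d1 s1
  rw [neg_smul, one_smul] at d2 s2
  rw [d1, d2, s1, s2, rep_rD rep_R0 α β hα hβ p u hr, rep_vk 1 α β hα hβ p u hr, ← map_mul,
    ← map_mul, ← map_sub]
  change _ = e1 _ _ _ - e1 _ _ _
  rw [← map_sub]
  congr 1
  rw [Rk, Rk, recD_eq, goodDer_eq_sum (T := {1, 0, -1})]
  · simp; ring
  · intro q hq
    simp only [Finset.mem_insert, Finset.mem_singleton, not_or] at hq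
    exact pd_R0 hq.1 hq.2.1 hq.2.2

theorem ABS.vk_one_explicit (hα : e.Admissible A α) (hβ : e.Admissible B β)
    (p : ℤ × ℤ) {u : Conf} (hu : u ∈ regular d) :
    (e.vk A B d 1).char p u α β =
      e.f (d.pick A B) (u 0) (u d.vec) (d.pick α β)
        * e.f (d.pick A B) (u 0) (u (-d.vec)) (d.pick α β)
        * (u ((2 : ℤ) • d.vec) - u ((-2 : ℤ) • d.vec))
      / ((u d.vec - u (-d.vec)) ^ 2 * (u ((2 : ℤ) • d.vec) - u 0)
        * (u ((-2 : ℤ) • d.vec) - u 0)) := by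
  have hr := reg_line hu
  have hf : ∀ x y, e.f (d.pick A B) x y (d.pick α β) = bq (e.cv A B α β d) x y := by
    intro x y
    cases d
    · exact e.f_eq hα _ _
    · exact e.f_eq hβ _ _
  have h := vanish_recD_R0_sub_R1 (fun _ => e.cv A B α β d) _ hr
  rw [map_sub, sub_eq_zero] at h
  have h0 := hr.sub_ne
  have h1 := sub_ne_zero.2 (hr.ne 1)
  have h2 := sub_ne_zero.2 (hr.ne (-1))
  rw [rep_vk 1 α β hα hβ p u hr, hf, hf]
  refine h.trans ((e1_R1 _ _).trans ?_)
  simp only [Dir.line_apply, one_add_one_eq_two, sub_self, neg_add_cancel,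
    show (-1 : ℤ) - 1 = -2 from rfl, zero_smul, one_smul, neg_one_smul] at h0 h1 h2 ⊢
  have h3 : u ((-2 : ℤ) • d.vec) - u 0 ≠ 0 := by rw [← neg_sub]; exact neg_ne_zero.2 h2
  rw [show u 0 - u ((-2 : ℤ) • d.vec) = -(u ((-2 : ℤ) • d.vec) - u 0) by ring]
  field_simp
  ring

end Line

/-! ### The first member of the hierarchy does not vanish -/

theorem finite_quadratic {a b c : ℂ} (h : a ≠ 0 ∨ b ≠ 0 ∨ c ≠ 0) :
    {x : ℂ | a * x ^ 2 + b * x + c = 0}.Finite := by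
  set p : Polynomial ℂ := Polynomial.C a * Polynomial.X ^ 2 + Polynomial.C b * Polynomial.X
    + Polynomial.C c with hp
  have hp0 : p ≠ 0 := by
    intro h0
    have h2 : p.coeff 2 = a := by simp [hp]
    have h1 : p.coeff 1 = b := by simp [hp, Polynomial.coeff_C]
    have h00 : p.coeff 0 = c := by simp [hp, Polynomial.coeff_X]
    rw [h0, Polynomial.coeff_zero] at h2 h1 h00
    rcases h with h | h | h
    · exact h h2.symm
    · exact h h1.symm
    · exact h h00.symm
  refine p.roots.toFinset.finite_toSet.subset fun x hx => ?_
  simp only [Finset.mem_coe, Multiset.mem_toFinset, Polynomial.mem_roots', ne_eq, hp0,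
    not_false_eq_true, true_and, Polynomial.IsRoot.def]
  simpa [hp] using hx

/-- As a polynomial in x, `bq c u x` has three coefficients which are themselves quadratic in u. If
all three vanished for every u, then all six entries of c would be zero. -/
theorem exists_finite_zeros {c : Fin 6 → ℂ} (hc : c ≠ 0) :
    ∃ u : ℂ, {x : ℂ | bq c u x = 0}.Finite := by
  have h : ∃ u : ℂ, (c 0 * u ^ 2 + 2 * c 1 * u + c 2 ≠ 0) ∨
      (2 * c 1 * u ^ 2 + 2 * c 3 * u + 2 * c 4 ≠ 0) ∨ (c 2 * u ^ 2 + 2 * c 4 * u + c 5 ≠ 0) := by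
    by_contra! h
    have key : ∀ a b d : ℂ, (∀ u : ℂ, a * u ^ 2 + b * u + d = 0) → a = 0 ∧ b = 0 ∧ d = 0 := by
      intro a b d h
      by_contra h'
      refine (finite_quadratic (a := a) (b := b) (c := d) (by tauto)).not_infinite ?_
      rw [Set.eq_univ_of_forall (s := {x : ℂ | a * x ^ 2 + b * x + d = 0}) h]
      exact Set.infinite_univ
    obtain ⟨a1, a2, a3⟩ := key _ _ _ fun u => (h u).1
    obtain ⟨b1, b2, b3⟩ := key _ _ _ fun u => (h u).2.1
    obtain ⟨c1, c2, c3⟩ := key _ _ _ fun u => (h u).2.2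
    refine hc (_root_.funext fun j => ?_)
    fin_cases j
    exacts [a1, (mul_eq_zero.1 a2).resolve_left two_ne_zero, a3,
      (mul_eq_zero.1 b2).resolve_left two_ne_zero, (mul_eq_zero.1 b3).resolve_left two_ne_zero, c3]
  obtain ⟨u, hu⟩ := h
  refine ⟨u, (finite_quadratic hu).subset fun x hx => ?_⟩
  rw [Set.mem_ofPred_eq] at hx ⊢
  rw [← hx, bq]
  ring

theorem exists_reg_ne {c : Fin 6 → ℂ} (hc : c ≠ 0) : ∃ x : ℤ → ℂ, Reg x ∧ bq c (x 0) (x 1) ≠ 0 ∧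
    bq c (x 0) (x (-1)) ≠ 0 ∧ x 2 ≠ x (-2) := by
  obtain ⟨u, hu⟩ := exists_finite_zeros hc
  obtain ⟨y, hy⟩ := (hu.union (Set.finite_singleton u)).exists_notMem
  obtain ⟨z, hz⟩ := ((hu.union (Set.finite_singleton u)).union
    (Set.finite_singleton y)).exists_notMem
  simp only [Set.mem_union, Set.mem_ofPred_eq, Set.mem_singleton_iff, not_or] at hy hz
  -- The profile on -2, …, 2 is z, z, u, y, y, with y and z different from each other, from u and
  -- from the zeros of f(u, ·). It makes every factor of the explicit first member nonzero.
  obtain ⟨x, hx, hx'⟩ := exists_regAll (D := Unit) (Finset.Icc (-2 : ℤ) 2)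
    (fun l => if l = 0 then u else if 0 < l then y else z) (by
      intro _ l h1 h2
      simp only [vec_unit, Finset.mem_Icc] at h1 h2
      obtain rfl | rfl | rfl : l = -1 ∨ l = 0 ∨ l = 1 := by omega
      · simpa using fun h => hz.1.2 h.symm
      · simpa using fun h => hz.2 h.symm
      · simpa using hy.2)
  refine ⟨x, hx, ?_, ?_, ?_⟩
  · rw [hx' 0 (by simp), hx' 1 (by simp)]; simpa using hy.1
  · rw [hx' 0 (by simp), hx' (-1) (by simp)]; simpa using hz.1.1
  · rw [hx' 2 (by simp), hx' (-2) (by simp)]; simpa using fun h => hz.2 h.symm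

section

variable {e : ABS} {A B : ℂ → ℂ} {d : Dir} {α β : ℂ}

theorem ABS.cv_ne_zero (hα : e.Admissible A α) (hβ : e.Admissible B β) (d : Dir) :
    e.cv A B α β d ≠ 0 := by
  cases d
  · exact coefC_ne_zero hα
  · exact coefC_ne_zero hβ

theorem ABS.exists_vk_one_ne (hα : e.Admissible A α) (hβ : e.Admissible B β) (d : Dir) :
    ∃ u ∈ regular d, (e.vk A B d 1).char 0 u α β ≠ 0 := by
  obtain ⟨x, hx, h1, h2, h3⟩ := exists_reg_ne (e.cv_ne_zero hα hβ d)
  -- The function on the line is extended to the plane independently of the other coordinate.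
  have hu : (fun q => x (d.coord q)) ∈ regular d := by
    intro q
    have e1 : d.coord (q + d.vec) = d.coord q + 1 := by
      rw [coord_add]; simpa using coord_smul d 1
    have e2 : d.coord (q - d.vec) = d.coord q - 1 := by
      rw [sub_eq_add_neg, coord_add]
      have := coord_smul d (-1)
      rw [neg_smul, one_smul] at this
      rw [this]; ring
    dsimp only
    rw [e1, e2]
    exact hx.ne _
  refine ⟨_, hu, ?_⟩
  have h0 := hx.sub_ne
  have h4 := sub_ne_zero.2 (hx.ne 1)
  have h5 := sub_ne_zero.2 (hx.ne (-1))
  have h := vanish_recD_R0_sub_R1 (fun _ => e.cv A B α β d) _ (reg_line hu)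
  rw [map_sub, sub_eq_zero] at h
  rw [rep_vk 1 α β hα hβ 0 _ (reg_line hu)]
  refine ((h.trans (e1_R1 _ _)).trans_ne ?_)
  simp only [Dir.line_apply, coord_smul]
  refine neg_ne_zero.2 (mul_ne_zero (mul_ne_zero (mul_ne_zero h1 h2)
    (pow_ne_zero 2 (inv_ne_zero h0))) ?_)
  simp only [one_add_one_eq_two, sub_self, neg_add_cancel, show (-1 : ℤ) - 1 = -2 from rfl]
    at h4 h5
  rw [inv_add_inv h4 h5]
  exact div_ne_zero (by rw [show x 2 - x 0 + (x 0 - x (-2)) = x 2 - x (-2) by ring]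
                        exact sub_ne_zero.2 h3) (mul_ne_zero h4 h5)

theorem ABS.bracket_vk_one (hα : e.Admissible A α) (hβ : e.Admissible B β) (d : Dir) :
    EqAt (regular d) α β ((e.vk A B d 1).bracket (e.vk A B d 0)) (ofChar 0) := by
  have hb := bracket_eq_of_char (v := e.vk A B d 1) (w := e.vk A B d 0) rfl rfl
  refine ⟨fun p u hu => ?_, by rw [hb.1]; rfl, by rw [hb.2.1]; rfl⟩
  rw [(vrep_vk 1).bracket (vrep_vk 0) d.line_injective α β hα hβ p u (reg_line hu)]
  dsimp only
  rw [vder_const, vder_const]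
  exact e.commutation hα hβ d 1 (reg_line hu)

theorem ABS.isMasterSymmetry (hα : e.Admissible A α) (hβ : e.Admissible B β) (d : Dir) :
    IsMasterSymmetry (regular d) α β (e.V A B d) (e.v A B d) := by
  refine ⟨fun h => ?_, bracket_vk_one hα hβ d⟩
  obtain ⟨u, hu, hne⟩ := exists_vk_one_ne hα hβ d
  exact hne (h.1 0 u hu)

/-! ### Symmetries -/

theorem ABS.quad_eq (p : ℤ × ℤ) (u : Conf) :
    e.quad A B p u α β = sqv (e.coefA A B α β) u (0, 0) := by
  rw [quad, e.Q_eq]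
  simp [sqv]

theorem ABS.dU_quad (p : ℤ × ℤ) (u : Conf) (q : ℤ × ℤ) : dU q (e.quad A B) p u α β =
    sqd (e.coefA A B α β) u (Pi.single q 1) (0, 0) := by
  simp only [dU, quad_eq]
  have := hasDerivAt_sqv (a := fun _ => e.coefA A B α β) (a' := 0) (q := (0, 0))
    (w := fun t => Function.update u q t) (U := Pi.single q 1) (t := u q)
    (fun k => hasDerivAt_const _ _) fun p _ => by
      by_cases hp : p = q
      · subst hp; simpa using! hasDerivAt_id _
      · simpa [hp, Function.update_of_ne hp] using hasDerivAt_const _ _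
  rw [this.deriv, Function.update_eq_self]
  simp [sqv, aq, affineQ]

theorem ABS.finsum_dU_quad (p : ℤ × ℤ) (u : Conf) (k : ℤ × ℤ → ℂ) :
    ∑ᶠ q : ℤ × ℤ, k q * dU q (e.quad A B) p u α β = sqd (e.coefA A B α β) u k (0, 0) := by
  rw [finsum_eq_sum_of_support_subset (s := {(0, 0), (1, 0), (0, 1), (1, 1)})]
  · rw [Finset.sum_insert (by simp), Finset.sum_insert (by simp), Finset.sum_insert (by simp),
      Finset.sum_singleton]
    simp only [dU_quad]
    simp [sqd, aqd]
    ring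
  · intro q hq
    by_contra hq'
    apply hq
    simp only [Finset.coe_insert, Finset.coe_singleton, Set.mem_insert_iff, Set.mem_singleton_iff,
      not_or] at hq'
    dsimp only
    rw [dU_quad]
    simp [sqd, aqd, Ne.symm hq'.1, Ne.symm hq'.2.1, Ne.symm hq'.2.2.1,
      Ne.symm hq'.2.2.2]

theorem ABS.mem_solutions {u : Conf} (hu : u ∈ e.solutions A B α β) (s : ℤ × ℤ) :
    sqv (e.coefA A B α β) u s = 0 ∧
      aqx (e.coefA A B α β) (u s) (u (s + (0, 1))) (u (s + (1, 1))) ≠ 0 ∧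
      aqy (e.coefA A B α β) (u s) (u (s + (1, 0))) (u (s + (1, 1))) ≠ 0 ∧
      aqz (e.coefA A B α β) (u s) (u (s + (1, 0))) (u (s + (0, 1))) ≠ 0 := by
  obtain ⟨h1, h2⟩ := hu s
  simp only [shift, quad_eq, dU_quad] at h1 h2
  have hx := h2 (1, 0) (by simp)
  have hy := h2 (0, 1) (by simp)
  have hz := h2 (1, 1) (by simp)
  simp only [sqv, zero_add, Prod.mk_zero_zero] at h1
  simp only [sqd, aqd, Prod.mk_zero_zero, zero_add] at hx hy hz
  simp at hx hy hz
  simp only [sqv, add_comm s]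
  exact ⟨h1, hx, hy, hz⟩

/-- On a solution Q_y Q_z = κ f, and nonsingularity makes the left side nonzero. Hence statements
about solutions are vacuous at the parameters with κ = 0. -/
theorem ABS.good_of_mem_solutions (hα : e.Admissible A α) (hβ : e.Admissible B β) (hαβ : α ≠ β)
    {u : Conf} (hu : u ∈ e.solutions A B α β) : e.Good A B α β := by
  refine ⟨hα, hβ, hαβ, fun h0 => ?_⟩
  obtain ⟨h1, -, h2, h3⟩ := mem_solutions hu 0
  have h := bq_aDisc (e.coefA A B α β) (u 0) (u (0 + (1, 0))) (u (0 + (0, 1))) (u (0 + (1, 1)))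
  rw [bq_mul _ _ _ (aDisc_coefA hα hβ hαβ), h0, zero_mul] at h
  rw [sqv] at h1
  rw [h1, zero_mul, sub_zero] at h
  exact mul_ne_zero h2 h3 h.symm

theorem aqy_aSwap (a : Fin 7 → ℂ) (u x z : ℂ) : aqy (aSwap a) u x z = aqx a u x z := by
  simp [aqy, aqx, aSwap]; ring

theorem ABS.sqy_coefD_ne {u : Conf} (hu : u ∈ e.solutions A B α β) (d : Dir) (q : ℤ × ℤ) :
    sqy (e.coefD d A B α β) (fun p => u (d.tr p)) q ≠ 0 := by
  cases d
  · exact (mem_solutions hu q).2.2.1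
  · have h := (mem_solutions hu q.swap).2.1
    have h2 : ∀ u x z, aqy (e.coefA B A β α) u x z = e.sgn * aqx (e.coefA A B α β) u x z := by
      intro u x z
      rw [← aqy_aSwap]
      simp only [aqy, e.coefA_swap A B α β]; ring
    rcases q with ⟨i, j⟩
    simp only [sqy, coefD, Dir.pick, Dir.tr, h2]
    exact mul_ne_zero e.sgn_ne_zero h

theorem regular_shift {d : Dir} {u : Conf} (hu : u ∈ regular d) (s : ℤ × ℤ) :
    (fun q => u (q + s)) ∈ regular d := fun q => by
  have := hu (q + s)
  rwa [add_right_comm, add_sub_right_comm] at this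

theorem reg_row_of_regular {d : Dir} {u : Conf} (hu : u ∈ regular d) (j : ℤ) :
    Reg (row (fun p => u (d.tr p)) j) := by
  intro _ i
  have := hu (d.tr (i, j))
  cases d <;> simpa [row, Dir.tr, Dir.vec, Dir.pick] using this

theorem ABS.shift_vk (hα : e.Admissible A α) (hβ : e.Admissible B β) {u : Conf}
    (hu : u ∈ regular d) (k : ℕ) (p q : ℤ × ℤ) : shift q (e.vk A B d k).char p u α β =
      ev (e.cv A B α β) u (shiftHom q (inc d (Rk k))) := by
  rw [ABSLattice.shift, rep_vk k α β hα hβ _ _ (reg_line (regular_shift hu q)), ev_shiftHom, ev_inc]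
  rfl

theorem ABS.sqd_vk (h : e.Good A B α β) {u : Conf} (hu : u ∈ regular d)
    (hs : u ∈ e.solutions A B α β) (k : ℕ) : sqd (e.coefA A B α β) u
      (fun q => ev (e.cv A B α β) u (shiftHom q (inc d (Rk k)))) (0, 0) = 0 := by
  have hS : StripSymmetry (e.coefD d A B α β) (e.cv A B α β d) (Rk k) (2 * k + 2) := by
    cases d
    · exact (e.strips_and_commutation k).1 A B α β h.right h.mem_dom
    · exact (e.strips_and_commutation k).1 B A β α h.left h.symm.mem_dom
  have h1 := hS (fun p => u (d.tr p)) (reg_row_of_regular hu 0) (reg_row_of_regular hu 1)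
    fun i _ => ⟨?_, sqy_coefD_ne hs d _⟩
  · refine (mul_eq_zero.1 ?_).resolve_left (e.sgnD_ne_zero d)
    rw [← e.sqd_coefD d]
    simp only [ev_shift_inc, Dir.tr_tr]
    rw [show d.tr (0, 0) = (0, 0) by cases d <;> rfl]
    exact h1
  · have := e.sqv_coefD d A B α β u (d.tr (i, 0))
    rw [Dir.tr_tr] at this
    rw [this, (mem_solutions hs _).1, mul_zero]

theorem ABS.isSymmetry_vk (hα : e.Admissible A α) (hβ : e.Admissible B β) (hαβ : α ≠ β) (d : Dir)
    (k : ℕ) : e.IsSymmetry A B (regular d) α β (e.vk A B d k) := by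
  rintro p u ⟨hs, hu⟩
  rw [VField.apply, finsum_dU_quad, (vk_xi_zeta e A B d k).1, (vk_xi_zeta e A B d k).2]
  simp only [shift_vk hα hβ hu, sqd_vk (good_of_mem_solutions hα hβ hαβ hs) hu hs]
  ring

theorem ABS.Good.deriv_quad (h : e.Good A B α β) {a' : Fin 7 → ℂ} (ha' : ∀ k, HasDerivAt
      (fun t => e.coefA A B (e.flow d A B α β t).1 (e.flow d A B α β t).2 k) (a' k) 0)
    (p : ℤ × ℤ) (u : Conf) : (e.V A B d).xi α β * dAlpha (e.quad A B) p u α β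
      + (e.V A B d).zeta α β * dBeta (e.quad A B) p u α β = sqv a' u (0, 0) := by
  have key : ∀ {a : ℂ → Fin 7 → ℂ} {b : Fin 7 → ℂ} {t : ℂ},
      (∀ k, HasDerivAt (fun s => a s k) (b k) t) →
      deriv (fun s => sqv (a s) u (0, 0)) t = sqv b u (0, 0) := by
    intro a b t hb
    have := hasDerivAt_sqv (w := fun _ => u) (U := 0) (q := (0, 0)) hb
      fun p _ => hasDerivAt_const _ _
    rw [this.deriv]
    simp [sqd, aqd]
  cases d
  · have h1 := hasDerivAt_coefA h.left h.right h.ne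
    have h2 : a' = fun k => -e.r A α * e.coefA' A B α β k := _root_.funext fun k =>
      (ha' k).unique (curve_a (h1 k))
    simp only [dAlpha, dBeta, quad_eq, V, Dir.pick]
    rw [key h1, h2, sqv_smul]
    ring
  · have h1 : ∀ k, HasDerivAt (fun t => e.coefA A B α t k)
        (e.sgn * aSwap (e.coefA' B A β α) k) β := by
      intro k
      have : ∀ t, e.coefA A B α t k = e.sgn * aSwap (e.coefA B A t α) k := fun t =>
        e.coefA_swap B A t α k
      simp only [this]
      refine HasDerivAt.const_mul _ ?_
      fin_cases k <;> exact hasDerivAt_coefA h.right h.left h.ne.symm _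
    have h2 : a' = fun k => -e.r B β * (e.sgn * aSwap (e.coefA' B A β α) k) :=
      _root_.funext fun k => (ha' k).unique (curve_a (a := fun t => e.coefA A B α t)
        (a' := fun k => e.sgn * aSwap (e.coefA' B A β α) k) (s := β) (r := e.r B β) (h1 k))
    simp only [dAlpha, dBeta, quad_eq, V, Dir.pick]
    rw [key h1, h2, sqv_smul (-e.r B β)]
    ring

theorem ABS.isSymmetry_V (hα : e.Admissible A α) (hβ : e.Admissible B β) (hαβ : α ≠ β) (d : Dir) :
    e.IsSymmetry A B (regular d) α β (e.V A B d) := by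
  rintro p u ⟨hs, hu⟩
  have h := good_of_mem_solutions hα hβ hαβ hs
  obtain ⟨a', ha', hV⟩ := h.flow_coefA d
  have h1 := hV u (reg_row_of_regular hu) (0, 0) (mem_solutions hs _).1 (mem_solutions hs _).1
    (mem_solutions hs _).1
  have h2 := sqd_vk h hu hs 0
  -- Additivity of the coordinate splits V at the point p into a multiple of the basic symmetry and
  -- V based at the origin.
  have hk : ∀ q, shift q (e.V A B d).char p u α β =
      d.coord p * ev (e.cv A B α β) u (shiftHom q (inc d (Rk 0)))
        + d.coord q * ev (e.cv A B α β) u (shiftHom q (R2 d)) := by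
    intro q
    have h3 : shift q (e.V A B d).char p u α β =
        (d.coord (p + q) : ℂ) * shift q (e.vk A B d 0).char p u α β := rfl
    rw [h3, shift_vk hα hβ hu, coord_add, Rk]
    push_cast
    ring
  rw [VField.apply, finsum_dU_quad, add_assoc, h.deriv_quad ha']
  simp only [hk]
  rw [sqd_add, sqd_smul, h2, mul_zero, zero_add, add_comm]
  exact h1

/-! ### Commutation relations between the two directions -/

/-- Representation on the plane. -/
abbrev ABS.Rep2 (e : ABS) (A B : ℂ → ℂ) (F : LatFun) (P : ℤ × ℤ → L2) : Prop :=
  e.Rep A B (AddMonoidHom.id (ℤ × ℤ)) id F P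

theorem reg_plane {u : Conf} (hu : u ∈ regular .n ∩ regular .m) : RegAll Dir u := by
  rintro (_ | _) q
  · exact hu.1 q
  · exact hu.2 q

theorem ABS.Rep1.plane {F : LatFun} {P : L1} (hF : e.Rep1 A B d F fun _ => P) :
    e.Rep2 A B F fun _ => inc d P := by
  intro α β hα hβ p u hu
  have hr : Reg fun l => u (d.line l) := by
    have := RegAll.plane hu d 0
    simpa using! this
  rw [hF α β hα hβ p u hr]
  exact (ev_inc _ _ _ _).symm

theorem ABS.vrep2_vk (d : Dir) (k : ℕ) : e.VRep A B (AddMonoidHom.id (ℤ × ℤ)) id (e.vk A B d k)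
    (fun _ => inc d (Rk k)) 0 :=
  ⟨(rep_vk k).plane, (vrep_vk k).xi, (vrep_vk k).zeta⟩

theorem ABS.vrep2_V (d : Dir) : e.VRep A B (AddMonoidHom.id (ℤ × ℤ)) id (e.V A B d)
    (fun p => C (d.coord p : ℂ) * R2 d) fun d' => if d' = d then 1 else 0 where
  char α β hα hβ p u hu := by
    rw [map_mul, ev_C, ← (rep_R0 (d := d)).plane α β hα hβ p u hu]
    rfl
  xi := vrep_V.xi
  zeta := vrep_V.zeta

theorem vder_V2 (p : ℤ × ℤ) (P : L2) : vder (AddMonoidHom.id (ℤ × ℤ)) id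
    (fun p => C (d.coord p : ℂ) * R2 d) (fun d' => if d' = d then 1 else 0) p P =
      recD2 d P + C (d.coord p : ℂ) * evo (R2 d) P := by
  have : vder (AddMonoidHom.id (ℤ × ℤ)) id (fun p => C (d.coord p : ℂ) * R2 d)
      (fun d' => if d' = d then 1 else 0) p = recD2 d + (C (d.coord p : ℂ) : L2) • evo (R2 d) := by
    refine derivation_ext fun g => ?_
    rcases g with ⟨d', j⟩ | q | ⟨d', q⟩
    · by_cases h : d' = d <;> simp [vder, recD2, h]
    · simp [vder, recD2, coord_add]; ring
    · simp [vder, recD2, evo, coord_add]; ring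
  rw [this]; rfl

theorem ABS.rep_bracket_vk (d d' : Dir) (k l : ℕ) :
    e.Rep2 A B ((e.vk A B d k).bracket (e.vk A B d' l)).char
      fun _ => br (inc d (Rk k)) (inc d' (Rk l)) :=
  ((vrep2_vk d k).bracket (vrep2_vk d' l) Function.injective_id).congr
    fun α β _ _ p u _ => by rw [vder_const, vder_const, br]

theorem evo_C_mul_right (F P : L2) (s : ℂ) : evo F (C s * P) = C s * evo F P := by
  rw [Derivation.leibniz, derivation_C, smul_zero, add_zero, smul_eq_mul]

/-- `recD2 d` annihilates the characteristic of the other direction, so only the part proportional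
to the coordinate remains. -/
theorem ABS.rep_bracket_V_vk {d d' : Dir} (h : d' ≠ d) (l : ℕ) :
    e.Rep2 A B ((e.V A B d).bracket (e.vk A B d' l)).char
      fun p => C (d.coord p : ℂ) * br (R2 d) (inc d' (Rk l)) :=
  ((vrep2_V d).bracket (vrep2_vk d' l) Function.injective_id).congr fun α β _ _ p u _ => by
    rw [vder_const, vder_V2, recD2_inc_of_ne h, evo_C_mul_right, br, zero_add, mul_sub]

theorem ABS.rep_bracket_vk_V {d d' : Dir} (h : d' ≠ d) (l : ℕ) :
    e.Rep2 A B ((e.vk A B d' l).bracket (e.V A B d)).char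
      fun p => C (d.coord p : ℂ) * br (inc d' (Rk l)) (R2 d) :=
  ((vrep2_vk d' l).bracket (vrep2_V d) Function.injective_id).congr fun α β _ _ p u _ => by
    rw [vder_const, vder_V2, recD2_inc_of_ne h, evo_C_mul_right, br, zero_add, mul_sub]

theorem ABS.bracket_V_v (hα : e.Admissible A α) (hβ : e.Admissible B β) {d d' : Dir} (h : d' ≠ d) :
    EqAt (regular .n ∩ regular .m) α β ((e.V A B d).bracket (e.v A B d')) (ofChar fun p u α β =>
      (d.coord p : ℂ) * ((e.v A B d).bracket (e.v A B d')).char p u α β) := by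
  have hb := bracket_eq_of_char (v := e.V A B d) (w := e.v A B d') rfl rfl
  refine ⟨fun p u hu => ?_, by rw [hb.1]; rfl, by rw [hb.2.1]; rfl⟩
  have h1 := rep_bracket_V_vk (A := A) (B := B) (e := e) h 0 α β hα hβ p u (reg_plane hu)
  have h2 := rep_bracket_vk (A := A) (B := B) (e := e) d d' 0 0 α β hα hβ p u (reg_plane hu)
  rw [map_mul, ev_C, Rk] at h1
  exact h1.trans (congrArg _ h2.symm)

theorem ABS.isTrivial_of_rep (hα : e.Admissible A α) (hβ : e.Admissible B β) (hαβ : α ≠ β)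
    {w : VField} {P : ℤ × ℤ → L2} (hw : e.Rep2 A B w.char P) (hx : w.xi = fun _ _ => 0)
    (hz : w.zeta = fun _ _ => 0) (hP : ∀ p, e.ShellVanish (P p)) :
    e.IsTrivial A B (regular .n ∩ regular .m) α β w := by
  refine ⟨fun p u hu => ?_, by rw [hx]; rfl, by rw [hz]; rfl⟩
  obtain ⟨N, hN⟩ := hP p
  have h := good_of_mem_solutions hα hβ hαβ hu.1
  rw [hw α β hα hβ p u (reg_plane hu.2)]
  exact hN A B α β h u (reg_plane hu.2) fun i j _ _ =>
    ⟨(mem_solutions hu.1 _).1, (mem_solutions hu.1 _).2.2.1⟩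

theorem ABS.isTrivial_bracket_vk (hα : e.Admissible A α) (hβ : e.Admissible B β) (hαβ : α ≠ β)
    {d d' : Dir} (h : d' ≠ d) {k l : ℕ} (hk : k ≤ 1) (hl : l ≤ 1) :
    e.IsTrivial A B (regular .n ∩ regular .m) α β ((e.vk A B d k).bracket (e.vk A B d' l)) := by
  have hb := bracket_eq_of_char (v := e.vk A B d k) (vk_xi_zeta e A B d' l).1
    (vk_xi_zeta e A B d' l).2
  exact isTrivial_of_rep hα hβ hαβ (rep_bracket_vk d d' k l) hb.1 hb.2.1
    fun _ => e.shellVanish_br_Rk h.symm hk hl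

theorem ABS.isTrivial_bracket_V_vk (hα : e.Admissible A α) (hβ : e.Admissible B β) (hαβ : α ≠ β)
    {d d' : Dir} (h : d' ≠ d) {l : ℕ} (hl : l ≤ 1) :
    e.IsTrivial A B (regular .n ∩ regular .m) α β ((e.V A B d).bracket (e.vk A B d' l)) := by
  have hb := bracket_eq_of_char (v := e.V A B d) (vk_xi_zeta e A B d' l).1
    (vk_xi_zeta e A B d' l).2
  exact isTrivial_of_rep hα hβ hαβ (rep_bracket_V_vk h l) hb.1 hb.2.1
    fun _ => (e.shellVanish_br_Rk (k := 0) h.symm zero_le_one hl).mul_left _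

theorem ABS.isTrivial_bracket_vk_V (hα : e.Admissible A α) (hβ : e.Admissible B β) (hαβ : α ≠ β)
    {d d' : Dir} (h : d' ≠ d) {l : ℕ} (hl : l ≤ 1) :
    e.IsTrivial A B (regular .n ∩ regular .m) α β ((e.vk A B d' l).bracket (e.V A B d)) := by
  have hb := bracket_eq_of_char (v := e.V A B d) (vk_xi_zeta e A B d' l).1
    (vk_xi_zeta e A B d' l).2
  exact isTrivial_of_rep hα hβ hαβ (rep_bracket_vk_V h l) hb.2.2.1 hb.2.2.2
    fun _ => (e.shellVanish_br_Rk (l := 0) h hl zero_le_one).mul_left _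

end

end ABSLattice

end

/-! ### Assembly of the symmetry and commutation statements -/

theorem mainTheorem6 (e : ABSLattice.ABS) (A B : ℂ → ℂ) (α β : ℂ)
    (hα : e.Admissible A α) (hβ : e.Admissible B β) (hαβ : α ≠ β) :
    -- In each of the two directions:
    (∀ d : ABSLattice.Dir,
      -- the extended symmetry, which is a master symmetry
      e.IsSymmetry A B (ABSLattice.regular d) α β (e.V A B d) ∧
      ABSLattice.IsMasterSymmetry (ABSLattice.regular d) α β (e.V A B d) (e.v A B d) ∧
      -- the first member of the hierarchy, in its two explicit forms
      (∀ p, ∀ u ∈ ABSLattice.regular d,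
        (e.vk A B d 1).char p u α β =
            ABSLattice.shift d.vec (e.R0 A B d) p u α β
                * ABSLattice.dU d.vec (e.R0 A B d) p u α β
              - ABSLattice.shift (-d.vec) (e.R0 A B d) p u α β
                * ABSLattice.dU (-d.vec) (e.R0 A B d) p u α β
              - e.rD A B d (e.R0 A B d) p u α β ∧
        (e.vk A B d 1).char p u α β =
            e.f (d.pick A B) (u 0) (u d.vec) (d.pick α β)
              * e.f (d.pick A B) (u 0) (u (-d.vec)) (d.pick α β)
              * (u ((2 : ℤ) • d.vec) - u ((-2 : ℤ) • d.vec))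
            / ((u d.vec - u (-d.vec)) ^ 2 * (u ((2 : ℤ) • d.vec) - u 0)
              * (u ((-2 : ℤ) • d.vec) - u 0))) ∧
      -- all members of the hierarchy
      (∀ k : ℕ,
        e.IsSymmetry A B (ABSLattice.regular d) α β (e.vk A B d k) ∧
        ABSLattice.EqAt (ABSLattice.regular d) α β (e.vk A B d k)
          (ABSLattice.ofChar ((e.recOp A B d)^[k] (e.R0 A B d))) ∧
        -- the characteristic is a function of `2 k + 3` values of `u` ...
        (∀ p, ∀ u ∈ ABSLattice.regular d, ∀ w ∈ ABSLattice.regular d,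
          (∀ i : ℤ, |i| ≤ (k : ℤ) + 1 → u (i • d.vec) = w (i • d.vec)) →
            (e.vk A B d k).char p u α β = (e.vk A B d k).char p w α β) ∧
        -- ... which depends on the two outermost ones
        (∀ p, ∀ u ∈ ABSLattice.regular d,
          (∀ i : ℤ, ABSLattice.shift (i • d.vec) (e.edge A B d) p u α β ≠ 0) →
            ABSLattice.dU (((k : ℤ) + 1) • d.vec) (e.vk A B d k).char p u α β ≠ 0 ∧
            ABSLattice.dU ((-((k : ℤ) + 1)) • d.vec) (e.vk A B d k).char p u α β ≠ 0)) ∧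
      -- `[v^{[1]}, v^{[0]}] = 0`
      ABSLattice.EqAt (ABSLattice.regular d) α β
        ((e.vk A B d 1).bracket (e.vk A B d 0)) (ABSLattice.ofChar 0)) ∧
    -- Commutation relations between the two directions:
    ABSLattice.EqAt (ABSLattice.regular .n ∩ ABSLattice.regular .m) α β
      ((e.V A B .n).bracket (e.v A B .m))
      (ABSLattice.ofChar fun p u α β =>
        (p.1 : ℂ) * ((e.v A B .n).bracket (e.v A B .m)).char p u α β) ∧
    ABSLattice.EqAt (ABSLattice.regular .n ∩ ABSLattice.regular .m) α β
      ((e.V A B .m).bracket (e.v A B .n))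
      (ABSLattice.ofChar fun p u α β =>
        (p.2 : ℂ) * ((e.v A B .m).bracket (e.v A B .n)).char p u α β) ∧
    (∀ w ∈ ([(e.v A B .n).bracket (e.v A B .m),
        (e.V A B .n).bracket (e.v A B .m),
        (e.V A B .m).bracket (e.v A B .n),
        (e.vk A B .n 1).bracket (e.vk A B .m 0),
        (e.vk A B .n 1).bracket (e.V A B .m),
        (e.vk A B .m 1).bracket (e.vk A B .n 0),
        (e.vk A B .m 1).bracket (e.V A B .n),
        (e.vk A B .n 1).bracket (e.vk A B .m 1)] : List ABSLattice.VField),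
      e.IsTrivial A B (ABSLattice.regular .n ∩ ABSLattice.regular .m) α β w) := by
  refine ⟨fun d => ⟨ABSLattice.ABS.isSymmetry_V hα hβ hαβ d, ABSLattice.ABS.isMasterSymmetry hα hβ d,
    fun p u hu => ⟨ABSLattice.ABS.vk_one_eq hα hβ p hu, ABSLattice.ABS.vk_one_explicit hα hβ p hu⟩,
    fun k => ⟨ABSLattice.ABS.isSymmetry_vk hα hβ hαβ d k, ABSLattice.ABS.vk_eq_iterate hα hβ k,
      fun p u hu w hw h => ABSLattice.ABS.vk_congr hα hβ k p hu hw h,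
      fun p u hu h => ABSLattice.ABS.dU_vk_ne hα hβ k p hu h⟩,
    ABSLattice.ABS.bracket_vk_one hα hβ d⟩, ABSLattice.ABS.bracket_V_v hα hβ (d := .n) (d' := .m) (by simp),
    ABSLattice.ABS.bracket_V_v hα hβ (d := .m) (d' := .n) (by simp), ?_⟩
  have hn : ABSLattice.Dir.n ≠ ABSLattice.Dir.m := by simp
  have hm : ABSLattice.Dir.m ≠ ABSLattice.Dir.n := by simp
  intro w hw
  simp only [List.mem_cons, List.not_mem_nil, or_false] at hw
  rcases hw with rfl | rfl | rfl | rfl | rfl | rfl | rfl | rfl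
  · exact ABSLattice.ABS.isTrivial_bracket_vk hα hβ hαβ (k := 0) (l := 0) hm zero_le_one zero_le_one
  · exact ABSLattice.ABS.isTrivial_bracket_V_vk hα hβ hαβ (l := 0) hm zero_le_one
  · exact ABSLattice.ABS.isTrivial_bracket_V_vk hα hβ hαβ (l := 0) hn zero_le_one
  · exact ABSLattice.ABS.isTrivial_bracket_vk hα hβ hαβ hm le_rfl zero_le_one
  · exact ABSLattice.ABS.isTrivial_bracket_vk_V hα hβ hαβ hn le_rfl
  · exact ABSLattice.ABS.isTrivial_bracket_vk hα hβ hαβ hn le_rfl zero_le_one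
  · exact ABSLattice.ABS.isTrivial_bracket_vk_V hα hβ hαβ hm le_rfl
  · exact ABSLattice.ABS.isTrivial_bracket_vk hα hβ hαβ hm le_rfl le_rfl
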